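/- A two-state spin system with external field $\lambda>0$ is given by instances $G(V,\mathcal{E},(\beta,\gamma))$, where $V$ is a finite set, $\mathcal{E}\subseteq 2^V$ is a set of hyperedges, and $\beta,\gamma:\mathcal{E}\to\mathbb{R}$. A configuration $\sigma:V\to\{0,1\}$ has weight $$w(\sigma)=\prod_{e\in\mathcal{E}}w(e,\sigma)\cdot\lambda^{|\{v\in V:\ \sigma(v)=1\}|},$$ where $w(e,\sigma)=\beta(e)$ if $\sigma\equiv 0$ on $e$, $w(e,\sigma)=\gamma(e)$ if $\sigma\equiv 1$ on $e$ (for $e=\varnothing$ the first case applies), and $w(e,\sigma)=1$ otherwise. The partition function is $Z(G)=\sum_{\sigma\in\{0,1\}^V}w(\sigma)$. The degree of a vertex is the number of hyperedges that contain it; there is no restriction on the sizes of hyperedges. **Theorem.** Let $\lambda>0$ be a real constant and let $D\ge 0$ be an integer constant. Consider the class of all instances $G(V,\mathcal{E},(\beta,\gamma))$ whose maximum degree $\Delta=\Delta(G)$ is at most $D$ and which satisfy $$1-\frac{2}{2e^{-1/2}\Delta+3}\ \le\ \beta(e),\gamma(e)\ \le\ 1\qquad\text{for every } e\in\mathcal{E}.$$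 There is an FPTAS for the partition function on this class: a deterministic algorithm (depending only on $\lambda$ and $D$) which, given an instance $G$ of the class and $\varepsilon\in(0,1)$, outputs a number $\hat Z$ with $|\hat Z-Z(G)|\le\varepsilon Z(G)$, in time polynomial in the size of the input and in $1/\varepsilon$. The algorithm is a program that is given $\lambda$, $\varepsilon$ and $G$, that contains no numbers besides finitely many rational constants, and that operates on numbers only by the field operations and the comparison $<$. The time bound holds in both of the usual senses: for arbitrary real $\lambda,\varepsilon,\beta,\gamma$ when every operation has unit cost, with the size of the input measured by $|V|+\sum_{e\in\mathcal{E}}(1+|e|)$; and, if $\lambda,\varepsilon$ and all $\beta(e),\gamma(e)$ are rational, also when every operation on numbers is charged the binary lengths of its operands and the size of the input includes the binary lengths of $\varepsilon$ and of all labels. -/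

import Mathlib

open Finset

noncomputable section

/-! ## Two-state spin systems on hypergraphs -/

/-- A labelled hypergraph `G(V, 𝓔, (β, γ))`: a set of hyperedges (subsets of `V`) together with
two real labels on every hyperedge.  Only the values of `β` and `γ` on `edges` are ever used. -/
structure SpinSystem (V : Type) where
  edges : Finset (Finset V)
  β : Finset V → ℝ
  γ : Finset V → ℝ

namespace SpinSystem

variable {V : Type} [Fintype V] [DecidableEq V]

/-- The weight `w(e, σ)`; the spin `0` is `false`, the spin `1` is `true`. -/
def edgeWeight (G : SpinSystem V) (e : Finset V) (σ : V → Bool) : ℝ :=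
  if ∀ v ∈ e, σ v = false then G.β e
  else if ∀ v ∈ e, σ v = true then G.γ e
  else 1

/-- The weight `w(v, σ)` for the external field `lam`. -/
def vertexWeight (lam : ℝ) (v : V) (σ : V → Bool) : ℝ :=
  if σ v = true then lam else 1

/-- The weight of a configuration. -/
def weight (lam : ℝ) (G : SpinSystem V) (σ : V → Bool) : ℝ :=
  (∏ e ∈ G.edges, G.edgeWeight e σ) * ∏ v, vertexWeight lam v σ

/-- The partition function `Z(G)`. -/
def partitionFunction (lam : ℝ) (G : SpinSystem V) : ℝ :=
  ∑ σ : V → Bool, weight lam G σ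

/-- The number of hyperedges that contain `v`. -/
def degree (G : SpinSystem V) (v : V) : ℕ :=
  #{e ∈ G.edges | v ∈ e}

/-- The maximum degree (`0` if there are no vertices). -/
def maxDegree (G : SpinSystem V) : ℕ :=
  univ.sup G.degree

/-- Every label lies between `1 - 2 / (2 e^{-1/2} Δ + 3)` and `1`, where `Δ` is the maximum degree
of the instance. -/
def LabelsInRange (G : SpinSystem V) : Prop :=
  ∀ e ∈ G.edges,
    (1 - 2 / (2 * Real.exp (-1 / 2) * (G.maxDegree : ℝ) + 3) ≤ G.β e ∧ G.β e ≤ 1) ∧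
    (1 - 2 / (2 * Real.exp (-1 / 2) * (G.maxDegree : ℝ) + 3) ≤ G.γ e ∧ G.γ e ≤ 1)

end SpinSystem

/-! ## The model of computation

A first-order functional language with recursion.  Data are binary trees whose leaves are numbers
or `nil`.  A program can combine numbers only by the four field operations and inspect them only by
the test `<`; the only numbers it contains itself are finitely many rationals. -/

/-- Data. -/
inductive Val : Type
  | num (x : ℝ)
  | nil
  | pair (a b : Val)

/-- The list `[v₁, …, vₘ]` is stored as `pair v₁ (pair v₂ (… (pair vₘ nil)))`. -/
def Val.ofList : List Val → Val
  | [] => Val.nil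
  | v :: l => Val.pair v (Val.ofList l)

/-- The arithmetic operations. -/
inductive ArithOp : Type
  | add
  | sub
  | mul
  | div

/-- `o.Result x y z` : the operation `o`, applied to `x` and `y`, is defined and returns `z`. -/
def ArithOp.Result : ArithOp → ℝ → ℝ → ℝ → Prop
  | .add, x, y, z => z = x + y
  | .sub, x, y, z => z = x - y
  | .mul, x, y, z => z = x * y
  | .div, x, y, z => y ≠ 0 ∧ z = x / y

/-- Expressions.  Variables are de Bruijn indices into the current environment. -/
inductive Code : Type
  /-- the value of the `i`-th variable -/
  | var (i : ℕ)
  /-- a rational constant -/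
  | const (q : ℚ)
  /-- the empty tree -/
  | nil
  /-- the tree with the two given subtrees -/
  | pair (a b : Code)
  /-- `let x := a; b`, where `x` is variable `0` in `b` -/
  | letIn (a b : Code)
  /-- arithmetic -/
  | arith (o : ArithOp) (a b : Code)
  /-- `if a < b then c else d` -/
  | ifLt (a b c d : Code)
  /-- if `a` is a pair then `b`, with its components as variables `0` and `1`; otherwise `c` -/
  | split (a b c : Code)
  /-- apply the `f`-th function of the program to the value of `a` -/
  | call (f : ℕ) (a : Code)

/-- A program is a finite list of function bodies.  Each function has one argument, which is
variable `0` of its body; functions may call each other recursively; function `0` is the main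
one. -/
abbrev Program : Type := List Code

/-- `Runs size P ρ c v t` : in the environment `ρ`, evaluating `c` terminates with value `v`, at
total cost `t`.  Every evaluation step costs one unit, and an arithmetic operation or a comparison
costs moreover the `size` of its two operands. -/
inductive Runs (size : ℝ → ℕ) (P : Program) : List Val → Code → Val → ℕ → Prop
  | var {ρ : List Val} {i : ℕ} {v : Val} (h : ρ[i]? = some v) :
      Runs size P ρ (.var i) v 1
  | const {ρ : List Val} {q : ℚ} :
      Runs size P ρ (.const q) (.num (q : ℝ)) 1
  | nil {ρ : List Val} :
      Runs size P ρ .nil .nil 1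
  | pair {ρ : List Val} {a b : Code} {u v : Val} {s t : ℕ}
      (ha : Runs size P ρ a u s) (hb : Runs size P ρ b v t) :
      Runs size P ρ (.pair a b) (.pair u v) (s + t + 1)
  | letIn {ρ : List Val} {a b : Code} {u v : Val} {s t : ℕ}
      (ha : Runs size P ρ a u s) (hb : Runs size P (u :: ρ) b v t) :
      Runs size P ρ (.letIn a b) v (s + t + 1)
  | arith {ρ : List Val} {o : ArithOp} {a b : Code} {x y z : ℝ} {s t : ℕ}
      (ha : Runs size P ρ a (.num x) s) (hb : Runs size P ρ b (.num y) t)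
      (h : o.Result x y z) :
      Runs size P ρ (.arith o a b) (.num z) (s + t + size x + size y + 1)
  | ifLt_true {ρ : List Val} {a b c d : Code} {x y : ℝ} {v : Val} {s t r : ℕ}
      (ha : Runs size P ρ a (.num x) s) (hb : Runs size P ρ b (.num y) t)
      (h : x < y) (hc : Runs size P ρ c v r) :
      Runs size P ρ (.ifLt a b c d) v (s + t + r + size x + size y + 1)
  | ifLt_false {ρ : List Val} {a b c d : Code} {x y : ℝ} {v : Val} {s t r : ℕ}
      (ha : Runs size P ρ a (.num x) s) (hb : Runs size P ρ b (.num y) t)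
      (h : ¬ x < y) (hd : Runs size P ρ d v r) :
      Runs size P ρ (.ifLt a b c d) v (s + t + r + size x + size y + 1)
  | split_pair {ρ : List Val} {a b c : Code} {u₁ u₂ v : Val} {s t : ℕ}
      (ha : Runs size P ρ a (.pair u₁ u₂) s) (hb : Runs size P (u₁ :: u₂ :: ρ) b v t) :
      Runs size P ρ (.split a b c) v (s + t + 1)
  | split_leaf {ρ : List Val} {a b c : Code} {u v : Val} {s t : ℕ}
      (ha : Runs size P ρ a u s) (hu : ∀ u₁ u₂, u ≠ .pair u₁ u₂) (hc : Runs size P ρ c v t) :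
      Runs size P ρ (.split a b c) v (s + t + 1)
  | call {ρ : List Val} {f : ℕ} {a body : Code} {u v : Val} {s t : ℕ}
      (ha : Runs size P ρ a u s) (hf : P[f]? = some body) (hb : Runs size P [u] body v t) :
      Runs size P ρ (.call f a) v (s + t + 1)

/-- On input `input` the program `P` halts with output `out`, at cost `t`. -/
def Program.Outputs (P : Program) (size : ℝ → ℕ) (input out : Val) (t : ℕ) : Prop :=
  Runs size P [input] (.call 0 (.var 0)) out t

/-- The length of a rational number in binary: the number of bits of its numerator plus the number
of bits of its denominator, in lowest terms (`0` for irrational numbers, where it is not used). -/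
def bitLength (x : ℝ) : ℕ :=
  sInf {m : ℕ | ∃ q : ℚ, (q : ℝ) = x ∧ m = q.num.natAbs.size + q.den.size}

/-- A way of measuring cost: which numbers may occur in the input, and the size of a number. -/
structure CostModel where
  carrier : Set ℝ
  size : ℝ → ℕ

/-- Unit cost: arbitrary real numbers, each of size one. -/
def realCost : CostModel where
  carrier := Set.univ
  size := fun _ => 1

/-- Bit cost: rational numbers, each of size its length in binary. -/
def bitCost : CostModel where
  carrier := Set.range fun q : ℚ => (q : ℝ)
  size := bitLength

/-! ## Approximation schemes for the partition function -/

namespace SpinSystem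

/-- A hyperedge, given as a list of its vertices, is stored with its two labels. -/
def encodeEdge {n : ℕ} (G : SpinSystem (Fin n)) (l : List (Fin n)) : Val :=
  .pair (.num (G.β l.toFinset)) (.pair (.num (G.γ l.toFinset))
    (Val.ofList (l.map fun v => .num ((v : ℕ) : ℝ))))

/-- `x` stores `G`: the number of vertices, and a list of the hyperedges without repetitions, each
as a list of its vertices without repetitions, in any order. -/
def IsEncoding {n : ℕ} (G : SpinSystem (Fin n)) (x : Val) : Prop :=
  ∃ L : List (List (Fin n)),
    (∀ l ∈ L, l.Nodup) ∧ (L.map List.toFinset).Nodup ∧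
    (L.map List.toFinset).toFinset = G.edges ∧
    x = .pair (.num (n : ℝ)) (Val.ofList (L.map G.encodeEdge))

/-- The size of an instance. -/
def inputSize {n : ℕ} (M : CostModel) (G : SpinSystem (Fin n)) : ℕ :=
  n + ∑ e ∈ G.edges, (1 + #e + M.size (G.β e) + M.size (G.γ e))

/-- `P` is a fully polynomial-time approximation scheme, in the cost model `M`, for the partition
function with external field `lam` on the class `𝒞` of instances.  On input `(lam, ε, G)`, with
`G ∈ 𝒞` and all numbers from the carrier of `M`, it outputs an approximation of `Z(G)` with relative
error at most `ε`, at a cost that is polynomial in the size of the input and in `1 / ε`. -/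
def IsFPTAS (M : CostModel) (P : Program) (lam : ℝ)
    (𝒞 : ∀ n : ℕ, Set (SpinSystem (Fin n))) : Prop :=
  ∃ C k : ℕ, ∀ (n : ℕ) (G : SpinSystem (Fin n)) (ε : ℝ) (x : Val),
    G ∈ 𝒞 n → lam ∈ M.carrier → ε ∈ M.carrier →
    (∀ e ∈ G.edges, G.β e ∈ M.carrier ∧ G.γ e ∈ M.carrier) →
    0 < ε → ε < 1 → G.IsEncoding x →
    ∃ (Z' : ℝ) (t : ℕ),
      P.Outputs M.size (.pair (.num lam) (.pair (.num ε) x)) (.num Z') t ∧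
      |Z' - G.partitionFunction lam| ≤ ε * G.partitionFunction lam ∧
      (t : ℝ) ≤ C * (((G.inputSize M + M.size ε : ℕ) : ℝ) + 1 / ε) ^ k

/-- The instances whose maximum degree is at most `D` and whose labels are in the range that
belongs to their own maximum degree. -/
def boundedClass (D : ℕ) (n : ℕ) : Set (SpinSystem (Fin n)) :=
  {G | G.maxDegree ≤ D ∧ G.LabelsInRange}

end SpinSystem

end

set_option linter.unusedSectionVars false

/-! The proof is a correlation-decay argument. Let `R` be the ratio between the probabilities of the
spins 1 and 0 at a vertex `u`. Switch the hyperedges through `u` from "u has spin 0" to "u has spin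
1" one at a time. Each switch multiplies the ratio by `(1 - (1 - γ) p) / (1 - (1 - β) q)`, where `p`
and `q` are the probabilities that all other vertices of the hyperedge have spin 1, respectively 0,
in the intermediate instance. The chain rule writes `p` and `q` as products of conditional
marginals, each given by a ratio in an instance with more pinned vertices. Hence `R` satisfies an
exact recursion (`loop_ratio`), and the partition function is the weight of the all-zero
configuration times a product of terms `1 + R` (`Lists.partitionFunction_eq`).

In the coordinates `log R` the recursion contracts. A marginal is the logistic function of `± log
R`, so the sensitivity of a product `∏ p` to its log-ratios is its influence `∏ p * ∑ (1 - p)`,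
which is at most `x * exp (-x)` when `x` is one of the marginals. The first vertex of a hyperedge
has complementary marginals `x` and `1 - x` in `p` and `q`; the tangent of `x * exp (-x)` at `1/2`
bounds the two influences together by `exp (-1/2)` (`influence_add_le`). Labels within `δ` of 1 add
the factor `δ / (1 - δ)`, and the assumed range makes `Δ * δ / (1 - δ) * exp (-1/2)` smaller than 1.

Hyperedges may be arbitrarily large, so truncation at a fixed depth would be too expensive. The
recursion instead carries a budget `N`, passes `N / (C (m + 1))` to the ratios at the `m` other
vertices of a hyperedge, and stops below 1. The two products need at most `2 m` recursive calls, so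
the work is linear in `N` up to polynomial factors (`fn_approx`). All ratios are bounded away from 0
and infinity, so the influence is also `O(m q ^ m)` with `q < 1`; this outweighs the loss `(C (m +
1)) ^ (1 / T)` once `T` is large (`exists_root_contraction`). The error is thus `O(N ^ (-1 / T))`
(`approx_log_sub_le`), and `N = (K (n + 1) / ε) ^ T` suffices (`accuracy`).

For bit cost no rounding is needed. The height of a number grows additively under arithmetic, and
the same accounting shows that the heights of the exact rational values are linear in the budget
(`approx_bounded`). One analysis of the program, over an abstract height (`IsHeight`), covers both
cost models. -/

/-- A hyperedge stored as a list of vertices, with its two labels. -/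
structure WEdge (V : Type) where
  b : ℝ
  g : ℝ
  verts : List V

/-! ### Hyperedges with one spin fixed. -/

namespace WEdge

variable {V : Type} [DecidableEq V]

/-- The weight of a stored hyperedge; an empty hyperedge contributes both labels. -/
noncomputable def weight (e : WEdge V) (σ : V → Bool) : ℝ :=
  (if ∀ v ∈ e.verts, σ v = false then e.b else 1) *
    (if ∀ v ∈ e.verts, σ v = true then e.g else 1)

/-- The hyperedge that remains when the spin of `u` is fixed to `s`. -/
noncomputable def restrict (s : Bool) (u : V) (e : WEdge V) : WEdge V :=
  if u ∈ e.verts then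
    (if s = true then ⟨1, e.g, e.verts.erase u⟩ else ⟨e.b, 1, e.verts.erase u⟩)
  else e

theorem forall_mem_erase_iff {l : List V} {u : V} {σ : V → Bool} {s : Bool}
    (hs : σ u = s) : (∀ v ∈ l.erase u, σ v = s) ↔ ∀ v ∈ l, σ v = s := by
  constructor
  · intro h v hv
    by_cases hvu : v = u
    · rw [hvu, hs]
    · exact h v ((List.mem_erase_of_ne hvu).2 hv)
  · intro h v hv
    exact h v (List.mem_of_mem_erase hv)

/-- Spin `s` at `u` excludes the opposite constant value on the hyperedge, so that label may be
replaced by 1. If nothing remains of the hyperedge, the surviving label must still count whichever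
one it is; this is why an empty stored hyperedge carries both labels. -/
theorem restrict_weight (e : WEdge V) {u : V} {σ : V → Bool} {s : Bool} (hs : σ u = s) :
    (restrict s u e).weight σ = e.weight σ := by
  unfold restrict
  split_ifs with hu h
  · subst h
    have h1 : ¬ ∀ v ∈ e.verts, σ v = false := fun h => by simp [h u hu] at hs
    simp only [weight, forall_mem_erase_iff hs, if_neg h1]
    simp
  · have h' : s = false := by simpa using h
    subst h'
    have h1 : ¬ ∀ v ∈ e.verts, σ v = true := fun h => by simp [h u hu] at hs
    simp only [weight, forall_mem_erase_iff hs, if_neg h1]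
    simp
  · rfl

theorem notMem_restrict {s : Bool} {u : V} {e : WEdge V} (hn : e.verts.Nodup) :
    u ∉ (restrict s u e).verts := by
  unfold restrict
  split_ifs with hu h
  · exact hn.not_mem_erase
  · exact hn.not_mem_erase
  · exact hu

theorem restrict_sublist (s : Bool) (u : V) (e : WEdge V) :
    (restrict s u e).verts.Sublist e.verts := by
  unfold restrict
  split_ifs with hu h
  · exact List.erase_sublist
  · exact List.erase_sublist
  · exact List.Sublist.refl _

theorem weight_update {e : WEdge V} {u : V} (hu : u ∉ e.verts) (σ : V → Bool) (x : Bool) :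
    e.weight (Function.update σ u x) = e.weight σ := by
  have h : ∀ s, (∀ v ∈ e.verts, Function.update σ u x v = s) ↔ ∀ v ∈ e.verts, σ v = s := by
    intro s
    refine forall₂_congr fun v hv => ?_
    rw [Function.update_of_ne (ne_of_mem_of_not_mem hv hu)]
  simp only [weight, h]

theorem weight_pos {e : WEdge V} (hb : 0 < e.b) (hg : 0 < e.g) (σ : V → Bool) :
    0 < e.weight σ := by
  unfold weight
  split_ifs <;> simp [hb, hg]

end WEdge

/-! ### Admissible lists of hyperedges and pinning. -/

namespace Hyp

variable {V : Type} [DecidableEq V]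

/-- All hyperedges after the spin of `u` has been fixed to `s`. -/
noncomputable def pin (s : Bool) (u : V) (H : List (WEdge V)) : List (WEdge V) :=
  H.map (WEdge.restrict s u)

/-- The number of hyperedges through `u`. -/
def deg (u : V) (H : List (WEdge V)) : ℕ :=
  H.countP fun e => decide (u ∈ e.verts)

/-- All labels lie in `S`, no hyperedge repeats a vertex, and all degrees are at most `d`. -/
structure Adm (S : Set ℝ) (d : ℕ) (H : List (WEdge V)) : Prop where
  b_mem : ∀ e ∈ H, e.b ∈ S
  g_mem : ∀ e ∈ H, e.g ∈ S
  nodup : ∀ e ∈ H, e.verts.Nodup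
  deg_le : ∀ u, deg u H ≤ d

theorem deg_append (u : V) (H K : List (WEdge V)) : deg u (H ++ K) = deg u H + deg u K := by
  simp [deg]

theorem deg_cons (u : V) (e : WEdge V) (H : List (WEdge V)) :
    deg u (e :: H) = deg u H + if u ∈ e.verts then 1 else 0 := by
  simp [deg, List.countP_cons]

theorem deg_pin_le (s : Bool) (u w : V) (H : List (WEdge V)) : deg w (pin s u H) ≤ deg w H := by
  unfold deg pin
  rw [List.countP_map]
  refine List.countP_mono_left fun e _ h => ?_
  simp only [Function.comp, decide_eq_true_eq] at h ⊢
  exact (WEdge.restrict_sublist s u e).subset h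

theorem restrict_b_mem {S : Set ℝ} (h1 : (1 : ℝ) ∈ S) {s : Bool} {u : V} {e : WEdge V}
    (hb : e.b ∈ S) : (WEdge.restrict s u e).b ∈ S := by
  unfold WEdge.restrict
  split_ifs <;> assumption

theorem restrict_g_mem {S : Set ℝ} (h1 : (1 : ℝ) ∈ S) {s : Bool} {u : V} {e : WEdge V}
    (hg : e.g ∈ S) : (WEdge.restrict s u e).g ∈ S := by
  unfold WEdge.restrict
  split_ifs <;> assumption

/-- Intermediate instances of the recursion have this shape: `H` holds the hyperedges still to be
switched, `K` those already treated. Pinning only erases vertices and replaces labels by 1. -/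
theorem Adm.pin_append {S : Set ℝ} (h1 : (1 : ℝ) ∈ S) {d : ℕ} {H K : List (WEdge V)}
    (h : Adm S d (H ++ K)) (s : Bool) (u : V) : Adm S d (pin s u H ++ K) := by
  refine ⟨?_, ?_, ?_, ?_⟩
  · intro e he
    rcases List.mem_append.1 he with he | he
    · obtain ⟨f, hf, rfl⟩ := List.mem_map.1 he
      exact restrict_b_mem h1 (h.b_mem f (List.mem_append_left _ hf))
    · exact h.b_mem e (List.mem_append_right _ he)
  · intro e he
    rcases List.mem_append.1 he with he | he
    · obtain ⟨f, hf, rfl⟩ := List.mem_map.1 he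
      exact restrict_g_mem h1 (h.g_mem f (List.mem_append_left _ hf))
    · exact h.g_mem e (List.mem_append_right _ he)
  · intro e he
    rcases List.mem_append.1 he with he | he
    · obtain ⟨f, hf, rfl⟩ := List.mem_map.1 he
      exact (h.nodup f (List.mem_append_left _ hf)).sublist (WEdge.restrict_sublist s u f)
    · exact h.nodup e (List.mem_append_right _ he)
  · intro w
    have := h.deg_le w
    rw [deg_append] at this ⊢
    have := deg_pin_le s u w H
    omega

theorem Adm.pin {S : Set ℝ} (h1 : (1 : ℝ) ∈ S) {d : ℕ} {H : List (WEdge V)}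
    (h : Adm S d H) (s : Bool) (u : V) : Adm S d (pin s u H) := by
  have := Adm.pin_append h1 (K := []) (by simpa using h) s u
  simpa using this

theorem Adm.of_perm {S : Set ℝ} {d : ℕ} {H K : List (WEdge V)} (h : Adm S d H)
    (p : H.Perm K) : Adm S d K :=
  ⟨fun e he => h.b_mem e (p.mem_iff.2 he), fun e he => h.g_mem e (p.mem_iff.2 he),
    fun e he => h.nodup e (p.mem_iff.2 he),
    fun u => by rw [deg, ← p.countP_eq]; exact h.deg_le u⟩

theorem Adm.tail {S : Set ℝ} {d : ℕ} {e : WEdge V} {H : List (WEdge V)}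
    (h : Adm S d (e :: H)) : Adm S d H :=
  ⟨fun f hf => h.b_mem f (List.mem_cons_of_mem _ hf),
    fun f hf => h.g_mem f (List.mem_cons_of_mem _ hf),
    fun f hf => h.nodup f (List.mem_cons_of_mem _ hf), fun u => by
      have := h.deg_le u
      rw [deg_cons] at this
      omega⟩

theorem Adm.rotate {S : Set ℝ} {d : ℕ} {e : WEdge V} {H K : List (WEdge V)}
    (h : Adm S d (e :: H ++ K)) : Adm S d (H ++ e :: K) :=
  h.of_perm (by simpa using List.perm_middle.symm)

theorem Adm.rotate_erase {S : Set ℝ} (h1 : (1 : ℝ) ∈ S) {d : ℕ} {e : WEdge V}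
    {H K : List (WEdge V)} (h : Adm S d (e :: H ++ K)) (u : V) :
    Adm S d (H ++ ⟨1, e.g, e.verts.erase u⟩ :: K) := by
  refine Adm.of_perm (H := ⟨1, e.g, e.verts.erase u⟩ :: (H ++ K)) ?_
    (by simpa using List.perm_middle.symm)
  have ht : Adm S d (H ++ K) := Adm.tail h
  refine ⟨?_, ?_, ?_, ?_⟩
  · intro f hf
    rcases List.mem_cons.1 hf with rfl | hf
    · exact h1
    · exact ht.b_mem f hf
  · intro f hf
    rcases List.mem_cons.1 hf with rfl | hf
    · exact h.g_mem e (by simp)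
    · exact ht.g_mem f hf
  · intro f hf
    rcases List.mem_cons.1 hf with rfl | hf
    · exact (h.nodup e (by simp)).sublist List.erase_sublist
    · exact ht.nodup f hf
  · intro w
    have := h.deg_le w
    rw [List.cons_append, deg_cons] at this
    rw [deg_cons]
    by_cases hw : w ∈ e.verts.erase u
    · have := List.mem_of_mem_erase hw
      simp_all
    · simp only [hw, if_false]
      omega

/-! ### Partition functions of pinned instances. -/

variable [Fintype V]

/-- The weight of a configuration, without the external field. -/
noncomputable def wt (H : List (WEdge V)) (σ : V → Bool) : ℝ := (H.map fun e => e.weight σ).prod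

/-- The weight of the external field. -/
noncomputable def field (lam : ℝ) (σ : V → Bool) : ℝ :=
  ∏ v, SpinSystem.vertexWeight lam v σ

/-- The total weight of the configurations that are constantly `s` on `l`. -/
noncomputable def mass (lam : ℝ) (H : List (WEdge V)) (s : Bool) (l : List V) : ℝ :=
  ∑ σ : V → Bool, if ∀ v ∈ l, σ v = s then wt H σ * field lam σ else 0

/-- The partition function. -/
noncomputable def Z (lam : ℝ) (H : List (WEdge V)) : ℝ :=
  ∑ σ : V → Bool, wt H σ * field lam σ

/-- The weight of spin `s` at an isolated vertex, normalised. -/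
noncomputable def bias (lam : ℝ) (s : Bool) : ℝ := if s = true then lam / (1 + lam) else 1 / (1 + lam)

theorem mass_nil (lam : ℝ) (H : List (WEdge V)) (s : Bool) : mass lam H s [] = Z lam H := by
  simp [mass, Z]

theorem field_update (lam : ℝ) (σ : V → Bool) (u : V) (x : Bool) :
    field lam (Function.update σ u x) =
      (if x = true then lam else 1) * ∏ v ∈ univ.erase u, SpinSystem.vertexWeight lam v σ := by
  unfold field
  rw [← Finset.mul_prod_erase univ _ (mem_univ u)]
  congr 1
  · simp [SpinSystem.vertexWeight]
  · refine Finset.prod_congr rfl fun v hv => ?_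
    simp [SpinSystem.vertexWeight, Function.update_of_ne (Finset.ne_of_mem_erase hv)]

/-- Flipping the spin of `u` is a bijection between the two halves of the sum and multiplies the
field by `lam` or its inverse. -/
theorem sum_fix_eq {lam : ℝ} (hl : 0 < lam) (u : V) (s : Bool) (F : (V → Bool) → ℝ)
    (hF : ∀ σ x, F (Function.update σ u x) = F σ) :
    (∑ σ : V → Bool, if σ u = s then F σ * field lam σ else 0) =
      bias lam s * ∑ σ : V → Bool, F σ * field lam σ := by
  have hsplit : ∀ G : (V → Bool) → ℝ, ∑ σ : V → Bool, G σ =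
      (∑ σ : V → Bool, if σ u = true then G σ else 0) +
        ∑ σ : V → Bool, if σ u = false then G σ else 0 := by
    intro G
    rw [← Finset.sum_add_distrib]
    refine Finset.sum_congr rfl fun σ _ => ?_
    cases σ u <;> simp
  have hflip : (∑ σ : V → Bool, if σ u = true then F σ * field lam σ else 0) =
      lam * ∑ σ : V → Bool, if σ u = false then F σ * field lam σ else 0 := by
    rw [Finset.mul_sum]
    refine Finset.sum_bij' (fun σ _ => Function.update σ u (!σ u))
      (fun σ _ => Function.update σ u (!σ u)) (by simp) (by simp) ?_ ?_ ?_
    · intro σ _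
      simp
    · intro σ _
      simp
    · intro σ _
      have h1 : ∀ x, field lam (Function.update σ u x) =
        (if x = true then lam else 1) * ∏ v ∈ univ.erase u, SpinSystem.vertexWeight lam v σ :=
        field_update lam σ u
      have h2 := h1 (σ u)
      rw [Function.update_eq_self] at h2
      by_cases h : σ u = true
      · simp [hF, h1, h, h2]
        ring
      · have : σ u = false := by simpa using h
        simp [this]
  have h0 : (1 + lam) ≠ 0 := by positivity
  rw [hsplit (fun σ => F σ * field lam σ), hflip]
  cases s
  · simp [bias]
    field_simp
    ring
  · rw [hflip]
    simp [bias]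
    field_simp
    ring

theorem wt_pin {H : List (WEdge V)} {s : Bool} {u : V} {σ : V → Bool} (hs : σ u = s) :
    wt (pin s u H) σ = wt H σ := by
  unfold wt pin
  rw [List.map_map]
  congr 1
  refine List.map_congr_left fun e _ => ?_
  exact WEdge.restrict_weight e hs

theorem wt_pin_update {H : List (WEdge V)} (hn : ∀ e ∈ H, e.verts.Nodup) (s : Bool) (u : V)
    (σ : V → Bool) (x : Bool) : wt (pin s u H) (Function.update σ u x) = wt (pin s u H) σ := by
  unfold wt pin
  rw [List.map_map, List.map_map]
  congr 1
  refine List.map_congr_left fun e he => ?_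
  exact WEdge.weight_update (WEdge.notMem_restrict (hn e he)) σ x

/-- Pinned vertices are not deleted: they stay as isolated vertices, and `bias` removes the weight
of their free spin. -/
theorem mass_cons {lam : ℝ} (hl : 0 < lam) {H : List (WEdge V)}
    (hn : ∀ e ∈ H, e.verts.Nodup) (s : Bool) {u : V} {l : List V} (hu : u ∉ l) :
    mass lam H s (u :: l) = bias lam s * mass lam (pin s u H) s l := by
  have := sum_fix_eq hl u s (fun σ => if ∀ v ∈ l, σ v = s then wt (pin s u H) σ else 0) ?_
  · simp only [ite_mul, zero_mul] at this
    unfold mass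
    rw [← this]
    refine Finset.sum_congr rfl fun σ _ => ?_
    by_cases h : σ u = s
    · simp [h, wt_pin h]
    · simp [h]
  · intro σ x
    have h : (∀ v ∈ l, Function.update σ u x v = s) ↔ ∀ v ∈ l, σ v = s := by
      refine forall₂_congr fun v hv => ?_
      rw [Function.update_of_ne (ne_of_mem_of_not_mem hv hu)]
    simp only [h, wt_pin_update hn]

theorem mass_single {lam : ℝ} (hl : 0 < lam) {H : List (WEdge V)}
    (hn : ∀ e ∈ H, e.verts.Nodup) (s : Bool) (u : V) :
    mass lam H s [u] = bias lam s * Z lam (pin s u H) := by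
  rw [mass_cons hl hn s (by simp), mass_nil]

theorem Z_eq_pin {lam : ℝ} (hl : 0 < lam) {H : List (WEdge V)}
    (hn : ∀ e ∈ H, e.verts.Nodup) (u : V) :
    Z lam H = bias lam true * Z lam (pin true u H) + bias lam false * Z lam (pin false u H) := by
  rw [← mass_single hl hn, ← mass_single hl hn]
  unfold Z mass
  rw [← Finset.sum_add_distrib]
  refine Finset.sum_congr rfl fun σ _ => ?_
  cases h : σ u <;> simp [h]

theorem wt_perm {H K : List (WEdge V)} (p : H.Perm K) (σ : V → Bool) : wt H σ = wt K σ :=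
  (p.map _).prod_eq

theorem Z_perm (lam : ℝ) {H K : List (WEdge V)} (p : H.Perm K) : Z lam H = Z lam K := by
  unfold Z
  simp only [wt_perm p]

/-- Such a hyperedge acts only on configurations that are constantly 1 on `l`, where it replaces the
factor 1 by `1 - (1 - g)`. -/
theorem Z_cons_true (lam g : ℝ) (l : List V) (H : List (WEdge V)) :
    Z lam (⟨1, g, l⟩ :: H) = Z lam H - (1 - g) * mass lam H true l := by
  unfold Z mass
  rw [Finset.mul_sum, ← Finset.sum_sub_distrib]
  refine Finset.sum_congr rfl fun σ _ => ?_
  simp only [wt, List.map_cons, List.prod_cons, WEdge.weight, ite_self, one_mul]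
  split_ifs <;> ring

theorem Z_cons_false (lam b : ℝ) (l : List V) (H : List (WEdge V)) :
    Z lam (⟨b, 1, l⟩ :: H) = Z lam H - (1 - b) * mass lam H false l := by
  unfold Z mass
  rw [Finset.mul_sum, ← Finset.sum_sub_distrib]
  refine Finset.sum_congr rfl fun σ _ => ?_
  simp only [wt, List.map_cons, List.prod_cons, WEdge.weight, ite_self, mul_one]
  split_ifs <;> ring

theorem field_pos {lam : ℝ} (hl : 0 < lam) (σ : V → Bool) : 0 < field lam σ := by
  refine Finset.prod_pos fun v _ => ?_
  unfold SpinSystem.vertexWeight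
  split_ifs <;> simp [hl]

theorem wt_pos {S : Set ℝ} (hS : ∀ x ∈ S, 0 < x) {d : ℕ} {H : List (WEdge V)}
    (h : Adm S d H) (σ : V → Bool) : 0 < wt H σ := by
  refine List.prod_pos fun x hx => ?_
  obtain ⟨e, he, rfl⟩ := List.mem_map.1 hx
  exact WEdge.weight_pos (hS _ (h.b_mem e he)) (hS _ (h.g_mem e he)) σ

theorem Z_pos {lam : ℝ} (hl : 0 < lam) {S : Set ℝ} (hS : ∀ x ∈ S, 0 < x) {d : ℕ}
    {H : List (WEdge V)} (h : Adm S d H) : 0 < Z lam H :=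
  Finset.sum_pos (fun σ _ => mul_pos (wt_pos hS h σ) (field_pos hl σ)) ⟨fun _ => true, mem_univ _⟩

/-! ### The exact recursion for ratios. -/

/-- The ratio between the probabilities of the spins `1` and `0` at `u`. -/
noncomputable def ratio (lam : ℝ) (u : V) (H : List (WEdge V)) : ℝ :=
  lam * (Z lam (pin true u H) / Z lam (pin false u H))

/-- The probability of the spin `s` when the ratio is `r`. -/
noncomputable def bern (s : Bool) (r : ℝ) : ℝ := if s = true then r / (1 + r) else 1 / (1 + r)

/-- The probability that all of `l` has spin `s`, from an oracle for ratios. -/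
noncomputable def chain (rat : V → List (WEdge V) → ℝ) (s : Bool) :
    List (WEdge V) → List V → ℝ
  | _, [] => 1
  | H, u :: l => bern s (rat u H) * chain rat s (pin s u H) l

/-- The effect of one hyperedge on a ratio. -/
noncomputable def factor (b g p q : ℝ) : ℝ := (1 - (1 - g) * p) / (1 - (1 - b) * q)

/-- The ratio at `u`, from an oracle for ratios at the other vertices of hyperedges through `u`.
The oracle is told the number of those vertices. -/
noncomputable def loop (lam : ℝ) (rat : ℕ → V → List (WEdge V) → ℝ) (u : V) :
    List (WEdge V) → List (WEdge V) → ℝ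
  | [], _ => lam
  | e :: H, acc =>
    if u ∈ e.verts then
      factor e.b e.g
        (chain (rat (e.verts.erase u).length) true (pin false u H ++ acc) (e.verts.erase u))
        (chain (rat (e.verts.erase u).length) false (pin false u H ++ acc) (e.verts.erase u)) *
      loop lam rat u H (⟨1, e.g, e.verts.erase u⟩ :: acc)
    else loop lam rat u H (e :: acc)

theorem ratio_pos {lam : ℝ} (hl : 0 < lam) {S : Set ℝ} (h1 : (1 : ℝ) ∈ S)
    (hS : ∀ x ∈ S, 0 < x) {d : ℕ} {H : List (WEdge V)} (h : Adm S d H) (u : V) :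
    0 < ratio lam u H :=
  mul_pos hl (div_pos (Z_pos hl hS (h.pin h1 true u)) (Z_pos hl hS (h.pin h1 false u)))

theorem bern_ratio {lam : ℝ} (hl : 0 < lam) {S : Set ℝ} (h1 : (1 : ℝ) ∈ S)
    (hS : ∀ x ∈ S, 0 < x) {d : ℕ} {H : List (WEdge V)} (h : Adm S d H) (u : V) (s : Bool) :
    bern s (ratio lam u H) * Z lam H = bias lam s * Z lam (pin s u H) := by
  have z1 := Z_pos hl hS (h.pin h1 true u)
  have z0 := Z_pos hl hS (h.pin h1 false u)
  rw [Z_eq_pin hl h.nodup u]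
  set a := Z lam (pin true u H) with ha
  set b := Z lam (pin false u H) with hb
  cases s
  · simp only [bern, ratio, bias, ← ha, ← hb]
    simp
    field_simp
    ring
  · simp only [bern, ratio, bias, ← ha, ← hb]
    simp
    field_simp
    ring

/-- The chain rule for conditional probabilities: conditioning on a spin is pinning. -/
theorem chain_ratio {lam : ℝ} (hl : 0 < lam) {S : Set ℝ} (h1 : (1 : ℝ) ∈ S)
    (hS : ∀ x ∈ S, 0 < x) {d : ℕ} (s : Bool) {l : List V} (hl' : l.Nodup) :
    ∀ {H : List (WEdge V)}, Adm S d H →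
      chain (ratio lam) s H l * Z lam H = mass lam H s l := by
  induction l with
  | nil => intro H _; simp [chain, mass_nil]
  | cons u l ih =>
    intro H h
    rw [chain, mass_cons hl h.nodup s (List.nodup_cons.1 hl').1,
      ← ih (List.nodup_cons.1 hl').2 (h.pin h1 s u), mul_right_comm, bern_ratio hl h1 hS h]
    ring

/-- A hybrid argument. In `acc` the vertex `u` has already been fixed to 1, while `H` is still to be
compared for both spins. Inserting the instance where only `e` has been switched splits the quotient
into one for the tail and one comparing `⟨1, γ, l⟩` with `⟨β, 1, l⟩` over the common rest `pin false
u H ++ acc`; the latter is `factor`. -/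
theorem loop_ratio_aux {lam : ℝ} (hl : 0 < lam) {S : Set ℝ} (h1 : (1 : ℝ) ∈ S)
    (hS : ∀ x ∈ S, 0 < x) {d : ℕ} (u : V) (H : List (WEdge V)) :
    ∀ {acc : List (WEdge V)}, Adm S d (H ++ acc) →
      loop lam (fun _ => ratio lam) u H acc =
        lam * (Z lam (pin true u H ++ acc) / Z lam (pin false u H ++ acc)) := by
  induction H with
  | nil =>
    intro acc h
    have := Z_pos hl hS h
    simp only [List.nil_append] at this
    simp [loop, pin, this.ne']
  | cons e H ih =>
    intro acc h
    have hn := h.nodup e (by simp)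
    by_cases hu : u ∈ e.verts
    · have hO : Adm S d (pin false u H ++ acc) := (Adm.tail h).pin_append h1 false u
      have hA := h.rotate_erase h1 u
      have hB : Adm S d (pin false u (e :: H) ++ acc) := h.pin_append h1 false u
      have e1 : pin true u (e :: H) = ⟨1, e.g, e.verts.erase u⟩ :: pin true u H := by
        simp [pin, WEdge.restrict, hu]
      have e0 : pin false u (e :: H) = ⟨e.b, 1, e.verts.erase u⟩ :: pin false u H := by
        simp [pin, WEdge.restrict, hu]
      have z0 := Z_pos hl hS hB
      have zO := Z_pos hl hS hO
      have zA := Z_pos hl hS (hA.pin_append h1 false u)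
      have p1 := Z_perm lam (List.perm_middle (a := (⟨1, e.g, e.verts.erase u⟩ : WEdge V))
        (l₁ := pin true u H) (l₂ := acc))
      have p0 := Z_perm lam (List.perm_middle (a := (⟨1, e.g, e.verts.erase u⟩ : WEdge V))
        (l₁ := pin false u H) (l₂ := acc))
      have f1 := chain_ratio hl h1 hS true (hn.erase u) hO
      have f0 := chain_ratio hl h1 hS false (hn.erase u) hO
      rw [loop, if_pos hu, ih hA]
      rw [e0] at z0 ⊢
      rw [e1, p1, p0]
      rw [p0] at zA
      simp only [List.cons_append] at *
      rw [Z_cons_true, ← f1] at zA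
      rw [Z_cons_false, ← f0] at z0 ⊢
      rw [Z_cons_true lam _ _ (pin false u H ++ acc), ← f1]
      unfold factor
      set p := chain (ratio lam) true (pin false u H ++ acc) (e.verts.erase u)
      set q := chain (ratio lam) false (pin false u H ++ acc) (e.verts.erase u)
      set z := Z lam (pin false u H ++ acc)
      have k0 : z - (1 - e.b) * (q * z) = (1 - (1 - e.b) * q) * z := by ring
      have k1 : z - (1 - e.g) * (p * z) = (1 - (1 - e.g) * p) * z := by ring
      rw [k0] at z0 ⊢
      rw [k1] at zA ⊢
      have z0' := (pos_iff_pos_of_mul_pos z0).2 zO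
      have zA' := (pos_iff_pos_of_mul_pos zA).2 zO
      field_simp
    · have e1 : ∀ s, pin s u (e :: H) = e :: pin s u H := by
        intro s
        simp [pin, WEdge.restrict, hu]
      rw [loop, if_neg hu, ih h.rotate, e1, e1, Z_perm lam List.perm_middle,
        Z_perm lam List.perm_middle (K := e :: (pin false u H ++ acc))]
      rfl

theorem loop_ratio {lam : ℝ} (hl : 0 < lam) {S : Set ℝ} (h1 : (1 : ℝ) ∈ S)
    (hS : ∀ x ∈ S, 0 < x) {d : ℕ} (u : V) {H : List (WEdge V)} (h : Adm S d H) :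
    loop lam (fun _ => ratio lam) u H [] = ratio lam u H := by
  rw [loop_ratio_aux hl h1 hS u H (by simpa using h)]
  simp [ratio]

end Hyp

/-! ### Analytic estimates for products of marginals. -/

namespace Hyp

theorem list_prod_nonneg {ps : List ℝ} (h : ∀ p ∈ ps, 0 ≤ p) : 0 ≤ ps.prod :=
  List.prod_nonneg h

theorem list_prod_le_pow {ps : List ℝ} {q : ℝ} (h0 : ∀ p ∈ ps, 0 ≤ p) (h1 : ∀ p ∈ ps, p ≤ q) :
    ps.prod ≤ q ^ ps.length := by
  induction ps with
  | nil => simp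
  | cons p ps ih =>
    simp only [List.mem_cons, forall_eq_or_imp] at h0 h1
    rw [List.prod_cons, List.length_cons, pow_succ']
    exact mul_le_mul h1.1 (ih h0.2 h1.2) (list_prod_nonneg h0.2) (h0.1.trans h1.1)

theorem list_prod_le_exp {ps : List ℝ} (h0 : ∀ p ∈ ps, 0 ≤ p) :
    ps.prod ≤ Real.exp (-(ps.map fun p => 1 - p).sum) := by
  induction ps with
  | nil => simp
  | cons p ps ih =>
    simp only [List.mem_cons, forall_eq_or_imp] at h0
    rw [List.prod_cons, List.map_cons, List.sum_cons, neg_add, Real.exp_add]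
    refine mul_le_mul ?_ (ih h0.2) (list_prod_nonneg h0.2) (Real.exp_nonneg _)
    have := Real.add_one_le_exp (-(1 - p))
    linarith

/-- The total influence on the product of `ps`, in terms of log-ratios. -/
noncomputable def influence (ps : List ℝ) : ℝ := ps.prod * (ps.map fun p => 1 - p).sum

/-- With `a = ∑ (1 - p)` over the tail, the product of the tail is at most `exp (-a)` and `1 - x + a
≤ exp (a - x)`, so `a` cancels. -/
theorem influence_cons_le {x : ℝ} {ps : List ℝ} (hx : 0 ≤ x) (h0 : ∀ p ∈ ps, 0 ≤ p) :
    influence (x :: ps) ≤ x * Real.exp (-x) := by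
  unfold influence
  rw [List.prod_cons, List.map_cons, List.sum_cons, mul_assoc]
  refine mul_le_mul_of_nonneg_left ?_ hx
  set a := (ps.map fun p => 1 - p).sum with ha
  calc ps.prod * (1 - x + a) ≤ Real.exp (-a) * Real.exp (a - x) := by
        refine (mul_le_mul_of_nonneg_left ?_ (list_prod_nonneg h0)).trans
          (mul_le_mul_of_nonneg_right (list_prod_le_exp h0) (Real.exp_nonneg _))
        have := Real.add_one_le_exp (a - x)
        linarith
    _ = Real.exp (-x) := by rw [← Real.exp_add]; ring_nf

/-- The bound for large hyperedges: exponential decay in their size when all marginals stay below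
some `q < 1`. -/
theorem influence_le_pow {ps : List ℝ} {q : ℝ} (h0 : ∀ p ∈ ps, 0 ≤ p) (h1 : ∀ p ∈ ps, p ≤ q) :
    influence ps ≤ ps.length * q ^ ps.length := by
  unfold influence
  rw [mul_comm]
  refine mul_le_mul ?_ (list_prod_le_pow h0 h1) (list_prod_nonneg h0) (Nat.cast_nonneg _)
  have := List.sum_le_card_nsmul (ps.map fun p => 1 - p) 1 (by
    intro y hy
    obtain ⟨p, hp, rfl⟩ := List.mem_map.1 hy
    linarith [h0 p hp])
  simpa using this

/-- The right side is the tangent at `x = 1/2`. From `exp (x - 1/2) ≥ x + 1/2` the claim reduces to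
`x ≤ (x + 1/2) ^ 2 / 2`, that is `(x - 1/2) ^ 2 ≥ 0`. -/
theorem mul_exp_neg_le_tangent {x : ℝ} (h0 : 0 ≤ x) :
    x * Real.exp (-x) ≤ Real.exp (-1 / 2) * (x / 2 + 1 / 4) := by
  have key : x * Real.exp (1 / 2 - x) ≤ x / 2 + 1 / 4 := by
    have h2 : 0 < 1 / 2 + x := by linarith
    have h3 : (1 / 2 + x) ≤ Real.exp (-(1 / 2 - x)) := by
      have := Real.add_one_le_exp (-(1 / 2 - x))
      linarith
    have h4 : Real.exp (1 / 2 - x) * (1 / 2 + x) ≤ 1 := by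
      calc Real.exp (1 / 2 - x) * (1 / 2 + x) ≤ Real.exp (1 / 2 - x) * Real.exp (-(1 / 2 - x)) :=
            mul_le_mul_of_nonneg_left h3 (Real.exp_nonneg _)
        _ = 1 := by rw [← Real.exp_add]; simp
    refine le_of_mul_le_mul_right ?_ h2
    nlinarith [sq_nonneg (x - 1 / 2), mul_le_mul_of_nonneg_left h4 h0]
  have e : Real.exp (-x) = Real.exp (-1 / 2) * Real.exp (1 / 2 - x) := by
    rw [← Real.exp_add]; ring_nf
  rw [e]
  have := mul_le_mul_of_nonneg_left key (Real.exp_nonneg (-1 / 2))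
  linarith

theorem influence_add_le {x : ℝ} {ps qs : List ℝ} (hx : 0 ≤ x) (hx1 : x ≤ 1)
    (h0 : ∀ p ∈ ps, 0 ≤ p) (k0 : ∀ p ∈ qs, 0 ≤ p) :
    influence (x :: ps) + influence ((1 - x) :: qs) ≤ Real.exp (-1 / 2) := by
  have a := influence_cons_le hx h0
  have b := influence_cons_le (by linarith : 0 ≤ 1 - x) k0
  have c := mul_exp_neg_le_tangent hx
  have d := mul_exp_neg_le_tangent (by linarith : 0 ≤ 1 - x)
  nlinarith

/-- The marginals at time `t` when all log-ratios move linearly from `z.1` to `z.2`. -/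
noncomputable def path (L : List (ℝ × ℝ)) (t : ℝ) : List ℝ :=
  L.map fun z => Real.sigmoid (z.1 + t * (z.2 - z.1))

theorem path_nonneg {L : List (ℝ × ℝ)} {t : ℝ} : ∀ p ∈ path L t, 0 ≤ p := by
  intro p hp
  obtain ⟨z, -, rfl⟩ := List.mem_map.1 hp
  exact Real.sigmoid_nonneg _

theorem path_le_one {L : List (ℝ × ℝ)} {t : ℝ} : ∀ p ∈ path L t, p ≤ 1 := by
  intro p hp
  obtain ⟨z, -, rfl⟩ := List.mem_map.1 hp
  exact Real.sigmoid_le_one _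

theorem path_prod_le_one (L : List (ℝ × ℝ)) (t : ℝ) : (path L t).prod ≤ 1 := by
  simpa using list_prod_le_pow path_nonneg (path_le_one (L := L) (t := t))

theorem path_le {L : List (ℝ × ℝ)} {t Λ : ℝ} (ht : 0 ≤ t) (ht1 : t ≤ 1)
    (h1 : ∀ z ∈ L, z.1 ≤ Λ) (h2 : ∀ z ∈ L, z.2 ≤ Λ) : ∀ p ∈ path L t, p ≤ Real.sigmoid Λ := by
  intro p hp
  obtain ⟨z, hz, rfl⟩ := List.mem_map.1 hp
  refine Real.sigmoid_le ?_
  nlinarith [h1 z hz, h2 z hz]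

/-- The logistic function satisfies `s' = s (1 - s)`, so moving one log-ratio changes the product by
the product times `1 - s`; adding up gives the influence. -/
theorem exists_hasDerivAt_path_prod {L : List (ℝ × ℝ)} {M : ℝ}
    (hM : ∀ z ∈ L, |z.2 - z.1| ≤ M) (t : ℝ) :
    ∃ d, HasDerivAt (fun t => (path L t).prod) d t ∧ |d| ≤ M * influence (path L t) := by
  induction L with
  | nil => exact ⟨0, by simpa [path] using hasDerivAt_const t (1 : ℝ), by simp [path, influence]⟩
  | cons z L ih =>
    simp only [List.mem_cons, forall_eq_or_imp] at hM
    obtain ⟨d, hd, hb⟩ := ih hM.2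
    set s := Real.sigmoid (z.1 + t * (z.2 - z.1)) with hs
    have h1 : HasDerivAt (fun t => Real.sigmoid (z.1 + t * (z.2 - z.1)))
        (s * (1 - s) * (z.2 - z.1)) t := by
      have := (Real.hasDerivAt_sigmoid (z.1 + t * (z.2 - z.1))).comp t
        (((hasDerivAt_id t).mul_const (z.2 - z.1)).const_add z.1)
      simpa [Function.comp_def] using this
    have e : (fun t => (path (z :: L) t).prod) =
        (fun t => Real.sigmoid (z.1 + t * (z.2 - z.1))) * fun t => (path L t).prod := by
      ext t
      simp [path]
    refine ⟨s * (1 - s) * (z.2 - z.1) * (path L t).prod + s * d, e ▸ h1.mul hd, ?_⟩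
    have s0 : 0 ≤ s := Real.sigmoid_nonneg _
    have s1 : s ≤ 1 := Real.sigmoid_le_one _
    have P0 : 0 ≤ (path L t).prod := list_prod_nonneg path_nonneg
    calc |s * (1 - s) * (z.2 - z.1) * (path L t).prod + s * d|
        ≤ |s * (1 - s) * (z.2 - z.1) * (path L t).prod| + |s * d| := abs_add_le _ _
      _ = s * (1 - s) * (path L t).prod * |z.2 - z.1| + s * |d| := by
          rw [abs_mul, abs_mul, abs_mul, abs_of_nonneg s0, abs_of_nonneg P0,
            abs_of_nonneg (sub_nonneg.2 s1), abs_mul, abs_of_nonneg s0]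
          ring
      _ ≤ s * (1 - s) * (path L t).prod * M + s * (M * influence (path L t)) := by
          refine add_le_add (mul_le_mul_of_nonneg_left hM.1 ?_) (mul_le_mul_of_nonneg_left hb s0)
          exact mul_nonneg (mul_nonneg s0 (sub_nonneg.2 s1)) P0
      _ = M * influence (path (z :: L) t) := by
          simp only [influence, path, List.map_cons, List.prod_cons, List.sum_cons, ← hs]
          ring

/-- The logarithmic derivative contributes `a / (1 - a * ∏ p)`, and both `a` and the product are
bounded by their largest values `δ` and 1. -/
theorem exists_hasDerivAt_log {L : List (ℝ × ℝ)} {M a δ : ℝ}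
    (hM : ∀ z ∈ L, |z.2 - z.1| ≤ M) (ha : 0 ≤ a) (haδ : a ≤ δ) (hδ : δ < 1) (t : ℝ) :
    ∃ d, HasDerivAt (fun t => Real.log (1 - a * (path L t).prod)) d t ∧
      |d| ≤ δ / (1 - δ) * (M * influence (path L t)) := by
  obtain ⟨d, hd, hb⟩ := exists_hasDerivAt_path_prod hM t
  have P0 : 0 ≤ (path L t).prod := list_prod_nonneg path_nonneg
  have P1 := path_prod_le_one L t
  have hpos : 1 - δ ≤ 1 - a * (path L t).prod := by nlinarith
  have hpos' : 0 < 1 - a * (path L t).prod := by linarith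
  refine ⟨_, ((hd.const_mul a).const_sub 1).log hpos'.ne', ?_⟩
  rw [abs_div, abs_neg, abs_mul, abs_of_nonneg ha, abs_of_pos hpos']
  have hI : 0 ≤ M * influence (path L t) := (abs_nonneg d).trans hb
  rw [div_mul_eq_mul_div]
  exact div_le_div₀ (mul_nonneg (ha.trans haδ) hI)
    (mul_le_mul haδ hb (abs_nonneg d) (ha.trans haδ)) (by linarith) hpos

/-- The logarithm of the effect of a hyperedge is Lipschitz in the log-ratios. -/
theorem log_factor_sub_le {L₁ L₀ : List (ℝ × ℝ)} {M a b δ F : ℝ} (hM0 : 0 ≤ M)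
    (h₁ : ∀ z ∈ L₁, |z.2 - z.1| ≤ M) (h₀ : ∀ z ∈ L₀, |z.2 - z.1| ≤ M)
    (ha : 0 ≤ a) (haδ : a ≤ δ) (hb : 0 ≤ b) (hbδ : b ≤ δ) (hδ : δ < 1)
    (hF : ∀ t, 0 ≤ t → t ≤ 1 → influence (path L₁ t) + influence (path L₀ t) ≤ F) :
    |(Real.log (1 - a * (path L₁ 1).prod) - Real.log (1 - b * (path L₀ 1).prod)) -
      (Real.log (1 - a * (path L₁ 0).prod) - Real.log (1 - b * (path L₀ 0).prod))| ≤
      δ / (1 - δ) * F * M := by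
  have hδ0 : 0 ≤ δ / (1 - δ) := div_nonneg (ha.trans haδ) (by linarith)
  have key : ∀ t ∈ Set.Icc (0 : ℝ) 1, ∃ d, HasDerivAt (fun t =>
      Real.log (1 - a * (path L₁ t).prod) - Real.log (1 - b * (path L₀ t).prod)) d t ∧
      ‖d‖ ≤ δ / (1 - δ) * F * M := by
    intro t ht
    obtain ⟨d₁, hd₁, hb₁⟩ := exists_hasDerivAt_log h₁ ha haδ hδ t
    obtain ⟨d₀, hd₀, hb₀⟩ := exists_hasDerivAt_log h₀ hb hbδ hδ t
    refine ⟨_, hd₁.sub hd₀, ?_⟩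
    have h := mul_le_mul_of_nonneg_left (hF t ht.1 ht.2) (mul_nonneg hδ0 hM0)
    rw [Real.norm_eq_abs]
    have := abs_sub d₁ d₀
    nlinarith
  -- The mean value inequality on the segment between the two vectors of log-ratios.
  have := (convex_Icc (0 : ℝ) 1).norm_image_sub_le_of_norm_deriv_le
    (f := fun t => Real.log (1 - a * (path L₁ t).prod) - Real.log (1 - b * (path L₀ t).prod))
    (C := δ / (1 - δ) * F * M)
    (fun t ht => by
      obtain ⟨d, hd, -⟩ := key t ht
      exact hd.differentiableAt)
    (fun t ht => by
      obtain ⟨d, hd, h⟩ := key t ht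
      rw [hd.deriv]; exact h)
    (Set.left_mem_Icc.2 zero_le_one) (Set.right_mem_Icc.2 zero_le_one)
  simpa using this

/-- A contraction rate below `1` that decays exponentially in `m` beats a small power of `m`. -/
theorem exists_root_contraction {α q : ℝ} (hα : α < 1) (hq0 : 0 < q) (hq : q < 1) (A C : ℝ)
    (hA : 0 ≤ A) (hC : 1 ≤ C) :
    ∃ T : ℕ, 0 < T ∧ ∀ (m : ℕ) (y : ℝ), 0 ≤ y → y ≤ α → y ≤ A * (m * q ^ m) →
      y * (C * (m + 1)) ^ (1 / (T : ℝ)) ≤ 1 := by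
  have lim : Filter.Tendsto (fun m : ℕ => A * C * ((m : ℝ) ^ 2 * q ^ m + (m : ℝ) ^ 1 * q ^ m))
      Filter.atTop (nhds (A * C * (0 + 0))) :=
    ((tendsto_pow_const_mul_const_pow_of_lt_one 2 hq0.le hq).add
      (tendsto_pow_const_mul_const_pow_of_lt_one 1 hq0.le hq)).const_mul _
  rw [add_zero, mul_zero] at lim
  -- Beyond `K` the exponential decay beats even the full factor `C (m + 1)`, so any exponent at
  -- most 1 works there.
  obtain ⟨K, hK⟩ := Filter.eventually_atTop.1 (lim.eventually (gt_mem_nhds one_pos))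
  have hCK : 0 < C * (K + 1) := by positivity
  have hlim2 : Filter.Tendsto (fun T : ℕ => α * (C * ((K : ℝ) + 1)) ^ (1 / (T : ℝ)))
      Filter.atTop (nhds (α * 1)) := by
    refine Filter.Tendsto.const_mul _ ?_
    have := (Real.continuousAt_const_rpow (a := C * ((K : ℝ) + 1)) (b := 0) hCK.ne').tendsto
    rw [Real.rpow_zero] at this
    exact this.comp tendsto_one_div_atTop_nhds_zero_nat
  rw [mul_one] at hlim2
  -- Up to `K` the factor is bounded, and a high enough root of it is absorbed by `α < 1`.
  obtain ⟨T, hT⟩ := Filter.eventually_atTop.1 (hlim2.eventually (gt_mem_nhds hα))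
  refine ⟨T + 1, Nat.succ_pos _, fun m y hy hyα hyA => ?_⟩
  have hT' := hT (T + 1) (Nat.le_succ _)
  have hexp : (0 : ℝ) ≤ 1 / ((T + 1 : ℕ) : ℝ) := by positivity
  have hexp1 : 1 / ((T + 1 : ℕ) : ℝ) ≤ 1 := by
    rw [div_le_one (by positivity)]
    exact_mod_cast Nat.succ_le_succ (Nat.zero_le T)
  by_cases hm : m ≤ K
  · calc y * (C * (m + 1)) ^ (1 / ((T + 1 : ℕ) : ℝ))
        ≤ α * (C * (K + 1)) ^ (1 / ((T + 1 : ℕ) : ℝ)) := by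
          refine mul_le_mul hyα ?_ (by positivity) (hy.trans hyα)
          refine Real.rpow_le_rpow (by positivity) ?_ hexp
          have : (m : ℝ) ≤ K := by exact_mod_cast hm
          gcongr
      _ ≤ 1 := hT'.le
  · have hk := (hK m (by omega)).le
    calc y * (C * (m + 1)) ^ (1 / ((T + 1 : ℕ) : ℝ))
        ≤ A * (m * q ^ m) * (C * (m + 1)) := by
          refine mul_le_mul hyA ?_ (by positivity) (by positivity)
          refine (Real.rpow_le_rpow_of_exponent_le ?_ hexp1).trans (Real.rpow_one _).le
          have : (0 : ℝ) ≤ m := by positivity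
          nlinarith
      _ = A * C * ((m : ℝ) ^ 2 * q ^ m + (m : ℝ) ^ 1 * q ^ m) := by ring
      _ ≤ 1 := hk

end Hyp

/-! ### Correlation decay for the budgeted recursion. -/

namespace Hyp

variable {V : Type} [DecidableEq V]

/-- The sign with which the log-ratio enters the marginal of the spin `s`. -/
noncomputable def sgn (s : Bool) (x : ℝ) : ℝ := if s = true then x else -x

theorem sigmoid_sgn_log (s : Bool) {r : ℝ} (hr : 0 < r) :
    Real.sigmoid (sgn s (Real.log r)) = bern s r := by
  unfold sgn bern
  split_ifs
  · rw [Real.sigmoid_def, Real.exp_neg, Real.exp_log hr]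
    field_simp
    ring
  · rw [Real.sigmoid_def, neg_neg, Real.exp_log hr]
    field_simp

/-- The signed log-ratios met by `chain` under two oracles. -/
noncomputable def logPairs (rat rat' : V → List (WEdge V) → ℝ) (s : Bool) :
    List (WEdge V) → List V → List (ℝ × ℝ)
  | _, [] => []
  | H, u :: l => (sgn s (Real.log (rat u H)), sgn s (Real.log (rat' u H))) ::
      logPairs rat rat' s (pin s u H) l

theorem length_logPairs (rat rat' : V → List (WEdge V) → ℝ) (s : Bool) (l : List V) :
    ∀ H, (logPairs rat rat' s H l).length = l.length := by
  induction l with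
  | nil => intro H; rfl
  | cons u l ih => intro H; simp [logPairs, ih]

theorem forall_logPairs {S : Set ℝ} (h1 : (1 : ℝ) ∈ S) {d : ℕ}
    {rat rat' : V → List (WEdge V) → ℝ} {s : Bool} {Q : ℝ × ℝ → Prop}
    (hQ : ∀ u H, Adm S d H → Q (sgn s (Real.log (rat u H)), sgn s (Real.log (rat' u H))))
    (l : List V) : ∀ H, Adm S d H → ∀ z ∈ logPairs rat rat' s H l, Q z := by
  induction l with
  | nil => intro H _ z hz; simp [logPairs] at hz
  | cons u l ih =>
    intro H h z hz
    rcases List.mem_cons.1 hz with rfl | hz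
    · exact hQ u H h
    · exact ih _ (h.pin h1 s u) z hz

theorem path_logPairs_zero {S : Set ℝ} (h1 : (1 : ℝ) ∈ S) {d : ℕ}
    {rat : V → List (WEdge V) → ℝ} (rat' : V → List (WEdge V) → ℝ) (s : Bool)
    (hr : ∀ u H, Adm S d H → 0 < rat u H) (l : List V) : ∀ H, Adm S d H →
    (path (logPairs rat rat' s H l) 0).prod = chain rat s H l := by
  induction l with
  | nil => intro H _; simp [logPairs, path, chain]
  | cons u l ih =>
    intro H h
    have := ih _ (h.pin h1 s u)
    simp only [path, zero_mul, add_zero] at this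
    simp [logPairs, path, chain, sigmoid_sgn_log s (hr u H h), this]

theorem path_logPairs_one {S : Set ℝ} (h1 : (1 : ℝ) ∈ S) {d : ℕ}
    (rat : V → List (WEdge V) → ℝ) {rat' : V → List (WEdge V) → ℝ} (s : Bool)
    (hr : ∀ u H, Adm S d H → 0 < rat' u H) (l : List V) : ∀ H, Adm S d H →
    (path (logPairs rat rat' s H l) 1).prod = chain rat' s H l := by
  induction l with
  | nil => intro H _; simp [logPairs, path, chain]
  | cons u l ih =>
    intro H h
    have := ih _ (h.pin h1 s u)
    simp only [path, one_mul, add_sub_cancel] at this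
    simp [logPairs, path, chain, sigmoid_sgn_log s (hr u H h), this]

theorem bern_nonneg (s : Bool) {r : ℝ} (hr : 0 < r) : 0 ≤ bern s r := by
  rw [← sigmoid_sgn_log s hr]; exact Real.sigmoid_nonneg _

theorem bern_le_one (s : Bool) {r : ℝ} (hr : 0 < r) : bern s r ≤ 1 := by
  rw [← sigmoid_sgn_log s hr]; exact Real.sigmoid_le_one _

theorem chain_mem {S : Set ℝ} (h1 : (1 : ℝ) ∈ S) {d : ℕ}
    {rat : V → List (WEdge V) → ℝ} (s : Bool)
    (hr : ∀ u H, Adm S d H → 0 < rat u H) (l : List V) : ∀ H, Adm S d H →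
    0 ≤ chain rat s H l ∧ chain rat s H l ≤ 1 := by
  induction l with
  | nil => intro H _; simp [chain]
  | cons u l ih =>
    intro H h
    obtain ⟨a, b⟩ := ih _ (h.pin h1 s u)
    have c := bern_nonneg s (hr u H h)
    have e := bern_le_one s (hr u H h)
    exact ⟨mul_nonneg c a, mul_le_one₀ e a b⟩

theorem one_sub_mul_mem {δ g p : ℝ} (hδ : δ ≤ 2 / 3) (hg : g ∈ Set.Icc (1 - δ) 1)
    (p0 : 0 ≤ p) (p1 : p ≤ 1) : 1 / 3 ≤ 1 - (1 - g) * p ∧ 1 - (1 - g) * p ≤ 1 := by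
  obtain ⟨a, b⟩ := hg
  constructor <;> nlinarith

theorem factor_pos {δ b g p q : ℝ} (hδ : δ ≤ 2 / 3) (hb : b ∈ Set.Icc (1 - δ) 1)
    (hg : g ∈ Set.Icc (1 - δ) 1) (p0 : 0 ≤ p) (p1 : p ≤ 1) (q0 : 0 ≤ q) (q1 : q ≤ 1) :
    0 < factor b g p q := by
  have := (one_sub_mul_mem hδ hg p0 p1).1
  have := (one_sub_mul_mem hδ hb q0 q1).1
  exact div_pos (by linarith) (by linarith)

/-- Numerator and denominator both lie between `1/3` and 1. -/
theorem abs_log_factor_le {δ b g p q : ℝ} (hδ : δ ≤ 2 / 3) (hb : b ∈ Set.Icc (1 - δ) 1)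
    (hg : g ∈ Set.Icc (1 - δ) 1) (p0 : 0 ≤ p) (p1 : p ≤ 1) (q0 : 0 ≤ q) (q1 : q ≤ 1) :
    |Real.log (factor b g p q)| ≤ Real.log 3 := by
  obtain ⟨a1, a2⟩ := one_sub_mul_mem hδ hg p0 p1
  obtain ⟨b1, b2⟩ := one_sub_mul_mem hδ hb q0 q1
  have h3 : Real.log (1 / 3) = -Real.log 3 := by rw [one_div, Real.log_inv]
  rw [abs_le, ← h3]
  constructor
  · refine Real.log_le_log (by norm_num) ?_
    rw [factor, le_div_iff₀ (by linarith)]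
    linarith
  · refine Real.log_le_log (factor_pos hδ hb hg p0 p1 q0 q1) ?_
    rw [factor, div_le_iff₀ (by linarith)]
    linarith

/-- Only positivity of the oracle is used, so the a priori bound holds for exact and approximate
ratios alike. It gives the constant `Λ` that keeps marginals away from 1. -/
theorem loop_pos_and_log {lam δ : ℝ} (hl : 0 < lam) (hδ : δ ≤ 2 / 3) (hδ0 : 0 ≤ δ) {d : ℕ}
    {rat : ℕ → V → List (WEdge V) → ℝ}
    (hr : ∀ m u H, Adm (Set.Icc (1 - δ) 1) d H → 0 < rat m u H) (u : V) (H : List (WEdge V)) :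
    ∀ acc, Adm (Set.Icc (1 - δ) 1) d (H ++ acc) → 0 < loop lam rat u H acc ∧
      |Real.log (loop lam rat u H acc) - Real.log lam| ≤ deg u H * Real.log 3 := by
  have h1 : (1 : ℝ) ∈ Set.Icc (1 - δ) 1 := ⟨by linarith, le_rfl⟩
  induction H with
  | nil => intro acc _; simp [loop, hl, deg]
  | cons e H ih =>
    intro acc h
    rw [loop, deg_cons]
    split_ifs with hu
    · have hO : Adm (Set.Icc (1 - δ) 1) d (pin false u H ++ acc) :=
        (Adm.tail h).pin_append h1 false u
      obtain ⟨i1, i2⟩ := ih _ (h.rotate_erase h1 u)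
      obtain ⟨p0, p1⟩ := chain_mem h1 true (hr (e.verts.erase u).length) (e.verts.erase u) _ hO
      obtain ⟨q0, q1⟩ := chain_mem h1 false (hr (e.verts.erase u).length) (e.verts.erase u) _ hO
      have hb := h.b_mem e (by simp)
      have hg := h.g_mem e (by simp)
      have fp := factor_pos hδ hb hg p0 p1 q0 q1
      have fl := abs_log_factor_le hδ hb hg p0 p1 q0 q1
      refine ⟨mul_pos fp i1, ?_⟩
      rw [Real.log_mul fp.ne' i1.ne', add_sub_assoc]
      refine (abs_add_le _ _).trans ?_
      push_cast
      linarith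
    · simpa using ih _ h.rotate

/-- The approximate ratio with budget `N`; the first argument bounds the depth of the recursion. -/
noncomputable def approx (C lam : ℝ) : ℕ → ℝ → V → List (WEdge V) → ℝ
  | 0, _, _, _ => lam
  | k + 1, N, u, H =>
    if N < 1 then lam else loop lam (fun m => approx C lam k (N / (C * (m + 1)))) u H []

theorem approx_pos_and_log {C lam δ : ℝ} (hl : 0 < lam) (hδ : δ ≤ 2 / 3) (hδ0 : 0 ≤ δ) {d : ℕ}
    (k : ℕ) : ∀ (N : ℝ) (u : V) (H : List (WEdge V)), Adm (Set.Icc (1 - δ) 1) d H →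
      0 < approx C lam k N u H ∧
      |Real.log (approx C lam k N u H) - Real.log lam| ≤ d * Real.log 3 := by
  have hl3 : 0 < Real.log 3 := Real.log_pos (by norm_num)
  induction k with
  | zero => intro N u H _; simp [approx, hl]; positivity
  | succ k ih =>
    intro N u H h
    rw [approx]
    split_ifs
    · simp [hl]; positivity
    · obtain ⟨a, b⟩ := loop_pos_and_log (rat := fun m => approx C lam k (N / (C * (m + 1)))) hl hδ
        hδ0 (fun m u H h => (ih _ u H h).1) u H [] (by simpa using h)
      refine ⟨a, b.trans ?_⟩
      exact mul_le_mul_of_nonneg_right (by exact_mod_cast h.deg_le u) hl3.le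

variable [Fintype V]

theorem ratio_log {lam δ : ℝ} (hl : 0 < lam) (hδ : δ ≤ 2 / 3) (hδ0 : 0 ≤ δ) {d : ℕ}
    (u : V) {H : List (WEdge V)} (h : Adm (Set.Icc (1 - δ) 1) d H) : 0 < ratio lam u H ∧
      |Real.log (ratio lam u H) - Real.log lam| ≤ d * Real.log 3 := by
  have hl3 : 0 < Real.log 3 := Real.log_pos (by norm_num)
  have h1 : (1 : ℝ) ∈ Set.Icc (1 - δ) 1 := ⟨by linarith, le_rfl⟩
  have hS : ∀ x ∈ Set.Icc (1 - δ) 1, 0 < x := fun x hx => by linarith [hx.1]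
  rw [← loop_ratio hl h1 hS u h]
  obtain ⟨a, b⟩ := loop_pos_and_log (rat := fun _ => ratio lam) hl hδ
    hδ0 (fun m u H h => ratio_pos hl h1 hS h u) u H [] (by simpa using h)
  refine ⟨a, b.trans ?_⟩
  exact mul_le_mul_of_nonneg_right (by exact_mod_cast h.deg_le u) hl3.le

/-- Both chains query their first vertex in the same instance, before any pinning of their own, so
along the path its two marginals add up to 1. Later queries see different pinnings and need only be
nonnegative for the first bound. -/
theorem influence_logPairs_le {δ Λ : ℝ} (hδ0 : 0 ≤ δ) {d : ℕ}
    {rat rat' : V → List (WEdge V) → ℝ}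
    (hΛ : ∀ u H, Adm (Set.Icc (1 - δ) 1) d H → |Real.log (rat u H)| ≤ Λ)
    (hΛ' : ∀ u H, Adm (Set.Icc (1 - δ) 1) d H → |Real.log (rat' u H)| ≤ Λ)
    {H : List (WEdge V)} (h : Adm (Set.Icc (1 - δ) 1) d H) (l : List V) {t : ℝ}
    (ht : 0 ≤ t) (ht1 : t ≤ 1) :
    influence (path (logPairs rat rat' true H l) t) +
      influence (path (logPairs rat rat' false H l) t) ≤
      min (Real.exp (-1 / 2)) (2 * (l.length * Real.sigmoid Λ ^ l.length)) := by
  have h1 : (1 : ℝ) ∈ Set.Icc (1 - δ) 1 := ⟨by linarith, le_rfl⟩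
  refine le_min ?_ ?_
  · cases l with
    -- The hyperedge was the singleton of the vertex in question, so nothing recurses.
    | nil => simp [logPairs, path, influence]; positivity
    | cons u l =>
      have e : Real.sigmoid (sgn false (Real.log (rat u H)) +
          t * (sgn false (Real.log (rat' u H)) - sgn false (Real.log (rat u H)))) =
        1 - Real.sigmoid (sgn true (Real.log (rat u H)) +
          t * (sgn true (Real.log (rat' u H)) - sgn true (Real.log (rat u H)))) := by
        rw [← Real.sigmoid_neg]
        congr 1
        simp only [sgn]
        simp
        ring
      have := influence_add_le (Real.sigmoid_nonneg (sgn true (Real.log (rat u H)) +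
          t * (sgn true (Real.log (rat' u H)) - sgn true (Real.log (rat u H)))))
        (Real.sigmoid_le_one _)
        (path_nonneg (L := logPairs rat rat' true (pin true u H) l) (t := t))
        (path_nonneg (L := logPairs rat rat' false (pin false u H) l) (t := t))
      rw [← e] at this
      exact this
  · have key : ∀ s, influence (path (logPairs rat rat' s H l) t) ≤
        l.length * Real.sigmoid Λ ^ l.length := by
      intro s
      have hs : ∀ x, |x| ≤ Λ → sgn s x ≤ Λ := by
        intro x hx
        unfold sgn
        rw [abs_le] at hx
        split_ifs <;> linarith
      have := influence_le_pow (path_nonneg (L := logPairs rat rat' s H l) (t := t))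
        (path_le ht ht1
          (forall_logPairs h1 (Q := fun z => z.1 ≤ Λ) (fun u H h => hs _ (hΛ u H h)) l H h)
          (forall_logPairs h1 (Q := fun z => z.2 ≤ Λ) (fun u H h => hs _ (hΛ' u H h)) l H h))
      simpa [path, length_logPairs] using this
    linarith [key true, key false]

/-- One level of error propagation: the logarithm of the ratio is a sum over the hyperedges at `u`,
each Lipschitz in its log-ratios. The oracle error `M m` may depend on the hyperedge size because
the budget does. -/
theorem loop_log_sub_le {lam δ Λ η : ℝ} (hl : 0 < lam) (hδ : δ ≤ 2 / 3) (hδ0 : 0 ≤ δ) {d : ℕ}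
    {rat rat' : ℕ → V → List (WEdge V) → ℝ} {M : ℕ → ℝ} (hM0 : ∀ m, 0 ≤ M m)
    (hr : ∀ m u H, Adm (Set.Icc (1 - δ) 1) d H → 0 < rat m u H)
    (hr' : ∀ m u H, Adm (Set.Icc (1 - δ) 1) d H → 0 < rat' m u H)
    (hΛ : ∀ m u H, Adm (Set.Icc (1 - δ) 1) d H → |Real.log (rat m u H)| ≤ Λ)
    (hΛ' : ∀ m u H, Adm (Set.Icc (1 - δ) 1) d H → |Real.log (rat' m u H)| ≤ Λ)
    (hM : ∀ m u H, Adm (Set.Icc (1 - δ) 1) d H →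
      |Real.log (rat' m u H) - Real.log (rat m u H)| ≤ M m)
    (hη : ∀ m : ℕ, δ / (1 - δ) * min (Real.exp (-1 / 2)) (2 * (m * Real.sigmoid Λ ^ m)) * M m ≤ η)
    (u : V) (H : List (WEdge V)) :
    ∀ acc, Adm (Set.Icc (1 - δ) 1) d (H ++ acc) →
      |Real.log (loop lam rat' u H acc) - Real.log (loop lam rat u H acc)| ≤ deg u H * η := by
  have h1 : (1 : ℝ) ∈ Set.Icc (1 - δ) 1 := ⟨by linarith, le_rfl⟩
  induction H with
  | nil => intro acc _; simp [loop, deg]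
  | cons e H ih =>
    intro acc h
    rw [loop, loop, deg_cons]
    split_ifs with hu
    · have hO : Adm (Set.Icc (1 - δ) 1) d (pin false u H ++ acc) :=
        (Adm.tail h).pin_append h1 false u
      have hA := h.rotate_erase h1 u
      have i := ih _ hA
      have j := (loop_pos_and_log hl hδ hδ0 hr u H _ hA).1
      have j' := (loop_pos_and_log hl hδ hδ0 hr' u H _ hA).1
      set l := e.verts.erase u
      set O := pin false u H ++ acc
      have hb := h.b_mem e (by simp)
      have hg := h.g_mem e (by simp)
      obtain ⟨p0, p1⟩ := chain_mem h1 true (hr l.length) l O hO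
      obtain ⟨q0, q1⟩ := chain_mem h1 false (hr l.length) l O hO
      obtain ⟨p0', p1'⟩ := chain_mem h1 true (hr' l.length) l O hO
      obtain ⟨q0', q1'⟩ := chain_mem h1 false (hr' l.length) l O hO
      have sg : ∀ s x y, |sgn s x - sgn s y| = |x - y| := by
        intro s x y
        unfold sgn
        split_ifs
        · rfl
        · rw [neg_sub_neg, abs_sub_comm]
      have lip := log_factor_sub_le (a := 1 - e.g) (b := 1 - e.b) (δ := δ) (hM0 l.length)
        (forall_logPairs h1 (s := true) (Q := fun z => |z.2 - z.1| ≤ M l.length)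
          (fun u H h => by simpa only [sg] using hM l.length u H h) l O hO)
        (forall_logPairs h1 (s := false) (Q := fun z => |z.2 - z.1| ≤ M l.length)
          (fun u H h => by simpa only [sg] using hM l.length u H h) l O hO)
        (by linarith [hg.2]) (by linarith [hg.1]) (by linarith [hb.2]) (by linarith [hb.1])
        (by linarith) (fun t ht ht1 =>
          influence_logPairs_le hδ0 (hΛ l.length) (hΛ' l.length) hO l ht ht1)
      rw [path_logPairs_one h1 _ true (hr' l.length) l O hO,
        path_logPairs_one h1 _ false (hr' l.length) l O hO,
        path_logPairs_zero h1 _ true (hr l.length) l O hO,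
        path_logPairs_zero h1 _ false (hr l.length) l O hO] at lip
      have lip' := lip.trans (hη l.length)
      have fp := factor_pos hδ hb hg p0 p1 q0 q1
      have fp' := factor_pos hδ hb hg p0' p1' q0' q1'
      rw [Real.log_mul fp'.ne' j'.ne', Real.log_mul fp.ne' j.ne', factor, factor,
        Real.log_div (by linarith [(one_sub_mul_mem hδ hg p0' p1').1])
          (by linarith [(one_sub_mul_mem hδ hb q0' q1').1]),
        Real.log_div (by linarith [(one_sub_mul_mem hδ hg p0 p1).1])
          (by linarith [(one_sub_mul_mem hδ hb q0 q1).1]), add_sub_add_comm]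
      refine (abs_add_le _ _).trans ?_
      push_cast
      linarith
    · simpa using ih _ h.rotate

/-- The error of the approximate ratio decays like a power of the budget. -/
theorem approx_log_sub_le {C lam δ Λ τ : ℝ} {d : ℕ} (hl : 0 < lam) (hδ : δ ≤ 2 / 3) (hδ0 : 0 ≤ δ)
    (hC : 2 ≤ C) (hτ : 0 ≤ τ) (hΛ : |Real.log lam| + d * Real.log 3 ≤ Λ)
    (hcontr : ∀ m : ℕ, d * (δ / (1 - δ) * min (Real.exp (-1 / 2)) (2 * (m * Real.sigmoid Λ ^ m))) *
      (C * (m + 1)) ^ τ ≤ 1)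
    (k : ℕ) : ∀ (N : ℝ) (u : V) (H : List (WEdge V)), 0 < N → N < 2 ^ k →
      Adm (Set.Icc (1 - δ) 1) d H →
      |Real.log (approx C lam k N u H) - Real.log (ratio lam u H)| ≤
        d * Real.log 3 * N ^ (-τ) := by
  have hl3 : 0 < Real.log 3 := Real.log_pos (by norm_num)
  -- Below budget 1 the answer `lam` is within the a priori bound, and `N ^ (-τ) ≥ 1`.
  have base : ∀ (N : ℝ) (u : V) (H : List (WEdge V)), 0 < N → N < 1 →
      Adm (Set.Icc (1 - δ) 1) d H →
      |Real.log lam - Real.log (ratio lam u H)| ≤ d * Real.log 3 * N ^ (-τ) := by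
    intro N u H hN hN1 h
    rw [abs_sub_comm]
    refine (ratio_log hl hδ hδ0 u h).2.trans ?_
    exact le_mul_of_one_le_right (by positivity)
      (Real.one_le_rpow_of_pos_of_le_one_of_nonpos hN hN1.le (by linarith))
  have hbd : ∀ x, |Real.log x - Real.log lam| ≤ d * Real.log 3 → |Real.log x| ≤ Λ := by
    intro x hx
    have := abs_sub_abs_le_abs_sub (Real.log x) (Real.log lam)
    linarith
  induction k with
  | zero =>
    intro N u H hN hN1 h
    exact base N u H hN (by simpa using hN1) h
  | succ k ih =>
    intro N u H hN hN1 h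
    rw [approx]
    split_ifs with hlt
    · exact base N u H hN hlt h
    · have h1 : (1 : ℝ) ∈ Set.Icc (1 - δ) 1 := ⟨by linarith, le_rfl⟩
      have hS : ∀ x ∈ Set.Icc (1 - δ) 1, 0 < x := fun x hx => by linarith [hx.1]
      rw [← loop_ratio hl h1 hS u h]
      rcases Nat.eq_zero_or_pos d with hd | hd
      · have := (loop_pos_and_log (rat := fun m => approx C lam k (N / (C * (m + 1)))) hl hδ hδ0
          (fun m u H h => (approx_pos_and_log hl hδ hδ0 k _ u H h).1) u H [] (by simpa using h)).2
        have h2 := (loop_pos_and_log (rat := fun _ => ratio lam) hl hδ hδ0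
          (fun m u H h => (ratio_log hl hδ hδ0 u h).1) u H [] (by simpa using h)).2
        have hdu : deg u H = 0 := by have := h.deg_le u; omega
        rw [hdu] at this h2
        simp only [Nat.cast_zero, zero_mul, abs_nonpos_iff, sub_eq_zero] at this h2
        rw [this, h2]
        simp [hd]
      · have hd' : (0 : ℝ) < d := by exact_mod_cast hd
        have hkey := loop_log_sub_le (rat := fun _ => ratio lam)
          (rat' := fun m => approx C lam k (N / (C * (m + 1))))
          (M := fun m : ℕ => d * Real.log 3 * (N / (C * (m + 1))) ^ (-τ)) (Λ := Λ)
          (η := Real.log 3 * N ^ (-τ)) hl hδ hδ0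
          (fun m => by positivity)
          (fun m u H h => (ratio_log hl hδ hδ0 u h).1)
          (fun m u H h => (approx_pos_and_log hl hδ hδ0 k _ u H h).1)
          (fun m u H h => hbd _ (ratio_log hl hδ hδ0 u h).2)
          (fun m u H h => hbd _ (approx_pos_and_log hl hδ hδ0 k _ u H h).2)
          -- Since `C (m + 1) ≥ 2`, each level at least halves the budget, so the depth bound is
          -- never what stops the recursion.
          (fun m u H h => ih _ u H (by positivity) (by
            have hm : (0 : ℝ) ≤ m := Nat.cast_nonneg m
            rw [div_lt_iff₀ (by positivity)]
            rw [pow_succ] at hN1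
            have : (2 : ℝ) ≤ C * (m + 1) := by nlinarith
            have := mul_le_mul_of_nonneg_left this (pow_nonneg zero_le_two k : (0 : ℝ) ≤ 2 ^ k)
            linarith) h)
          -- The child error exceeds the target by `(C (m + 1)) ^ τ`, which is the factor that
          -- `hcontr` absorbs.
          (fun m => by
            have hc := mul_le_mul_of_nonneg_left (hcontr m)
              (by positivity : 0 ≤ Real.log 3 * N ^ (-τ))
            have hCm : 0 < C * ((m : ℝ) + 1) := by positivity
            rw [Real.div_rpow hN.le hCm.le, Real.rpow_neg hCm.le, div_inv_eq_mul]
            calc _ = _ := ?_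
              _ ≤ _ := hc
              _ = _ := mul_one _
            ring) u H [] (by simpa using h)
        refine hkey.trans ?_
        have : (deg u H : ℝ) ≤ d := by exact_mod_cast h.deg_le u
        calc _ ≤ (d : ℝ) * (Real.log 3 * N ^ (-τ)) :=
              mul_le_mul_of_nonneg_right this (by positivity)
          _ = _ := by ring

end Hyp

/-! ### From ratios to the partition function, and the choice of the budget. -/

namespace Hyp

variable {V : Type} [DecidableEq V]

/-- The ratio of the partition function to the weight of the all-zero configuration, from an
oracle for ratios. -/
noncomputable def telescope (rat : V → List (WEdge V) → ℝ) : List (WEdge V) → List V → ℝ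
  | _, [] => 1
  | H, v :: l => (1 + rat v H) * telescope rat (pin false v H) l

/-- Each `1 + R` is the inverse of a conditional probability of spin 0. -/
theorem telescope_mul_chain {S : Set ℝ} (h1 : (1 : ℝ) ∈ S) {d : ℕ}
    {rat : V → List (WEdge V) → ℝ} (hr : ∀ u H, Adm S d H → 0 < rat u H) (l : List V) :
    ∀ H, Adm S d H → telescope rat H l * chain rat false H l = 1 := by
  induction l with
  | nil => intro H _; simp [telescope, chain]
  | cons u l ih =>
    intro H h
    have h2 := ih _ (h.pin h1 false u)
    have h3 := hr u H h
    have h4 : (1 + rat u H) * bern false (rat u H) = 1 := by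
      simp only [bern]
      simp
      field_simp
    rw [telescope, chain, mul_mul_mul_comm, h2, h4, one_mul]

theorem telescope_pos {S : Set ℝ} (h1 : (1 : ℝ) ∈ S) {d : ℕ}
    {rat : V → List (WEdge V) → ℝ} (hr : ∀ u H, Adm S d H → 0 < rat u H) (l : List V) :
    ∀ H, Adm S d H → 0 < telescope rat H l := by
  induction l with
  | nil => intro H _; simp [telescope]
  | cons u l ih =>
    intro H h
    exact mul_pos (by linarith [hr u H h]) (ih _ (h.pin h1 false u))

/-- In terms of `log x`, the function `log (1 + x)` has slope `x / (1 + x) ≤ 1`. -/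
theorem abs_log_one_add_sub_le {x y η : ℝ} (hx : 0 < x) (hy : 0 < y)
    (h : |Real.log x - Real.log y| ≤ η) : |Real.log (1 + x) - Real.log (1 + y)| ≤ η := by
  have hη : 0 ≤ η := (abs_nonneg _).trans h
  have key : ∀ x y, 0 < x → 0 < y → Real.log x - Real.log y ≤ η →
      Real.log (1 + x) - Real.log (1 + y) ≤ η := by
    intro x y hx hy h
    have h2 : x ≤ Real.exp η * y := by
      rw [← Real.exp_log hx, ← Real.exp_log hy, ← Real.exp_add]
      exact Real.exp_le_exp.2 (by simpa using (by linarith))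
    have h3 : 1 + x ≤ Real.exp η * (1 + y) := by
      nlinarith [Real.one_le_exp hη]
    have := Real.log_le_log (by linarith) h3
    rw [Real.log_mul (Real.exp_ne_zero _) (by linarith), Real.log_exp] at this
    linarith
  rw [abs_le] at h ⊢
  constructor
  · linarith [key y x hy hx (by linarith)]
  · exact key x y hx hy h.2

theorem telescope_log_sub_le {S : Set ℝ} (h1 : (1 : ℝ) ∈ S) {d : ℕ}
    {rat rat' : V → List (WEdge V) → ℝ} {η : ℝ} (hr : ∀ u H, Adm S d H → 0 < rat u H)
    (hr' : ∀ u H, Adm S d H → 0 < rat' u H)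
    (hη : ∀ u H, Adm S d H → |Real.log (rat' u H) - Real.log (rat u H)| ≤ η) (l : List V) :
    ∀ H, Adm S d H →
      |Real.log (telescope rat' H l) - Real.log (telescope rat H l)| ≤ l.length * η := by
  induction l with
  | nil => intro H _; simp [telescope]
  | cons u l ih =>
    intro H h
    have i := ih _ (h.pin h1 false u)
    have a := telescope_pos h1 hr l _ (h.pin h1 false u)
    have a' := telescope_pos h1 hr' l _ (h.pin h1 false u)
    have b := abs_log_one_add_sub_le (hr' u H h) (hr u H h) (hη u H h)
    have c := hr u H h
    have c' := hr' u H h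
    rw [telescope, telescope, Real.log_mul (by linarith) a'.ne', Real.log_mul (by linarith) a.ne',
      add_sub_add_comm]
    refine (abs_add_le _ _).trans ?_
    rw [List.length_cons]
    push_cast
    linarith

/-- The stored form of a hypergraph whose hyperedges are listed in `L`. -/
noncomputable def ofSystem (G : SpinSystem V) (L : List (List V)) : List (WEdge V) :=
  L.map fun l => ⟨G.β l.toFinset, G.γ l.toFinset, l⟩

/-- `L` lists the hyperedges of `G`. -/
structure Lists (G : SpinSystem V) (L : List (List V)) : Prop where
  nodup_verts : ∀ l ∈ L, l.Nodup
  nodup_edges : (L.map List.toFinset).Nodup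
  edges_eq : (L.map List.toFinset).toFinset = G.edges

theorem Lists.mem_edges {G : SpinSystem V} {L : List (List V)} (h : Lists G L) {l : List V}
    (hl : l ∈ L) : l.toFinset ∈ G.edges := by
  rw [← h.edges_eq]
  exact List.mem_toFinset.2 (List.mem_map_of_mem hl)

theorem Lists.deg_eq {G : SpinSystem V} {L : List (List V)} (h : Lists G L) (u : V) :
    deg u (ofSystem G L) = G.degree u := by
  have e : G.edges.filter (fun e => u ∈ e) =
      ((L.map List.toFinset).filter fun e => decide (u ∈ e)).toFinset := by
    rw [← h.edges_eq, List.toFinset_filter]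
    simp
  rw [SpinSystem.degree, e, List.toFinset_card_of_nodup (h.nodup_edges.filter _),
    ← List.countP_eq_length_filter, List.countP_map, deg, ofSystem, List.countP_map]
  congr 1
  ext l
  simp

theorem Lists.adm [Fintype V] {G : SpinSystem V} {L : List (List V)} (h : Lists G L) {S : Set ℝ}
    {d : ℕ} (hd : G.maxDegree ≤ d) (hS : ∀ e ∈ G.edges, G.β e ∈ S ∧ G.γ e ∈ S) :
    Adm S d (ofSystem G L) := by
  refine ⟨?_, ?_, ?_, ?_⟩
  · intro e he
    obtain ⟨l, hl, rfl⟩ := List.mem_map.1 he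
    exact (hS _ (h.mem_edges hl)).1
  · intro e he
    obtain ⟨l, hl, rfl⟩ := List.mem_map.1 he
    exact (hS _ (h.mem_edges hl)).2
  · intro e he
    obtain ⟨l, hl, rfl⟩ := List.mem_map.1 he
    exact h.nodup_verts l hl
  · intro u
    rw [h.deg_eq]
    exact (Finset.le_sup (f := G.degree) (mem_univ u)).trans hd

/-- The weight that empty hyperedges contribute in excess. -/
noncomputable def excess (H : List (WEdge V)) : ℝ :=
  (H.map fun e => if e.verts = [] then e.g else 1).prod

theorem excess_pos {S : Set ℝ} (hS : ∀ x ∈ S, 0 < x) {d : ℕ} {H : List (WEdge V)}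
    (h : Adm S d H) : 0 < excess H := by
  refine List.prod_pos fun x hx => ?_
  obtain ⟨e, he, rfl⟩ := List.mem_map.1 hx
  split_ifs
  · exact hS _ (h.g_mem e he)
  · exact one_pos

/-- The two conventions differ only on the empty hyperedge, which has weight `β` in the system and
`β * γ` in stored form. -/
theorem Lists.wt_eq [Fintype V] {G : SpinSystem V} {L : List (List V)} (h : Lists G L) (σ : V → Bool) :
    wt (ofSystem G L) σ = excess (ofSystem G L) * ∏ e ∈ G.edges, G.edgeWeight e σ := by
  rw [← h.edges_eq, List.prod_toFinset _ h.nodup_edges, excess, wt, ofSystem, List.map_map,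
    List.map_map, List.map_map, ← List.prod_map_mul]
  congr 1
  refine List.map_congr_left fun l _ => ?_
  simp only [Function.comp, WEdge.weight, SpinSystem.edgeWeight, List.mem_toFinset]
  rcases l with _ | ⟨v, l⟩
  · simp [mul_comm]
  · by_cases h0 : ∀ w ∈ v :: l, σ w = false
    · have h1 : ¬ ∀ w ∈ v :: l, σ w = true := fun h1 => by
        have a := h0 v (by simp)
        have b := h1 v (by simp)
        simp [a] at b
      rw [if_pos h0, if_pos h0, if_neg h1]
      simp
    · rw [if_neg h0, if_neg h0]
      simp

/-- The product of the first labels. -/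
noncomputable def bprod (H : List (WEdge V)) : ℝ := (H.map fun e => e.b).prod

theorem bprod_pos {S : Set ℝ} (hS : ∀ x ∈ S, 0 < x) {d : ℕ} {H : List (WEdge V)}
    (h : Adm S d H) : 0 < bprod H := by
  refine List.prod_pos fun x hx => ?_
  obtain ⟨e, he, rfl⟩ := List.mem_map.1 hx
  exact hS _ (h.b_mem e he)

variable [Fintype V]

theorem wt_false (H : List (WEdge V)) : wt H (fun _ => false) = excess H * bprod H := by
  rw [excess, bprod, wt, ← List.prod_map_mul]
  congr 1
  refine List.map_congr_left fun e _ => ?_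
  unfold WEdge.weight
  rcases h : e.verts with _ | ⟨v, l⟩
  · simp [mul_comm]
  · have : ¬ ∀ w ∈ v :: l, false = true := fun h => absurd (h v (by simp)) (by simp)
    rw [if_neg this]
    simp

theorem mass_full (lam : ℝ) (H : List (WEdge V)) {l : List V} (hl : ∀ v, v ∈ l) :
    mass lam H false l = wt H fun _ => false := by
  unfold mass
  rw [Finset.sum_eq_single (fun _ => false)]
  · simp [field, SpinSystem.vertexWeight]
  · intro σ _ hσ
    rw [if_neg]
    exact fun h => hσ (funext fun v => h v (hl v))
  · simp

/-- The probability of the all-zero configuration is computed by the chain rule and is also its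
weight over the partition function. The factor `excess` occurs in both weights and cancels. -/
theorem Lists.partitionFunction_eq {lam : ℝ} (hl : 0 < lam) {G : SpinSystem V}
    {L : List (List V)} (hL : Lists G L) {S : Set ℝ} (h1 : (1 : ℝ) ∈ S)
    (hS : ∀ x ∈ S, 0 < x) {d : ℕ} (h : Adm S d (ofSystem G L)) {l : List V} (hn : l.Nodup)
    (hv : ∀ v, v ∈ l) :
    G.partitionFunction lam =
      bprod (ofSystem G L) * telescope (ratio lam) (ofSystem G L) l := by
  have a := chain_ratio hl h1 hS false hn h
  rw [mass_full lam _ hv, wt_false] at a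
  have b := telescope_mul_chain h1 (fun u H h => ratio_pos hl h1 hS h u) l _ h
  have c := excess_pos hS h
  have e : Z lam (ofSystem G L) = excess (ofSystem G L) * G.partitionFunction lam := by
    unfold Z SpinSystem.partitionFunction
    rw [Finset.mul_sum]
    refine Finset.sum_congr rfl fun σ _ => ?_
    rw [hL.wt_eq, SpinSystem.weight, field, mul_assoc]
  rw [e] at a
  refine mul_left_cancel₀ c.ne' ?_
  linear_combination (-(excess (ofSystem G L) * G.partitionFunction lam)) * b +
    telescope (ratio lam) (ofSystem G L) l * a

/-- The distance from `1` that is allowed for the labels when the maximum degree is `d`. -/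
noncomputable def slack (d : ℕ) : ℝ := 2 / (2 * Real.exp (-1 / 2) * (d : ℝ) + 3)

theorem slack_pos (d : ℕ) : 0 < slack d := by unfold slack; positivity

theorem slack_le (d : ℕ) : slack d ≤ 2 / 3 := by
  unfold slack
  have : 0 ≤ 2 * Real.exp (-1 / 2) * (d : ℝ) := by positivity
  exact div_le_div_of_nonneg_left (by norm_num) (by norm_num) (by linarith)

theorem slack_div (d : ℕ) :
    slack d / (1 - slack d) = 2 / (2 * Real.exp (-1 / 2) * (d : ℝ) + 1) := by
  unfold slack
  have : 0 ≤ 2 * Real.exp (-1 / 2) * (d : ℝ) := by positivity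
  rw [one_sub_div (by positivity), div_div_div_cancel_right₀ (by positivity)]
  congr 1
  ring

theorem exists_exponent {lam C : ℝ} (D : ℕ) (hC : 1 ≤ C) :
    ∃ T : ℕ, 0 < T ∧ ∀ d ≤ D, ∀ m : ℕ, d * (slack d / (1 - slack d) *
      min (Real.exp (-1 / 2))
        (2 * (m * Real.sigmoid (|Real.log lam| + D * Real.log 3) ^ m))) *
      (C * (m + 1)) ^ (1 / (T : ℝ)) ≤ 1 := by
  set q := Real.sigmoid (|Real.log lam| + D * Real.log 3)
  have hq0 : 0 < q := Real.sigmoid_pos _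
  set E := Real.exp (-1 / 2)
  have hE : 0 < E := Real.exp_pos _
  -- The contraction rate `2 E d / (2 E d + 1)` increases with `d`, so its value at `D` serves all
  -- `d ≤ D` and one `T` suffices.
  obtain ⟨T, hT, h⟩ := exists_root_contraction (α := 2 * E * D / (2 * E * D + 1)) (q := q)
    (by rw [div_lt_one (by positivity)]; linarith) hq0 (Real.sigmoid_lt_one _) (4 * D) C
    (by positivity) hC
  refine ⟨T, hT, fun d hd m => ?_⟩
  have hd' : (d : ℝ) ≤ D := by exact_mod_cast hd
  have hs : slack d / (1 - slack d) = 2 / (2 * E * d + 1) := slack_div d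
  rw [hs]
  have hk : 0 ≤ 2 / (2 * E * (d : ℝ) + 1) := by positivity
  refine h m _ (by positivity) ?_ ?_
  · calc d * (2 / (2 * E * (d : ℝ) + 1) * min E (2 * (m * q ^ m)))
        ≤ d * (2 / (2 * E * (d : ℝ) + 1) * E) := by
          gcongr
          exact min_le_left _ _
      _ = (2 * E * d) / (2 * E * (d : ℝ) + 1) := by ring
      _ ≤ 2 * E * D / (2 * E * D + 1) := by
          rw [div_le_div_iff₀ (by positivity) (by positivity)]
          nlinarith [mul_le_mul_of_nonneg_left hd' hE.le]
  · have h2 : 2 / (2 * E * (d : ℝ) + 1) ≤ 2 := by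
      have : 0 ≤ 2 * E * (d : ℝ) := by positivity
      rw [div_le_iff₀ (by positivity)]
      linarith
    calc d * (2 / (2 * E * (d : ℝ) + 1) * min E (2 * (m * q ^ m)))
        ≤ D * (2 * (2 * (m * q ^ m))) := by
          gcongr
          exact min_le_right _ _
      _ = 4 * D * (m * q ^ m) := by ring

/-- The budget that suffices for relative error `ε` on `n` vertices. -/
noncomputable def budget (D T n : ℕ) (ε : ℝ) : ℝ := ((4 * D + 1 : ℕ) * ((n : ℝ) + 1) / ε) ^ T

theorem accuracy {lam C : ℝ} (hl : 0 < lam) {D T : ℕ} (hC : 2 ≤ C) (hT : 0 < T)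
    (hcontr : ∀ d ≤ D, ∀ m : ℕ, d * (slack d / (1 - slack d) *
      min (Real.exp (-1 / 2))
        (2 * (m * Real.sigmoid (|Real.log lam| + D * Real.log 3) ^ m))) *
      (C * (m + 1)) ^ (1 / (T : ℝ)) ≤ 1)
    {G : SpinSystem V} (hG : G.maxDegree ≤ D) (hG' : G.LabelsInRange)
    {L : List (List V)} (hL : Lists G L) {l : List V} (hn : l.Nodup) (hv : ∀ v, v ∈ l)
    {ε : ℝ} (hε : 0 < ε) (hε1 : ε < 1) {k : ℕ} (hk : budget D T l.length ε < 2 ^ k) :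
    |bprod (ofSystem G L) *
        telescope (approx C lam k (budget D T l.length ε)) (ofSystem G L) l -
      G.partitionFunction lam| ≤ ε * G.partitionFunction lam := by
  -- The label range belongs to the instance's own maximum degree, so the contraction is used at
  -- `d`, not at `D`.
  set d := G.maxDegree with hd
  have hd' : (d : ℝ) ≤ D := by exact_mod_cast hG
  have hl3 : 0 < Real.log 3 := Real.log_pos (by norm_num)
  have hl3' : Real.log 3 ≤ 2 := by
    have := Real.log_le_sub_one_of_pos (show (0 : ℝ) < 3 by norm_num)
    linarith
  have h1 : (1 : ℝ) ∈ Set.Icc (1 - slack d) 1 := ⟨by linarith [slack_pos d], le_rfl⟩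
  have hS : ∀ x ∈ Set.Icc (1 - slack d) 1, 0 < x := fun x hx => by linarith [hx.1, slack_le d]
  have hadm : Adm (Set.Icc (1 - slack d) 1) d (ofSystem G L) := hL.adm le_rfl hG'
  set N := budget D T l.length ε with hN
  set X : ℝ := (4 * D + 1 : ℕ) * ((l.length : ℝ) + 1) / ε with hX
  have hX0 : 0 < X := by positivity
  have hN0 : 0 < N := by rw [hN]; unfold budget; positivity
  have hNX : N ^ (-(1 / (T : ℝ))) = X⁻¹ := by
    rw [hN, budget, ← hX, Real.rpow_neg (by positivity), one_div,
      Real.pow_rpow_inv_natCast hX0.le hT.ne']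
  have herr : ∀ (u : V) (H : List (WEdge V)), Adm (Set.Icc (1 - slack d) 1) d H →
      |Real.log (approx C lam k N u H) - Real.log (ratio lam u H)| ≤ d * Real.log 3 * X⁻¹ := by
    intro u H h
    rw [← hNX]
    exact approx_log_sub_le (Λ := |Real.log lam| + D * Real.log 3) hl (slack_le d)
      (slack_pos d).le hC (by positivity) (by gcongr) (hcontr d hG) k N u H hN0 hk h
  have hr : ∀ (u : V) (H : List (WEdge V)), Adm (Set.Icc (1 - slack d) 1) d H → 0 < ratio lam u H :=
    fun u H h => ratio_pos hl h1 hS h u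
  have hr' : ∀ (u : V) (H : List (WEdge V)), Adm (Set.Icc (1 - slack d) 1) d H → 0 < approx C lam k N u H :=
    fun u H h => (approx_pos_and_log hl (slack_le d) (slack_pos d).le k N u H h).1
  have ht := telescope_log_sub_le h1 hr hr' herr l _ hadm
  have hp := telescope_pos h1 hr l _ hadm
  have hp' := telescope_pos h1 hr' l _ hadm
  have hb := bprod_pos hS hadm
  rw [hL.partitionFunction_eq hl h1 hS hadm hn hv]
  set t := Real.log (telescope (approx C lam k N) (ofSystem G L) l) -
    Real.log (telescope (ratio lam) (ofSystem G L) l)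
  have hte : telescope (approx C lam k N) (ofSystem G L) l =
      telescope (ratio lam) (ofSystem G L) l * Real.exp t := by
    rw [Real.exp_sub, Real.exp_log hp', Real.exp_log hp]
    field_simp
  -- The `n` ratios each contribute at most `d log 3 / X ≤ 2 D ε / ((4 D + 1) (n + 1))`, which
  -- explains the constant `4 D + 1` of the budget.
  have hbound : |t| ≤ ε / 2 := by
    refine ht.trans ?_
    rw [hX, inv_div]
    have : (l.length : ℝ) * (d * Real.log 3) ≤ ((4 * D + 1 : ℕ) * ((l.length : ℝ) + 1)) / 2 := by
      have h4 : (d : ℝ) * Real.log 3 ≤ D * 2 := by gcongr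
      push_cast
      have h5 : (0 : ℝ) ≤ l.length := Nat.cast_nonneg _
      have h6 : (0 : ℝ) ≤ D := Nat.cast_nonneg _
      nlinarith [mul_le_mul_of_nonneg_left h4 h5]
    calc _ = ((l.length : ℝ) * (d * Real.log 3)) * (ε / ((4 * D + 1 : ℕ) * ((l.length : ℝ) + 1))) := by
          ring
      _ ≤ ((4 * D + 1 : ℕ) * ((l.length : ℝ) + 1)) / 2 *
          (ε / ((4 * D + 1 : ℕ) * ((l.length : ℝ) + 1))) :=
          mul_le_mul_of_nonneg_right this (by positivity)
      _ = ε / 2 := by field_simp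
  have hexp := Real.abs_exp_sub_one_le (x := t) (by linarith)
  rw [hte]
  have e : bprod (ofSystem G L) * (telescope (ratio lam) (ofSystem G L) l * Real.exp t) -
      bprod (ofSystem G L) * telescope (ratio lam) (ofSystem G L) l =
      (bprod (ofSystem G L) * telescope (ratio lam) (ofSystem G L) l) * (Real.exp t - 1) := by ring
  rw [e, abs_mul, abs_of_pos (mul_pos hb hp), mul_comm]
  exact mul_le_mul_of_nonneg_right (by linarith) (mul_pos hb hp).le

end Hyp

/-! ### Heights of numbers and cost accounting for programs. -/

/-- A measure of the length of numbers that grows additively under arithmetic and is comparable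
with the size. -/
structure IsHeight (M : CostModel) (h : ℝ → ℕ) : Prop where
  size_le : ∀ x ∈ M.carrier, M.size x ≤ 2 * h x
  le_size : ∀ x ∈ M.carrier, h x ≤ M.size x
  nat_mem : ∀ n : ℕ, (n : ℝ) ∈ M.carrier
  nat_le : ∀ n : ℕ, h (n : ℝ) ≤ n + 1
  result : ∀ (o : ArithOp) (x y z : ℝ), x ∈ M.carrier → y ∈ M.carrier → o.Result x y z →
    z ∈ M.carrier ∧ h z ≤ h x + h y + 1

/-- `x` is a number of the model of height at most `B`. -/
def Bounded (M : CostModel) (h : ℝ → ℕ) (B x : ℝ) : Prop := x ∈ M.carrier ∧ (h x : ℝ) ≤ B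

namespace Bounded

variable {M : CostModel} {h : ℝ → ℕ} {A B x y : ℝ}

theorem mono (hx : Bounded M h A x) (hab : A ≤ B) : Bounded M h B x := ⟨hx.1, hx.2.trans hab⟩

theorem result (hh : IsHeight M h) {o : ArithOp} {z : ℝ} (hx : Bounded M h A x)
    (hy : Bounded M h B y) (hz : o.Result x y z) : Bounded M h (A + B + 1) z := by
  obtain ⟨a, b⟩ := hh.result o x y z hx.1 hy.1 hz
  refine ⟨a, ?_⟩
  have : (h z : ℝ) ≤ h x + h y + 1 := by exact_mod_cast b
  linarith [hx.2, hy.2]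

theorem add (hh : IsHeight M h) (hx : Bounded M h A x) (hy : Bounded M h B y) :
    Bounded M h (A + B + 1) (x + y) := result hh (o := .add) hx hy rfl

theorem sub (hh : IsHeight M h) (hx : Bounded M h A x) (hy : Bounded M h B y) :
    Bounded M h (A + B + 1) (x - y) := result hh (o := .sub) hx hy rfl

theorem mul (hh : IsHeight M h) (hx : Bounded M h A x) (hy : Bounded M h B y) :
    Bounded M h (A + B + 1) (x * y) := result hh (o := .mul) hx hy rfl

theorem div (hh : IsHeight M h) (hx : Bounded M h A x) (hy : Bounded M h B y) (h0 : y ≠ 0) :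
    Bounded M h (A + B + 1) (x / y) := result hh (o := .div) hx hy ⟨h0, rfl⟩

theorem nat (hh : IsHeight M h) (n : ℕ) : Bounded M h (n + 1) (n : ℝ) :=
  ⟨hh.nat_mem n, by exact_mod_cast hh.nat_le n⟩

theorem one (hh : IsHeight M h) : Bounded M h 2 (1 : ℝ) := by
  have := nat hh 1
  norm_num at this
  exact this

end Bounded

/-- Evaluation in at most `k` steps, up to the factor that pays for operands of height at most
`Y`. -/
def Ev (M : CostModel) (P : Program) (Y : ℝ) (ρ : List Val) (c : Code) (v : Val) (k : ℝ) : Prop :=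
  ∃ t : ℕ, Runs M.size P ρ c v t ∧ (t : ℝ) ≤ (4 * |Y| + 1) * k

/-- The `f`-th function maps `x` to `v` in at most `k` steps. -/
def Fn (M : CostModel) (P : Program) (Y : ℝ) (f : ℕ) (x v : Val) (k : ℝ) : Prop :=
  ∃ body, P[f]? = some body ∧ Ev M P Y [x] body v k

namespace Ev

variable {M : CostModel} {P : Program} {Y : ℝ} {ρ : List Val} {a b c d : Code} {u v w : Val}
  {j k l : ℝ} {h : ℝ → ℕ}

theorem mono (he : Ev M P Y ρ c v k) (hk : k ≤ l) : Ev M P Y ρ c v l := by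
  obtain ⟨t, ht, hb⟩ := he
  exact ⟨t, ht, hb.trans (mul_le_mul_of_nonneg_left hk (by positivity))⟩

theorem step_le (Y : ℝ) {t : ℕ} (ht : t ≤ 1) {k : ℝ} (hk : 1 ≤ k) :
    (t : ℝ) ≤ (4 * |Y| + 1) * k := by
  have h1 : (t : ℝ) ≤ 1 := by exact_mod_cast ht
  have h2 : 0 ≤ |Y| := abs_nonneg Y
  nlinarith

theorem var {i : ℕ} (h : ρ[i]? = some v) : Ev M P Y ρ (.var i) v 1 :=
  ⟨1, .var h, step_le Y le_rfl le_rfl⟩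

theorem nil : Ev M P Y ρ .nil .nil 1 := ⟨1, .nil, step_le Y le_rfl le_rfl⟩

theorem nat (n : ℕ) : Ev M P Y ρ (.const n) (.num n) 1 := by
  refine ⟨1, ?_, step_le Y le_rfl le_rfl⟩
  have := Runs.const (size := M.size) (P := P) (ρ := ρ) (q := (n : ℚ))
  simpa using this

theorem one : Ev M P Y ρ (.const 1) (.num 1) 1 := by
  simpa using nat (M := M) (P := P) (Y := Y) (ρ := ρ) 1

theorem zero : Ev M P Y ρ (.const 0) (.num 0) 1 := by
  simpa using nat (M := M) (P := P) (Y := Y) (ρ := ρ) 0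

theorem pair (ha : Ev M P Y ρ a u j) (hb : Ev M P Y ρ b v k) :
    Ev M P Y ρ (.pair a b) (.pair u v) (j + k + 1) := by
  obtain ⟨s, hs, hs'⟩ := ha
  obtain ⟨t, ht, ht'⟩ := hb
  refine ⟨_, .pair hs ht, ?_⟩
  push_cast
  nlinarith [abs_nonneg Y]

theorem letIn (ha : Ev M P Y ρ a u j) (hb : Ev M P Y (u :: ρ) b v k) :
    Ev M P Y ρ (.letIn a b) v (j + k + 1) := by
  obtain ⟨s, hs, hs'⟩ := ha
  obtain ⟨t, ht, ht'⟩ := hb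
  refine ⟨_, .letIn hs ht, ?_⟩
  push_cast
  nlinarith [abs_nonneg Y]

theorem size_le (hh : IsHeight M h) {x : ℝ} (hx : Bounded M h Y x) :
    (M.size x : ℝ) ≤ 2 * |Y| := by
  have h1 : (M.size x : ℝ) ≤ 2 * h x := by exact_mod_cast hh.size_le x hx.1
  linarith [hx.2, le_abs_self Y]

/-- Two operands of size at most `2 * |Y|` and the unit charge make `4 * |Y| + 1`, the price of one
step in `Ev`. Steps and heights can then be counted separately. -/
theorem arith (hh : IsHeight M h) {o : ArithOp} {x y z : ℝ} (ha : Ev M P Y ρ a (.num x) j)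
    (hb : Ev M P Y ρ b (.num y) k) (hx : Bounded M h Y x) (hy : Bounded M h Y y)
    (hz : o.Result x y z) : Ev M P Y ρ (.arith o a b) (.num z) (j + k + 1) := by
  obtain ⟨s, hs, hs'⟩ := ha
  obtain ⟨t, ht, ht'⟩ := hb
  refine ⟨_, .arith hs ht hz, ?_⟩
  have := size_le hh hx
  have := size_le hh hy
  push_cast
  nlinarith [abs_nonneg Y]

theorem ifLt_true (hh : IsHeight M h) {x y : ℝ} (ha : Ev M P Y ρ a (.num x) j)
    (hb : Ev M P Y ρ b (.num y) k) (hx : Bounded M h Y x) (hy : Bounded M h Y y)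
    (hz : x < y) (hc : Ev M P Y ρ c v l) : Ev M P Y ρ (.ifLt a b c d) v (j + k + l + 1) := by
  obtain ⟨s, hs, hs'⟩ := ha
  obtain ⟨t, ht, ht'⟩ := hb
  obtain ⟨r, hr, hr'⟩ := hc
  refine ⟨_, .ifLt_true hs ht hz hr, ?_⟩
  have := size_le hh hx
  have := size_le hh hy
  push_cast
  nlinarith [abs_nonneg Y]

theorem ifLt_false (hh : IsHeight M h) {x y : ℝ} (ha : Ev M P Y ρ a (.num x) j)
    (hb : Ev M P Y ρ b (.num y) k) (hx : Bounded M h Y x) (hy : Bounded M h Y y)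
    (hz : ¬ x < y) (hc : Ev M P Y ρ d v l) : Ev M P Y ρ (.ifLt a b c d) v (j + k + l + 1) := by
  obtain ⟨s, hs, hs'⟩ := ha
  obtain ⟨t, ht, ht'⟩ := hb
  obtain ⟨r, hr, hr'⟩ := hc
  refine ⟨_, .ifLt_false hs ht hz hr, ?_⟩
  have := size_le hh hx
  have := size_le hh hy
  push_cast
  nlinarith [abs_nonneg Y]

theorem split (ha : Ev M P Y ρ a (.pair u v) j) (hb : Ev M P Y (u :: v :: ρ) b w k) :
    Ev M P Y ρ (.split a b c) w (j + k + 1) := by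
  obtain ⟨s, hs, hs'⟩ := ha
  obtain ⟨t, ht, ht'⟩ := hb
  refine ⟨_, .split_pair hs ht, ?_⟩
  push_cast
  nlinarith [abs_nonneg Y]

theorem split_nil (ha : Ev M P Y ρ a .nil j) (hc : Ev M P Y ρ c w k) :
    Ev M P Y ρ (.split a b c) w (j + k + 1) := by
  obtain ⟨s, hs, hs'⟩ := ha
  obtain ⟨t, ht, ht'⟩ := hc
  refine ⟨_, .split_leaf hs (by simp) ht, ?_⟩
  push_cast
  nlinarith [abs_nonneg Y]

theorem call {f : ℕ} (ha : Ev M P Y ρ a u j) (hf : Fn M P Y f u v k) :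
    Ev M P Y ρ (.call f a) v (j + k + 1) := by
  obtain ⟨s, hs, hs'⟩ := ha
  obtain ⟨body, hbody, t, ht, ht'⟩ := hf
  refine ⟨_, .call hs hbody ht, ?_⟩
  push_cast
  nlinarith [abs_nonneg Y]

end Ev

theorem Fn.mono {M : CostModel} {P : Program} {Y : ℝ} {f : ℕ} {x v : Val} {k l : ℝ}
    (hf : Fn M P Y f x v k) (hk : k ≤ l) : Fn M P Y f x v l := by
  obtain ⟨b, hb, he⟩ := hf
  exact ⟨b, hb, he.mono hk⟩

/-! ## The program -/

namespace Scheme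

/-- Product of `T` copies of variable `0`. -/
def powCode : ℕ → Code
  | 0 => .const 1
  | T + 1 => .arith .mul (.var 0) (powCode T)

/-- The whole computation: the budget, then the product of all labels `β` and of all `1 + R`. -/
def mainCode (K T : ℕ) : Code :=
  .split (.var 0) (.split (.var 1) (.split (.var 1)
    (.letIn (.arith .div (.arith .mul (.const K) (.arith .add (.var 0) (.const 1))) (.var 2))
      (.letIn (powCode T)
        (.arith .mul (.call 8 (.var 3))
          (.call 7 (.pair (.pair (.var 6) (.var 0)) (.pair (.var 2) (.var 3)))))))
    .nil) .nil) .nil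

/-- Remove a vertex from a list that contains it; fail otherwise. -/
def stripCode : Code :=
  .split (.var 0) (.split (.var 1)
    (.ifLt (.var 0) (.var 2)
      (.split (.call 1 (.pair (.var 2) (.var 1))) (.pair .nil (.pair (.var 2) (.var 1))) .nil)
      (.ifLt (.var 2) (.var 0)
        (.split (.call 1 (.pair (.var 2) (.var 1))) (.pair .nil (.pair (.var 2) (.var 1))) .nil)
        (.pair .nil (.var 1))))
    .nil) .nil

/-- Fix the spin of a vertex in all hyperedges of a list and prepend them to a second list. -/
def pinCode : Code :=
  .split (.var 0) (.split (.var 1) (.split (.var 1) (.split (.var 0)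
    (.letIn (.call 2 (.pair (.var 6) (.pair (.var 4) (.pair (.var 1) (.var 3)))))
      (.split (.var 1) (.split (.var 1)
        (.split (.call 1 (.pair (.var 9) (.var 1)))
          (.split (.var 13)
            (.pair (.pair (.const 1) (.pair (.var 4) (.var 3))) (.var 8))
            (.pair (.pair (.var 4) (.pair (.const 1) (.var 1))) (.var 6)))
          (.pair (.var 5) (.var 4)))
        .nil) .nil))
    (.var 1)) .nil) .nil) .nil

/-- One more than the length of a list. -/
def lenCode : Code :=
  .split (.var 0) (.arith .add (.call 3 (.var 1)) (.const 1)) (.const 1)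

/-- The probability that a list of vertices has a constant spin. -/
def chainCode : Code :=
  .split (.var 0) (.split (.var 1) (.split (.var 1) (.split (.var 1)
    (.letIn (.call 6 (.pair (.var 4) (.pair (.var 0) (.var 2))))
      (.arith .mul
        (.split (.var 7)
          (.arith .div (.var 2) (.arith .add (.const 1) (.var 2)))
          (.arith .div (.const 1) (.arith .add (.const 1) (.var 0))))
        (.call 4 (.pair (.var 7) (.pair (.var 5)
          (.pair (.call 2 (.pair (.var 7) (.pair (.var 1) (.pair (.var 3) .nil))))
            (.var 2)))))))
    (.const 1)) .nil) .nil) .nil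

/-- The product over all hyperedges through a vertex. -/
def loopCode (C : ℕ) : Code :=
  .split (.var 0) (.split (.var 1) (.split (.var 1) (.split (.var 0)
    (.split (.var 0) (.split (.var 1)
      (.split (.call 1 (.pair (.var 8) (.var 1)))
        (.letIn (.call 2 (.pair .nil (.pair (.var 10) (.pair (.var 7) (.var 9)))))
          (.split (.var 13)
            (.letIn (.pair (.var 0)
                (.arith .div (.var 1) (.arith .mul (.const C) (.call 3 (.var 4)))))
              (.arith .mul
                (.arith .div
                  (.arith .sub (.const 1) (.arith .mul (.arith .sub (.const 1) (.var 6))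
                    (.call 4 (.pair (.pair .nil .nil) (.pair (.var 0)
                      (.pair (.var 3) (.var 5)))))))
                  (.arith .sub (.const 1) (.arith .mul (.arith .sub (.const 1) (.var 8))
                    (.call 4 (.pair .nil (.pair (.var 0) (.pair (.var 3) (.var 5))))))))
                (.call 5 (.pair (.var 16) (.pair (.var 14) (.pair (.var 11)
                  (.pair (.pair (.const 1) (.pair (.var 6) (.var 5))) (.var 13))))))))
            .nil))
        (.call 5 (.pair (.var 10) (.pair (.var 8) (.pair (.var 5)
          (.pair (.var 4) (.var 7)))))))
      .nil) .nil)
    (.split (.var 4) (.var 0) .nil)) .nil) .nil) .nil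

/-- The approximate ratio at a vertex. -/
def ratioCode : Code :=
  .split (.var 0) (.split (.var 1) (.split (.var 2)
    (.ifLt (.var 1) (.const 1) (.var 0)
      (.call 5 (.pair (.var 4) (.pair (.var 2) (.pair (.var 3) .nil)))))
    .nil) .nil) .nil

/-- The product of `1 + R` over the vertices below a bound, pinning them to `0` one by one. -/
def teleCode : Code :=
  .split (.var 0) (.split (.var 1)
    (.ifLt (.const 0) (.var 0)
      (.letIn (.arith .sub (.var 0) (.const 1))
        (.arith .mul
          (.arith .add (.const 1) (.call 6 (.pair (.var 3) (.pair (.var 0) (.var 2)))))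
          (.call 7 (.pair (.var 3) (.pair (.var 0)
            (.call 2 (.pair .nil (.pair (.var 0) (.pair (.var 2) .nil)))))))))
      (.const 1))
    .nil) .nil

/-- The product of all labels `β`. -/
def bprodCode : Code :=
  .split (.var 0) (.split (.var 0) (.arith .mul (.var 0) (.call 8 (.var 3))) .nil) (.const 1)

/-- The program. -/
def program (C K T : ℕ) : Program :=
  [mainCode K T, stripCode, pinCode, lenCode, chainCode, loopCode C, ratioCode, teleCode,
    bprodCode]

/-! ## Data -/

variable {n : ℕ}

noncomputable def encV (v : Fin n) : Val := .num ((v : ℕ) : ℝ)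

noncomputable def encL : List (Fin n) → Val
  | [] => .nil
  | v :: l => .pair (encV v) (encL l)

noncomputable def encE (e : WEdge (Fin n)) : Val :=
  .pair (.num e.b) (.pair (.num e.g) (encL e.verts))

noncomputable def encH : List (WEdge (Fin n)) → Val
  | [] => .nil
  | e :: H => .pair (encE e) (encH H)

/-- With this coding `split` branches on a spin. -/
def encS (s : Bool) : Val := if s = true then .pair .nil .nil else .nil

theorem encL_eq (l : List (Fin n)) :
    encL l = Val.ofList (l.map fun v => .num ((v : ℕ) : ℝ)) := by
  induction l with
  | nil => rfl
  | cons v l ih => rw [encL, ih]; rfl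

theorem encH_ofSystem (G : SpinSystem (Fin n)) (L : List (List (Fin n))) :
    encH (Hyp.ofSystem G L) = Val.ofList (L.map G.encodeEdge) := by
  induction L with
  | nil => rfl
  | cons l L ih =>
    have : encH (Hyp.ofSystem G (l :: L)) = .pair (encE ⟨G.β l.toFinset, G.γ l.toFinset, l⟩)
      (encH (Hyp.ofSystem G L)) := rfl
    rw [this, ih, encE, encL_eq]
    rfl

/-- The space taken by a list of hyperedges. -/
def vol (H : List (WEdge (Fin n))) : ℕ := (H.map fun e => 1 + e.verts.length).sum

theorem vol_cons (e : WEdge (Fin n)) (H : List (WEdge (Fin n))) :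
    vol (e :: H) = 1 + e.verts.length + vol H := by simp [vol]

theorem vol_append (H K : List (WEdge (Fin n))) : vol (H ++ K) = vol H + vol K := by simp [vol]

theorem vol_pin (s : Bool) (u : Fin n) (H : List (WEdge (Fin n))) :
    vol (Hyp.pin s u H) ≤ vol H := by
  induction H with
  | nil => simp [Hyp.pin]
  | cons e H ih =>
    have : Hyp.pin s u (e :: H) = WEdge.restrict s u e :: Hyp.pin s u H := rfl
    rw [this, vol_cons, vol_cons]
    have := (WEdge.restrict_sublist s u e).length_le
    omega

/-! ## The functions that do not recurse through ratios -/

variable {M : CostModel} {h : ℝ → ℕ} {C K T : ℕ} {Y : ℝ}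

/-- The result of removing a vertex. -/
noncomputable def encStrip (u : Fin n) (l : List (Fin n)) : Val :=
  if u ∈ l then .pair .nil (encL (l.erase u)) else .nil

theorem bounded_vertex (hh : IsHeight M h) (hY : (n : ℝ) + 3 ≤ Y) (v : Fin n) :
    Bounded M h Y ((v : ℕ) : ℝ) := by
  refine (Bounded.nat hh v).mono ?_
  have : ((v : ℕ) : ℝ) ≤ n := by exact_mod_cast v.2.le
  linarith

/-- Vertices are recognised as equal when `<` fails in both directions. A pair signals success, so
membership test and removal are one call. -/
theorem fn_strip (hh : IsHeight M h) (hY : (n : ℝ) + 3 ≤ Y) (u : Fin n) (l : List (Fin n)) :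
    Fn M (program C K T) Y 1 (.pair (encV u) (encL l)) (encStrip u l) (30 * (l.length + 1)) := by
  induction l with
  | nil =>
    refine ⟨_, rfl, Ev.mono (k := 5) ?_ (by norm_num)⟩
    exact (Ev.split (Ev.var rfl) (Ev.split_nil (Ev.var rfl) .nil)).mono (by norm_num)
  | cons v l ih =>
    refine ⟨_, rfl, Ev.split (Ev.var rfl) (Ev.split (Ev.var rfl) ?_) |>.mono
      (k := 1 + (1 + (26 + 30 * (l.length + 1)) + 1) + 1) (by rw [List.length_cons]; push_cast; linarith)⟩
    have bu := bounded_vertex hh hY u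
    have bv := bounded_vertex hh hY v
    by_cases huv : u = v
    · subst huv
      have : encStrip u (u :: l) = .pair .nil (encL l) := by simp [encStrip]
      rw [this]
      refine (Ev.ifLt_false hh (Ev.var rfl) (Ev.var rfl) bu bu (lt_irrefl _)
        (Ev.ifLt_false hh (Ev.var rfl) (Ev.var rfl) bu bu (lt_irrefl _)
          (Ev.pair .nil (Ev.var rfl)))).mono ?_
      have : (0 : ℝ) ≤ l.length := Nat.cast_nonneg _
      linarith
    · have rest : Ev M (program C K T) Y
          (encV v :: encL l :: encV u :: encL (v :: l) :: [.pair (encV u) (encL (v :: l))])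
          (.split (.call 1 (.pair (.var 2) (.var 1))) (.pair .nil (.pair (.var 2) (.var 1))) .nil)
          (encStrip u (v :: l)) (12 + 30 * (l.length + 1)) := by
        have hc := Ev.call (Ev.pair (Ev.var (M := M) (P := program C K T) (Y := Y)
          (ρ := encV v :: encL l :: encV u :: encL (v :: l) ::
            [.pair (encV u) (encL (v :: l))]) (i := 2) rfl) (Ev.var (i := 1) rfl)) ih
        by_cases hu : u ∈ l
        · have e1 : encStrip u l = .pair .nil (encL (l.erase u)) := by simp [encStrip, hu]
          have e2 : encStrip u (v :: l) = .pair .nil (.pair (encV v) (encL (l.erase u))) := by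
            simp [encStrip, hu, Ne.symm huv, encL]
          rw [e1] at hc
          rw [e2]
          exact (Ev.split hc (Ev.pair .nil (Ev.pair (Ev.var rfl) (Ev.var rfl)))).mono (by linarith)
        · have e1 : encStrip u l = .nil := by simp [encStrip, hu]
          have e2 : encStrip u (v :: l) = .nil := by simp [encStrip, hu, huv]
          rw [e1] at hc
          rw [e2]
          exact (Ev.split_nil hc .nil).mono (by linarith)
      have hne : ((u : ℕ) : ℝ) ≠ ((v : ℕ) : ℝ) := by
        simpa [Fin.val_inj] using huv
      rcases lt_or_gt_of_ne hne with hlt | hlt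
      · exact (Ev.ifLt_false hh (Ev.var rfl) (Ev.var rfl) bv bu (not_lt.2 hlt.le)
          (Ev.ifLt_true hh (Ev.var rfl) (Ev.var rfl) bu bv hlt rest)).mono (by linarith)
      · exact (Ev.ifLt_true hh (Ev.var rfl) (Ev.var rfl) bv bu hlt rest).mono (by linarith)

theorem fn_pin (hh : IsHeight M h) (hY : (n : ℝ) + 3 ≤ Y) (s : Bool) (u : Fin n)
    (H acc : List (WEdge (Fin n))) :
    Fn M (program C K T) Y 2 (.pair (encS s) (.pair (encV u) (.pair (encH H) (encH acc))))
      (encH (Hyp.pin s u H ++ acc)) (100 * (vol H + 1)) := by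
  induction H with
  | nil =>
    refine ⟨_, rfl, Ev.mono (k := 20) ?_ (by simp [vol]; norm_num)⟩
    exact (Ev.split (Ev.var rfl) (Ev.split (Ev.var rfl) (Ev.split (Ev.var rfl)
      (Ev.split_nil (Ev.var rfl) (Ev.var rfl))))).mono (by norm_num)
  | cons e H ih =>
    have hlen : (0 : ℝ) ≤ e.verts.length := Nat.cast_nonneg _
    refine ⟨_, rfl, Ev.split (Ev.var rfl) (Ev.split (Ev.var rfl) (Ev.split (Ev.var rfl)
      (Ev.split (Ev.var rfl) (Ev.letIn (Ev.call (Ev.pair (Ev.var rfl) (Ev.pair (Ev.var rfl)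
        (Ev.pair (Ev.var rfl) (Ev.var rfl)))) ih) (Ev.split (Ev.var rfl) (Ev.split (Ev.var rfl)
          (k := 25 + 30 * (e.verts.length + 1)) ?_)))))) |>.mono
          (by rw [vol_cons]; push_cast; linarith)⟩
    have e0 : Hyp.pin s u (e :: H) ++ acc =
      WEdge.restrict s u e :: (Hyp.pin s u H ++ acc) := rfl
    rw [e0]
    have hc := fn_strip (C := C) (K := K) (T := T) hh hY u e.verts
    by_cases hu : u ∈ e.verts
    · have e1 : encStrip u e.verts = .pair .nil (encL (e.verts.erase u)) := by simp [encStrip, hu]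
      rw [e1] at hc
      cases s
      · have e2 : WEdge.restrict false u e = ⟨e.b, 1, e.verts.erase u⟩ := by
          simp [WEdge.restrict, hu]
        rw [e2]
        exact (Ev.split (Ev.call (Ev.pair (Ev.var rfl) (Ev.var rfl)) hc)
          (Ev.split_nil (Ev.var rfl) (Ev.pair (Ev.pair (Ev.var rfl) (Ev.pair Ev.one (Ev.var rfl)))
            (Ev.var rfl)))).mono (by linarith)
      · have e2 : WEdge.restrict true u e = ⟨1, e.g, e.verts.erase u⟩ := by
          simp [WEdge.restrict, hu]
        rw [e2]
        exact (Ev.split (Ev.call (Ev.pair (Ev.var rfl) (Ev.var rfl)) hc)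
          (Ev.split (Ev.var rfl) (Ev.pair (Ev.pair Ev.one (Ev.pair (Ev.var rfl) (Ev.var rfl)))
            (Ev.var rfl)))).mono (by linarith)
    · have e1 : encStrip u e.verts = .nil := by simp [encStrip, hu]
      have e2 : WEdge.restrict s u e = e := by simp [WEdge.restrict, hu]
      rw [e1] at hc
      rw [e2]
      exact (Ev.split_nil (Ev.call (Ev.pair (Ev.var rfl) (Ev.var rfl)) hc)
        (Ev.pair (Ev.var rfl) (Ev.var rfl))).mono (by linarith)

theorem fn_len (hh : IsHeight M h) (l : List (Fin n)) (hY : (l.length : ℝ) + 3 ≤ Y) :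
    Fn M (program C K T) Y 3 (encL l) (.num (l.length + 1)) (10 * (l.length + 1)) := by
  induction l with
  | nil =>
    refine ⟨_, rfl, ?_⟩
    simp only [List.length_nil, Nat.cast_zero, zero_add]
    exact (Ev.split_nil (Ev.var rfl) Ev.one).mono (by norm_num)
  | cons v l ih =>
    rw [List.length_cons] at hY
    push_cast at hY
    refine ⟨_, rfl, Ev.split (Ev.var rfl) (Ev.arith hh (Ev.call (Ev.var rfl) (ih (by linarith)))
      Ev.one ?_ ((Bounded.one hh).mono ?_) ?_) |>.mono (by rw [List.length_cons]; push_cast; linarith)⟩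
    · have := (Bounded.nat hh (l.length + 1)).mono (B := Y) (by push_cast; linarith)
      exact_mod_cast this
    · have : (0 : ℝ) ≤ l.length := Nat.cast_nonneg _
      linarith
    · simp [ArithOp.Result]

theorem fn_bprod (hh : IsHeight M h) {B : ℝ} {S : Set ℝ} (hS : ∀ x ∈ S, Bounded M h B x)
    (hB : 0 ≤ B) (H : List (WEdge (Fin n))) (hH : ∀ e ∈ H, e.b ∈ S)
    (hY : (H.length : ℝ) * (B + 1) + 2 ≤ Y) :
    Fn M (program C K T) Y 8 (encH H) (.num (Hyp.bprod H)) (10 * (H.length + 1)) ∧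
      Bounded M h (H.length * (B + 1) + 2) (Hyp.bprod H) := by
  induction H with
  | nil =>
    refine ⟨⟨_, rfl, ?_⟩, ?_⟩
    · simp only [Hyp.bprod, List.map_nil, List.prod_nil]
      exact (Ev.split_nil (Ev.var rfl) Ev.one).mono (by norm_num)
    · simpa [Hyp.bprod] using Bounded.one hh
  | cons e H ih =>
    have hlen : (0 : ℝ) ≤ H.length := Nat.cast_nonneg _
    rw [List.length_cons] at hY ⊢
    push_cast at hY ⊢
    obtain ⟨i1, i2⟩ := ih (fun e he => hH e (List.mem_cons_of_mem _ he)) (by linarith)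
    have hb := hS _ (hH e (by simp))
    have e1 : Hyp.bprod (e :: H) = e.b * Hyp.bprod H := by simp [Hyp.bprod]
    rw [e1]
    refine ⟨⟨_, rfl, (Ev.split (Ev.var rfl) (Ev.split (Ev.var rfl) (Ev.arith (o := .mul) hh (Ev.var rfl)
      (Ev.call (Ev.var rfl) i1) (hb.mono ?_) (i2.mono ?_) rfl))).mono (by linarith)⟩,
      (hb.mul hh i2).mono (by linarith)⟩
    · nlinarith
    · linarith

end Scheme

/-! ### Heights of the computed numbers, and steps of the chain and loop functions. -/

namespace Scheme

open Hyp

variable {n : ℕ}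

/-- The instances that occur during the computation. -/
structure Valid (S : Set ℝ) (d W : ℕ) (H : List (WEdge (Fin n))) : Prop where
  adm : Adm S d H
  vol_le : vol H ≤ W

theorem Valid.pin {S : Set ℝ} (h1 : (1 : ℝ) ∈ S) {d W : ℕ} {H : List (WEdge (Fin n))}
    (hv : Valid S d W H) (s : Bool) (u : Fin n) : Valid S d W (pin s u H) :=
  ⟨hv.adm.pin h1 s u, (vol_pin s u H).trans hv.vol_le⟩

theorem Valid.tail_pin {S : Set ℝ} (h1 : (1 : ℝ) ∈ S) {d W : ℕ} {e : WEdge (Fin n)}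
    {H acc : List (WEdge (Fin n))} (hv : Valid S d W (e :: H ++ acc)) (s : Bool) (u : Fin n) :
    Valid S d W (Hyp.pin s u H ++ acc) := by
  refine ⟨(Adm.tail hv.adm).pin_append h1 s u, ?_⟩
  have a := hv.vol_le
  have b := vol_pin s u H
  rw [List.cons_append, vol_cons, vol_append] at a
  rw [vol_append]
  omega

theorem Valid.rotate {S : Set ℝ} {d W : ℕ} {e : WEdge (Fin n)}
    {H acc : List (WEdge (Fin n))} (hv : Valid S d W (e :: H ++ acc)) :
    Valid S d W (H ++ e :: acc) := by
  refine ⟨hv.adm.rotate, ?_⟩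
  have a := hv.vol_le
  rw [List.cons_append, vol_cons, vol_append] at a
  rw [vol_append, vol_cons]
  omega

theorem Valid.rotate_erase {S : Set ℝ} (h1 : (1 : ℝ) ∈ S) {d W : ℕ} {e : WEdge (Fin n)}
    {H acc : List (WEdge (Fin n))} (hv : Valid S d W (e :: H ++ acc)) (u : Fin n) :
    Valid S d W (H ++ ⟨1, e.g, e.verts.erase u⟩ :: acc) := by
  refine ⟨hv.adm.rotate_erase h1 u, ?_⟩
  have a := hv.vol_le
  have b := List.erase_sublist (a := u) (l := e.verts) |>.length_le
  rw [List.cons_append, vol_cons, vol_append] at a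
  rw [vol_append, vol_cons]
  dsimp only
  omega

theorem Valid.length_erase {S : Set ℝ} {d W : ℕ} {e : WEdge (Fin n)}
    {H acc : List (WEdge (Fin n))} (hv : Valid S d W (e :: H ++ acc)) {u : Fin n}
    (hu : u ∈ e.verts) : e.verts.length = (e.verts.erase u).length + 1 ∧
      (e.verts.erase u).length + 2 ≤ W := by
  have a := hv.vol_le
  have b := List.length_erase_of_mem hu
  have c := List.length_pos_of_mem hu
  rw [List.cons_append, vol_cons] at a
  omega

/-- Labels that are close to `1` and of height at most `B`. -/
structure Labels (M : CostModel) (h : ℝ → ℕ) (δ B : ℝ) (S : Set ℝ) : Prop where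
  one_mem : (1 : ℝ) ∈ S
  mem_Icc : ∀ x ∈ S, x ∈ Set.Icc (1 - δ) 1
  bounded : ∀ x ∈ S, Bounded M h B x
  delta_nonneg : 0 ≤ δ
  delta_le : δ ≤ 2 / 3
  two_le : 2 ≤ B

theorem Valid.adm_Icc {M : CostModel} {h : ℝ → ℕ} {δ B : ℝ} {S : Set ℝ}
    (hS : Labels M h δ B S) {d W : ℕ} {H : List (WEdge (Fin n))}
    (hv : Valid S d W H) : Adm (Set.Icc (1 - δ) 1) d H :=
  ⟨fun e he => hS.mem_Icc _ (hv.adm.b_mem e he), fun e he => hS.mem_Icc _ (hv.adm.g_mem e he),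
    hv.adm.nodup, hv.adm.deg_le⟩

variable {M : CostModel} {h : ℝ → ℕ} {δ B : ℝ} {S : Set ℝ} {d W : ℕ}

theorem bounded_nonneg {X x : ℝ} (hx : Bounded M h X x) : 0 ≤ X :=
  (Nat.cast_nonneg _).trans hx.2

theorem bern_bounded (hh : IsHeight M h) (s : Bool) {r X : ℝ} (hr : 0 < r)
    (hX : Bounded M h X r) : Bounded M h (2 * X + 6) (bern s r) := by
  have h0 := bounded_nonneg hX
  have h1 : (1 + r) ≠ 0 := by positivity
  have h2 := (Bounded.one hh).add hh hX
  unfold bern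
  split_ifs
  · exact (hX.div hh h2 h1).mono (by linarith)
  · exact ((Bounded.one hh).div hh h2 h1).mono (by linarith)

/-- A ratio of height `X` occurs twice in its marginal, which gives `2 X + 6`; multiplication adds
1. -/
theorem chain_bounded (hh : IsHeight M h) (hS : Labels M h δ B S)
    {rat : Fin n → List (WEdge (Fin n)) → ℝ} {X : ℝ}
    (hr0 : ∀ u H, Adm (Set.Icc (1 - δ) 1) d H → 0 < rat u H)
    (hr : ∀ u H, Valid S d W H → Bounded M h X (rat u H)) (s : Bool)
    (l : List (Fin n)) : ∀ H, Valid S d W H →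
      Bounded M h (l.length * (2 * X + 7) + 2) (chain rat s H l) := by
  induction l with
  | nil => intro H _; simpa [chain] using Bounded.one hh
  | cons u l ih =>
    intro H hv
    have a := ih _ (hv.pin hS.one_mem s u)
    rw [List.length_cons]
    push_cast
    exact ((bern_bounded hh s (hr0 u H (hv.adm_Icc hS)) (hr u H hv)).mul hh a).mono (by linarith)

theorem factor_bounded (hh : IsHeight M h) {b g p q A A' : ℝ} (hb : Bounded M h B b)
    (hg : Bounded M h B g) (hp : Bounded M h A p) (hq : Bounded M h A' q)
    (h0 : 1 - (1 - b) * q ≠ 0) : Bounded M h (2 * B + A + A' + 15) (factor b g p q) := by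
  have o := Bounded.one hh
  exact ((o.sub hh ((o.sub hh hg).mul hh hp)).div hh (o.sub hh ((o.sub hh hb).mul hh hq))
    h0).mono (by linarith)

theorem Valid.denominator_ne_zero (hS : Labels M h δ B S)
    {rat : Fin n → List (WEdge (Fin n)) → ℝ}
    (hr0 : ∀ u H, Adm (Set.Icc (1 - δ) 1) d H → 0 < rat u H) {b : ℝ} (hb : b ∈ S) (s : Bool)
    (l : List (Fin n)) {H : List (WEdge (Fin n))} (hv : Valid S d W H) :
    1 - (1 - b) * chain rat s H l ≠ 0 := by
  have h1 : (1 : ℝ) ∈ Set.Icc (1 - δ) 1 := ⟨by linarith [hS.delta_nonneg], le_rfl⟩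
  obtain ⟨q0, q1⟩ := chain_mem h1 s hr0 l _ (hv.adm_Icc hS)
  have := (one_sub_mul_mem hS.delta_le (hS.mem_Icc b hb) q0 q1).1
  linarith

/-- A hyperedge with `m` other vertices brings two chains, hence `4 m X m`. The hypothesis `hX`
splits this into a part charged to the volume and a part `η` charged once per hyperedge at `u`. -/
theorem loop_bounded (hh : IsHeight M h) (hS : Labels M h δ B S) {lam : ℝ}
    (hlam : Bounded M h B lam) {rat : ℕ → Fin n → List (WEdge (Fin n)) → ℝ} {X : ℕ → ℝ}
    {x η : ℝ} (hx : 0 ≤ x)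
    (hr0 : ∀ m u H, Adm (Set.Icc (1 - δ) 1) d H → 0 < rat m u H)
    (hr : ∀ m u H, Valid S d W H → Bounded M h (X m) (rat m u H))
    (hX : ∀ m : ℕ, 4 * (m * X m) ≤ 4 * (m * x) + η) (u : Fin n) (H : List (WEdge (Fin n))) :
    ∀ acc, Valid S d W (H ++ acc) →
      Bounded M h (B + deg u H * η + vol H * (2 * B + 34 + 4 * x)) (loop lam rat u H acc) := by
  have hB := hS.two_le
  induction H with
  | nil => intro acc _; simpa [loop, deg, vol] using hlam
  | cons e H ih =>
    intro acc hv
    rw [loop, deg_cons, vol_cons]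
    split_ifs with hu
    · obtain ⟨hm, hmW⟩ := hv.length_erase hu
      have hO := hv.tail_pin hS.one_mem false u
      have i := ih _ (hv.rotate_erase hS.one_mem u)
      have p := chain_bounded hh hS (hr0 (e.verts.erase u).length) (hr (e.verts.erase u).length)
        true (e.verts.erase u) _ hO
      have q := chain_bounded hh hS (hr0 (e.verts.erase u).length) (hr (e.verts.erase u).length)
        false (e.verts.erase u) _ hO
      have hb := hv.adm.b_mem e (by simp)
      have hg := hv.adm.g_mem e (by simp)
      have h0 := hO.denominator_ne_zero hS (hr0 (e.verts.erase u).length) hb false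
        (e.verts.erase u)
      have f := factor_bounded hh (hS.bounded _ hb) (hS.bounded _ hg) p q h0
      refine (f.mul hh i).mono ?_
      rw [hm]
      push_cast
      have hXm := hX (e.verts.erase u).length
      have hm0 : (0 : ℝ) ≤ (e.verts.erase u).length := Nat.cast_nonneg _
      nlinarith [mul_nonneg hm0 (by linarith : 0 ≤ B)]
    · refine (ih _ hv.rotate).mono ?_
      push_cast
      nlinarith [Nat.cast_nonneg (α := ℝ) e.verts.length]

/-- The growth rate of the heights in the budget. -/
noncomputable def growth (B : ℝ) (W : ℕ) : ℝ := 2 * (W * (6 * B + 34))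

theorem approx_bounded (hh : IsHeight M h) (hS : Labels M h δ B S) {lam : ℝ} (hl : 0 < lam)
    (hlam : Bounded M h B lam) {C : ℕ} (hC : 8 * d + 1 ≤ C) (k : ℕ) :
    ∀ (N : ℝ) (u : Fin n) (H : List (WEdge (Fin n))), 0 < N → Valid S d W H →
      Bounded M h (B + growth B W * N) (approx C lam k N u H) := by
  have hB := hS.two_le
  have hg : 0 ≤ growth B W := by unfold growth; positivity
  have hC' : 8 * (d : ℝ) + 1 ≤ C := by exact_mod_cast hC
  have hd0 : (0 : ℝ) ≤ d := Nat.cast_nonneg _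
  have hC0 : (0 : ℝ) < C := by linarith
  induction k with
  | zero =>
    intro N u H hN _
    exact hlam.mono (by nlinarith [mul_nonneg hg hN.le])
  | succ k ih =>
    intro N u H hN hv
    rw [approx]
    split_ifs with hlt
    · exact hlam.mono (by nlinarith [mul_nonneg hg hN.le])
    · refine (loop_bounded hh hS hlam (rat := fun m => approx C lam k (N / (C * (m + 1))))
        (X := fun m => B + growth B W * (N / (C * (m + 1)))) (x := B)
        (η := 4 * (growth B W * N / C)) (by linarith)
        (fun m u H h => (approx_pos_and_log hl hS.delta_le hS.delta_nonneg k _ u H h).1)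
        (fun m u H h => ih _ u H (by positivity) h) (fun m => ?_) u H [] (by simpa using hv)).mono ?_
      · have hm0 : (0 : ℝ) ≤ m := Nat.cast_nonneg _
        have e : (m : ℝ) * (B + growth B W * (N / (C * (m + 1)))) =
            m * B + growth B W * N / C * (m / (m + 1)) := by
          field_simp
        have : (m : ℝ) / (m + 1) ≤ 1 := by rw [div_le_one (by positivity)]; linarith
        rw [e]
        have h3 : 0 ≤ growth B W * N / C := by positivity
        nlinarith
      · have hdeg : (deg u H : ℝ) ≤ d := by exact_mod_cast hv.adm.deg_le u
        have hvol : (vol H : ℝ) ≤ W := by exact_mod_cast hv.vol_le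
        have h3 : 0 ≤ growth B W * N / C := by positivity
        have h4 : growth B W * N / C * C = growth B W * N := by field_simp
        -- The children share half of the bound because `C ≥ 8 d`; the volume term takes the other
        -- half because `N ≥ 1`.
        have h5 : (deg u H : ℝ) * (4 * (growth B W * N / C)) ≤ growth B W * N / 2 := by
          nlinarith
        have h6 : (vol H : ℝ) * (2 * B + 34 + 4 * B) ≤ growth B W / 2 := by
          unfold growth
          nlinarith
        have h7 : 1 ≤ N := not_lt.1 hlt
        nlinarith

/-! ## The functions that recurse through ratios -/

variable {C K T : ℕ} {Y : ℝ}

theorem ev_bern (hh : IsHeight M h) {P : Program} {ρ : List Val} {s : Bool} {r X : ℝ}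
    (hr : 0 < r) (hX : Bounded M h X r) (hY : X + 3 ≤ Y) {i : ℕ} (hs : ρ[i]? = some (encS s))
    (h0 : ρ[0]? = some (.num r)) :
    Ev M P Y ρ (.split (.var i)
          (.arith .div (.var 2) (.arith .add (.const 1) (.var 2)))
          (.arith .div (.const 1) (.arith .add (.const 1) (.var 0)))) (.num (bern s r)) 10 := by
  have hX0 := bounded_nonneg hX
  have o := (Bounded.one hh).mono (by linarith : (2 : ℝ) ≤ Y)
  have hX' := hX.mono (by linarith : X ≤ Y)
  have a := ((Bounded.one hh).add hh hX).mono (by linarith : 2 + X + 1 ≤ Y)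
  have h1 : 1 + r ≠ 0 := by positivity
  cases s
  · exact (Ev.split_nil (Ev.var hs) (Ev.arith (o := .div) hh Ev.one (Ev.arith (o := .add) (z := 1 + r) hh Ev.one
      (Ev.var h0) o hX' rfl) o a ⟨h1, rfl⟩)).mono (by norm_num)
  · have h2 : (Val.nil :: Val.nil :: ρ)[2]? = some (.num r) := by simpa using h0
    exact (Ev.split (Ev.var hs) (Ev.arith (o := .div) hh (Ev.var h2) (Ev.arith (o := .add) (z := 1 + r) hh Ev.one
      (Ev.var h2) o hX' rfl) hX' a ⟨h1, rfl⟩)).mono (by norm_num)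

/-- The mutual recursion is cut at the ratio calls: `hcall` assumes them to be correct within `R`
steps and is discharged by induction on depth in `fn_approx`. -/
theorem fn_chain (hh : IsHeight M h) (hS : Labels M h δ B S)
    {rat : Fin n → List (WEdge (Fin n)) → ℝ} {X R : ℝ} {c : Val}
    (hr0 : ∀ u H, Adm (Set.Icc (1 - δ) 1) d H → 0 < rat u H)
    (hr : ∀ u H, Valid S d W H → Bounded M h X (rat u H))
    (hcall : ∀ u H, Valid S d W H → Fn M (program C K T) Y 6
      (.pair c (.pair (encV u) (encH H))) (.num (rat u H)) R)
    (hn : (n : ℝ) + 3 ≤ Y) (s : Bool) (l : List (Fin n))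
    (hY : (l.length + 1) * (2 * X + 7) + 2 ≤ Y) :
    ∀ H, Valid S d W H →
      Fn M (program C K T) Y 4 (.pair (encS s) (.pair c (.pair (encH H) (encL l))))
        (.num (chain rat s H l)) (20 + l.length * (100 * (W + 1) + 60 + R)) := by
  induction l with
  | nil =>
    intro H _
    refine ⟨_, rfl, Ev.mono (k := 20) ?_ (by simp)⟩
    exact (Ev.split (Ev.var rfl) (Ev.split (Ev.var rfl) (Ev.split (Ev.var rfl)
      (Ev.split_nil (Ev.var rfl) Ev.one)))).mono (by norm_num)
  | cons u l ih =>
    intro H hv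
    have hr1 := hr u H hv
    have hp := hr0 u H (hv.adm_Icc hS)
    have hX0 := bounded_nonneg hr1
    have hl0 : (0 : ℝ) ≤ l.length := Nat.cast_nonneg _
    rw [List.length_cons] at hY ⊢
    push_cast at hY ⊢
    have hv' := hv.pin hS.one_mem s u
    have i := ih (by nlinarith) _ hv'
    have hpin := fn_pin (C := C) (K := K) (T := T) hh hn s u H []
    rw [List.append_nil] at hpin
    have hvol : (vol H : ℝ) ≤ W := by exact_mod_cast hv.vol_le
    have hb := chain_bounded hh hS hr0 hr s l _ hv'
    refine ⟨_, rfl, Ev.split (Ev.var rfl) (Ev.split (Ev.var rfl) (Ev.split (Ev.var rfl)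
      (Ev.split (Ev.var rfl) (Ev.letIn (Ev.call (Ev.pair (Ev.var rfl) (Ev.pair (Ev.var rfl)
        (Ev.var rfl))) (hcall u H hv))
        (Ev.arith (o := .mul) hh (ev_bern hh hp hr1 (by nlinarith) rfl rfl)
          (Ev.call (Ev.pair (Ev.var rfl) (Ev.pair (Ev.var rfl) (Ev.pair (Ev.call (Ev.pair (Ev.var rfl)
            (Ev.pair (Ev.var rfl) (Ev.pair (Ev.var rfl) Ev.nil))) hpin) (Ev.var rfl)))) i)
          ((bern_bounded hh s hp hr1).mono (by nlinarith)) (hb.mono (by nlinarith)) rfl))))) |>.mono ?_⟩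
    nlinarith

/-- The accounting of `loop_bounded` with steps in place of heights: two chains make `2 m` calls at
cost `R m`, split by `hR` into a volume part and `η` per hyperedge at `u`. -/
theorem fn_loop (hh : IsHeight M h) (hS : Labels M h δ B S) {lam N : ℝ}
    (hlam : Bounded M h B lam) {rat : ℕ → Fin n → List (WEdge (Fin n)) → ℝ} {X A w η : ℝ}
    {R : ℕ → ℝ} (hX0 : 0 ≤ X) (hw : 0 ≤ w) (hC : C ≠ 0)
    (hr0 : ∀ m u H, Adm (Set.Icc (1 - δ) 1) d H → 0 < rat m u H)
    (hr : ∀ m u H, Valid S d W H → Bounded M h X (rat m u H))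
    (hcall : ∀ m ≤ W, ∀ u H, Valid S d W H → Fn M (program C K T) Y 6
      (.pair (.pair (.num lam) (.num (N / (C * (m + 1))))) (.pair (encV u) (encH H)))
      (.num (rat m u H)) (R m))
    (hR : ∀ m ≤ W, 2 * (m * R m) ≤ 2 * (m * w) + η)
    (hN : Bounded M h A N) (hA : A ≤ Y) (hCY : C + W + 6 ≤ Y)
    (hn : (n : ℝ) + 3 ≤ Y) (hY : B + (W + 2) * (2 * B + 34 + 4 * X) ≤ Y)
    (u : Fin n) (H : List (WEdge (Fin n))) :
    ∀ acc, Valid S d W (H ++ acc) → Fn M (program C K T) Y 5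
      (.pair (.pair (.num lam) (.num N)) (.pair (encV u) (.pair (encH H) (encH acc))))
      (.num (loop lam rat u H acc))
      (20 + deg u H * η + vol H * (600 + 300 * (W + 1) + 2 * w)) := by
  have hB := hS.two_le
  have hW0 : (0 : ℝ) ≤ W := Nat.cast_nonneg _
  induction H with
  | nil =>
    intro acc _
    refine ⟨_, rfl, Ev.mono (k := 20) ?_ (by simp [deg, vol])⟩
    exact (Ev.split (Ev.var rfl) (Ev.split (Ev.var rfl) (Ev.split (Ev.var rfl)
      (Ev.split_nil (Ev.var rfl) (Ev.split (Ev.var rfl) (Ev.var rfl)))))).mono (by norm_num)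
  | cons e H ih =>
    intro acc hv
    have hs := fn_strip (C := C) (K := K) (T := T) hh hn u e.verts
    rw [loop, deg_cons, vol_cons]
    by_cases hu : u ∈ e.verts
    · obtain ⟨hm, hmW⟩ := hv.length_erase hu
      have e1 : encStrip u e.verts = .pair .nil (encL (e.verts.erase u)) := by simp [encStrip, hu]
      rw [e1] at hs
      rw [if_pos hu]
      have hA' := hv.rotate_erase hS.one_mem u
      have hO := hv.tail_pin hS.one_mem false u
      have i := ih _ hA'
      have ib := loop_bounded hh hS hlam (X := fun _ => X) (x := X) (η := 0) hX0 hr0 hr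
        (fun m => by simp) u H _ hA'
      have hpin := fn_pin (C := C) (K := K) (T := T) hh hn false u H acc
      have hvolH : (vol H : ℝ) ≤ W := by
        have := hv.vol_le
        rw [List.cons_append, vol_cons, vol_append] at this
        exact_mod_cast (by omega : vol H ≤ W)
      rw [hm] at hs ⊢
      have hb := hv.adm.b_mem e (by simp)
      have hg := hv.adm.g_mem e (by simp)
      generalize hl : e.verts.erase u = l at *
      have hlW : (l.length : ℝ) + 2 ≤ W := by exact_mod_cast hmW
      have hl0 : (0 : ℝ) ≤ l.length := Nat.cast_nonneg _
      have hlen := fn_len (C := C) (K := K) (T := T) (Y := Y) hh l (by linarith)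
      have p1 : l.length * (2 * X + 7) ≤ W * (2 * X + 7) :=
        mul_le_mul_of_nonneg_right (by linarith) (by linarith)
      have p2 : (0 : ℝ) ≤ W * B := mul_nonneg hW0 (by linarith)
      have p3 : (0 : ℝ) ≤ W * X := mul_nonneg hW0 hX0
      have p4 : vol H * (2 * B + 34 + 4 * X) ≤ W * (2 * B + 34 + 4 * X) :=
        mul_le_mul_of_nonneg_right hvolH (by linarith)
      have c1 := fn_chain hh hS (hr0 l.length) (hr l.length) (hcall l.length (by omega)) hn true l
        (by nlinarith) _ hO
      have c0 := fn_chain hh hS (hr0 l.length) (hr l.length) (hcall l.length (by omega)) hn false l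
        (by nlinarith) _ hO
      have b1 := chain_bounded hh hS (hr0 l.length) (hr l.length) true l _ hO
      have b0 := chain_bounded hh hS (hr0 l.length) (hr l.length) false l _ hO
      have hne := hO.denominator_ne_zero hS (hr0 l.length) hb false l
      have bb := hS.bounded _ hb
      have bg := hS.bounded _ hg
      have o := Bounded.one hh
      have oY := o.mono (by nlinarith : (2 : ℝ) ≤ Y)
      have g1 := o.sub hh bg
      have g2 := g1.mul hh b1
      have g3 := o.sub hh g2
      have k1 := o.sub hh bb
      have k2 := k1.mul hh b0
      have k3 := o.sub hh k2
      have f := factor_bounded hh bb bg b1 b0 hne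
      have bC := Bounded.nat hh C
      have bl := (Bounded.nat hh (l.length + 1))
      push_cast at bl
      have bCl := bC.mul hh bl
      have hCl : (C : ℝ) * (l.length + 1) ≠ 0 := by
        have : (C : ℝ) ≠ 0 := by exact_mod_cast hC
        positivity
      refine ⟨_, rfl, Ev.split (Ev.var rfl) (Ev.split (Ev.var rfl) (Ev.split (Ev.var rfl)
        (Ev.split (Ev.var rfl) (Ev.split (Ev.var rfl) (Ev.split (Ev.var rfl)
        (Ev.split (Ev.call (Ev.pair (Ev.var rfl) (Ev.var rfl)) hs)
        (Ev.letIn (Ev.call (Ev.pair Ev.nil (Ev.pair (Ev.var rfl) (Ev.pair (Ev.var rfl)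
          (Ev.var rfl)))) hpin)
        (Ev.split (Ev.var rfl)
        (Ev.letIn (Ev.pair (Ev.var rfl) (Ev.arith (o := .div) hh (Ev.var rfl)
          (Ev.arith (o := .mul) hh (Ev.nat C) (Ev.call (Ev.var rfl) hlen)
            (bC.mono (by linarith)) (bl.mono (by linarith)) rfl)
          (hN.mono hA) (bCl.mono (by linarith)) ⟨hCl, rfl⟩))
        (Ev.arith (o := .mul) hh
          (Ev.arith (o := .div) hh
            (Ev.arith (o := .sub) hh Ev.one (Ev.arith (o := .mul) hh
              (Ev.arith (o := .sub) hh Ev.one (Ev.var rfl) oY (bg.mono (by nlinarith)) rfl)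
              (Ev.call (Ev.pair (Ev.pair Ev.nil Ev.nil) (Ev.pair (Ev.var rfl) (Ev.pair (Ev.var rfl)
                (Ev.var rfl)))) c1) (g1.mono (by nlinarith)) (b1.mono (by nlinarith)) rfl)
              oY (g2.mono (by nlinarith)) rfl)
            (Ev.arith (o := .sub) hh Ev.one (Ev.arith (o := .mul) hh
              (Ev.arith (o := .sub) hh Ev.one (Ev.var rfl) oY (bb.mono (by nlinarith)) rfl)
              (Ev.call (Ev.pair Ev.nil (Ev.pair (Ev.var rfl) (Ev.pair (Ev.var rfl)
                (Ev.var rfl)))) c0) (k1.mono (by nlinarith)) (b0.mono (by nlinarith)) rfl)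
              oY (k2.mono (by nlinarith)) rfl)
            (g3.mono (by nlinarith)) (k3.mono (by nlinarith)) ⟨hne, rfl⟩)
          (Ev.call (Ev.pair (Ev.var rfl) (Ev.pair (Ev.var rfl) (Ev.pair (Ev.var rfl)
            (Ev.pair (Ev.pair Ev.one (Ev.pair (Ev.var rfl) (Ev.var rfl))) (Ev.var rfl))))) i)
          (f.mono (by nlinarith)) (ib.mono (by nlinarith)) rfl)))))))))) |>.mono ?_⟩
      have hRl := hR l.length (by omega)
      simp only [hu, if_true]
      push_cast
      nlinarith [mul_nonneg hl0 hW0, mul_nonneg hl0 hw]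
    · have e1 : encStrip u e.verts = .nil := by simp [encStrip, hu]
      rw [e1] at hs
      rw [if_neg hu]
      have i := ih _ hv.rotate
      refine ⟨_, rfl, Ev.split (Ev.var rfl) (Ev.split (Ev.var rfl) (Ev.split (Ev.var rfl)
        (Ev.split (Ev.var rfl) (Ev.split (Ev.var rfl) (Ev.split (Ev.var rfl)
        (Ev.split_nil (Ev.call (Ev.pair (Ev.var rfl) (Ev.var rfl)) hs)
          (Ev.call (Ev.pair (Ev.var rfl) (Ev.pair (Ev.var rfl) (Ev.pair (Ev.var rfl)
            (Ev.pair (Ev.var rfl) (Ev.var rfl))))) i))))))) |>.mono ?_⟩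
      simp only [hu, if_false]
      push_cast
      have hl0 : (0 : ℝ) ≤ e.verts.length := Nat.cast_nonneg _
      nlinarith [mul_nonneg hl0 hW0, mul_nonneg hl0 hw]

end Scheme

/-! ### Running time of the ratio recursion, the telescoping product and the power. -/

namespace Scheme

open Hyp

variable {n : ℕ} {M : CostModel} {h : ℝ → ℕ} {δ B : ℝ} {S : Set ℝ} {d W C K T : ℕ} {Y : ℝ}

/-- The number of steps per unit of budget. -/
noncomputable def rate (W : ℕ) : ℝ := 2 * (30 + W * (660 + 300 * (W + 1)))

theorem ev_ratio_leaf (hh : IsHeight M h) {lam N : ℝ} (hN1 : N < 1) (hN : Bounded M h Y N)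
    (hY : 2 ≤ Y) (u : Fin n) (H : List (WEdge (Fin n))) :
    Fn M (program C K T) Y 6 (.pair (.pair (.num lam) (.num N)) (.pair (encV u) (encH H)))
      (.num lam) 30 :=
  ⟨_, rfl, (Ev.split (Ev.var rfl) (Ev.split (Ev.var rfl) (Ev.split (Ev.var rfl)
    (Ev.ifLt_true hh (Ev.var rfl) Ev.one hN ((Bounded.one hh).mono hY) hN1 (Ev.var rfl))))).mono
    (by norm_num)⟩

/-- Work is linear in the budget because the `m` calls of a chain get `N / (C (m + 1))` each and so
at most `N / C` together, whatever the size of the hyperedge. The budget itself gains height at most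
`C + W + 6` per division, hence the reserve `k * (C + W + 6)` below `A`. -/
theorem fn_approx (hh : IsHeight M h) (hS : Labels M h δ B S) {lam N₀ A : ℝ} (hl : 0 < lam)
    (hlam : Bounded M h B lam) (hC : 8 * d + 1 ≤ C) (hC2 : 2 ≤ C) (hA : A ≤ Y) (hCY : C + W + 6 ≤ Y)
    (hn : (n : ℝ) + 3 ≤ Y) (hN₀ : 0 ≤ N₀)
    (hY : B + (W + 2) * (2 * B + 34 + 4 * (B + growth B W * N₀)) ≤ Y) (k : ℕ) :
    ∀ (N : ℝ) (u : Fin n) (H : List (WEdge (Fin n))), 0 < N → N < 2 ^ k → N ≤ N₀ →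
      Bounded M h (A - k * (C + W + 6)) N → Valid S d W H →
      Fn M (program C K T) Y 6 (.pair (.pair (.num lam) (.num N)) (.pair (encV u) (encH H)))
        (.num (approx C lam k N u H)) (30 + rate W * N) := by
  have hB := hS.two_le
  have hW0 : (0 : ℝ) ≤ W := Nat.cast_nonneg _
  have hr0 : 0 ≤ rate W := by unfold rate; positivity
  have hg : 0 ≤ growth B W := by unfold growth; positivity
  have hC' : 8 * (d : ℝ) + 1 ≤ C := by exact_mod_cast hC
  have hd0 : (0 : ℝ) ≤ d := Nat.cast_nonneg _
  have hC0 : (0 : ℝ) < C := by linarith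
  have hY2 : 2 ≤ Y := by linarith [Nat.cast_nonneg (α := ℝ) n]
  have leaf : ∀ (k : ℕ) (N : ℝ) (u : Fin n) (H : List (WEdge (Fin n))), 0 < N → N < 1 →
      Bounded M h (A - k * (C + W + 6)) N →
      Fn M (program C K T) Y 6 (.pair (.pair (.num lam) (.num N)) (.pair (encV u) (encH H)))
        (.num lam) (30 + rate W * N) := by
    intro k N u H hN hN1 hb
    have : 0 ≤ (k : ℝ) * (C + W + 6) := by positivity
    exact (ev_ratio_leaf hh hN1 (hb.mono (by linarith)) hY2 u H).mono
      (by linarith [mul_nonneg hr0 hN.le])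
  induction k with
  | zero =>
    intro N u H hN hN1 _ hb _
    exact leaf 0 N u H hN (by simpa using hN1) hb
  | succ k ih =>
    intro N u H hN hN1 hNN hb hv
    rw [approx]
    split_ifs with hlt
    · exact leaf (k + 1) N u H hN hlt hb
    · push_cast at hb
      have hk0 : 0 ≤ (k : ℝ) * (C + W + 6) := by positivity
      have hbY : Bounded M h Y N := hb.mono (by linarith)
      have hchild : ∀ m : ℕ, N / (C * (m + 1)) ≤ N := by
        intro m
        have hm0 : (0 : ℝ) ≤ m := Nat.cast_nonneg m
        exact div_le_self hN.le (by nlinarith)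
      have hC2' : (2 : ℝ) ≤ C := by exact_mod_cast hC2
      have hloop := fn_loop (C := C) (K := K) (T := T) (Y := Y) hh hS hlam (N := N)
        (rat := fun m => approx C lam k (N / (C * (m + 1))))
        (X := B + growth B W * N₀) (A := Y) (w := 30) (η := 2 * (rate W * N / C))
        (R := fun m => 30 + rate W * (N / (C * (m + 1))))
        (by positivity) (by norm_num) (by rintro rfl; simp at hC0)
        (fun m u H h => (approx_pos_and_log hl hS.delta_le hS.delta_nonneg k _ u H h).1)
        (fun m u H h => (approx_bounded hh hS hl hlam hC k _ u H (by positivity) h).mono (by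
          have := mul_le_mul_of_nonneg_left ((hchild m).trans hNN) hg
          linarith))
        (fun m hm u H h => ih _ u H (by positivity) (by
          have hm0 : (0 : ℝ) ≤ m := Nat.cast_nonneg m
          rw [div_lt_iff₀ (by positivity)]
          rw [pow_succ] at hN1
          have : (2 : ℝ) ≤ C * (m + 1) := by nlinarith
          have := mul_le_mul_of_nonneg_left this (pow_nonneg zero_le_two k : (0 : ℝ) ≤ 2 ^ k)
          linarith) ((hchild m).trans hNN) (by
          have hmW : (m : ℝ) ≤ W := by exact_mod_cast hm
          have b1 := Bounded.nat hh (m + 1)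
          push_cast at b1
          exact (hb.div hh ((Bounded.nat hh C).mul hh b1) (by positivity)).mono
            (by linarith)) h)
        (fun m _ => by
          have hm0 : (0 : ℝ) ≤ m := Nat.cast_nonneg m
          have e : (m : ℝ) * (30 + rate W * (N / (C * (m + 1)))) =
              m * 30 + rate W * N / C * (m / (m + 1)) := by
            field_simp
          have : (m : ℝ) / (m + 1) ≤ 1 := by rw [div_le_one (by positivity)]; linarith
          rw [e]
          have h3 : 0 ≤ rate W * N / C := by positivity
          nlinarith)
        hbY le_rfl hCY hn hY u H [] (by simpa using hv)
      refine ⟨_, rfl, (Ev.split (Ev.var rfl) (Ev.split (Ev.var rfl) (Ev.split (Ev.var rfl)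
        (Ev.ifLt_false hh (Ev.var rfl) Ev.one hbY ((Bounded.one hh).mono hY2) hlt
          (Ev.call (Ev.pair (Ev.var rfl) (Ev.pair (Ev.var rfl) (Ev.pair (Ev.var rfl) Ev.nil)))
            hloop))))).mono ?_⟩
      have hdeg : (deg u H : ℝ) ≤ d := by exact_mod_cast hv.adm.deg_le u
      have hvol : (vol H : ℝ) ≤ W := by exact_mod_cast hv.vol_le
      have h3 : 0 ≤ rate W * N / C := by positivity
      have h4 : rate W * N / C * C = rate W * N := by field_simp
      -- Again `C ≥ 8 d` leaves room for the local work, which is paid by `N ≥ 1`.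
      have h5 : (deg u H : ℝ) * (2 * (rate W * N / C)) ≤ rate W * N / 4 := by nlinarith
      have h6 : (vol H : ℝ) * (600 + 300 * (W + 1) + 2 * 30) ≤ rate W / 2 - 30 := by
        unfold rate
        nlinarith
      have h7 : 1 ≤ N := not_lt.1 hlt
      have h8 : 60 ≤ rate W := by
        unfold rate
        nlinarith [mul_nonneg hW0 hW0]
      nlinarith

/-- The vertices below `i`, in decreasing order. -/
def below (n : ℕ) : (i : ℕ) → i ≤ n → List (Fin n)
  | 0, _ => []
  | i + 1, hi => ⟨i, hi⟩ :: below n i (Nat.le_of_succ_le hi)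

theorem mem_below (i : ℕ) : ∀ hi : i ≤ n, ∀ v : Fin n, v ∈ below n i hi ↔ (v : ℕ) < i := by
  induction i with
  | zero => intro hi v; simp [below]
  | succ i ih =>
    intro hi v
    rw [below, List.mem_cons, ih, Fin.ext_iff]
    dsimp only
    omega

theorem nodup_below (i : ℕ) : ∀ hi : i ≤ n, (below n i hi).Nodup := by
  induction i with
  | zero => intro hi; simp [below]
  | succ i ih =>
    intro hi
    rw [below, List.nodup_cons, mem_below]
    exact ⟨by simp, ih _⟩

theorem length_below (i : ℕ) : ∀ hi : i ≤ n, (below n i hi).length = i := by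
  induction i with
  | zero => intro hi; rfl
  | succ i ih => intro hi; rw [below, List.length_cons, ih]

theorem fn_telescope (hh : IsHeight M h) (h1 : (1 : ℝ) ∈ S)
    {rat : Fin n → List (WEdge (Fin n)) → ℝ} {X R : ℝ} {c : Val} (hX : 0 ≤ X)
    (hr : ∀ u H, Valid S d W H → Bounded M h X (rat u H))
    (hcall : ∀ u H, Valid S d W H → Fn M (program C K T) Y 6
      (.pair c (.pair (encV u) (encH H))) (.num (rat u H)) R)
    (hn : (n : ℝ) + 3 ≤ Y) (hY : (n + 1) * (X + 4) ≤ Y) (i : ℕ) :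
    ∀ (hi : i ≤ n) (H : List (WEdge (Fin n))), Valid S d W H →
      Bounded M h (i * (X + 4) + 2) (telescope rat H (below n i hi)) ∧
      Fn M (program C K T) Y 7 (.pair c (.pair (.num i) (encH H)))
        (.num (telescope rat H (below n i hi))) (20 + i * (100 * (W + 1) + 60 + R)) := by
  have o := Bounded.one hh
  have hn0 : (0 : ℝ) ≤ n := Nat.cast_nonneg _
  have z : Bounded M h Y 0 := by
    have := (Bounded.nat hh 0).mono (B := Y) (by push_cast; linarith)
    simpa using this
  induction i with
  | zero =>
    intro hi H _
    simp only [below, telescope]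
    refine ⟨by simpa using o, ⟨_, rfl, Ev.mono (k := 20) ?_ (by simp)⟩⟩
    simp only [Nat.cast_zero]
    exact (Ev.split (Ev.var rfl) (Ev.split (Ev.var rfl) (Ev.ifLt_false hh Ev.zero (Ev.var rfl) z z
      (lt_irrefl _) Ev.one))).mono (by norm_num)
  | succ i ih =>
    intro hi H hv
    obtain ⟨b, f⟩ := ih (Nat.le_of_succ_le hi) _ (hv.pin h1 false ⟨i, hi⟩)
    have hin : (i : ℝ) + 1 ≤ n := by exact_mod_cast hi
    have bi : Bounded M h Y ((i + 1 : ℕ) : ℝ) :=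
      (Bounded.nat hh (i + 1)).mono (by push_cast; linarith)
    have br := hr ⟨i, hi⟩ H hv
    have ba := o.add hh br
    have hpin := fn_pin (C := C) (K := K) (T := T) hh hn false ⟨i, hi⟩ H []
    rw [List.append_nil] at hpin
    have hvol : (vol H : ℝ) ≤ W := by exact_mod_cast hv.vol_le
    have hi0 : (0 : ℝ) ≤ i := Nat.cast_nonneg _
    rw [below, telescope]
    refine ⟨(ba.mul hh b).mono (by push_cast; linarith), ⟨_, rfl, (Ev.split (Ev.var rfl)
      (Ev.split (Ev.var rfl) (Ev.ifLt_true hh Ev.zero (Ev.var rfl) z bi (by positivity)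
        (Ev.letIn (Ev.arith (o := .sub) (z := ((i : ℕ) : ℝ)) hh (Ev.var rfl) Ev.one bi
          (o.mono (by linarith)) (by simp [ArithOp.Result]))
          (Ev.arith (o := .mul) hh (Ev.arith (o := .add) hh Ev.one
            (Ev.call (Ev.pair (Ev.var rfl) (Ev.pair (Ev.var rfl) (Ev.var rfl)))
              (hcall ⟨i, hi⟩ H hv)) (o.mono (by linarith)) (br.mono (by nlinarith)) rfl)
            (Ev.call (Ev.pair (Ev.var rfl) (Ev.pair (Ev.var rfl) (Ev.call (Ev.pair Ev.nil
              (Ev.pair (Ev.var rfl) (Ev.pair (Ev.var rfl) Ev.nil))) hpin))) f)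
            (ba.mono (by nlinarith)) (b.mono (by nlinarith)) rfl))))).mono ?_⟩⟩
    push_cast
    nlinarith

theorem ev_pow (hh : IsHeight M h) {P : Program} {ρ : List Val} {x X : ℝ}
    (hx : Bounded M h X x) (h0 : ρ[0]? = some (.num x)) (T : ℕ)
    (hY : (T + 1) * (X + 1) + 2 ≤ Y) :
    Bounded M h (T * (X + 1) + 2) (x ^ T) ∧ Ev M P Y ρ (powCode T) (.num (x ^ T)) (2 * T + 1) := by
  have hX := bounded_nonneg hx
  induction T with
  | zero => simpa using ⟨Bounded.one hh, Ev.one⟩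
  | succ T ih =>
    push_cast at hY
    have hT : (0 : ℝ) ≤ T := Nat.cast_nonneg _
    obtain ⟨b, e⟩ := ih (by nlinarith)
    rw [pow_succ']
    refine ⟨(hx.mul hh b).mono (by push_cast; linarith), (Ev.arith (o := .mul) hh (Ev.var h0) e
      (hx.mono (by nlinarith)) (b.mono (by nlinarith)) rfl).mono (by push_cast; linarith)⟩

end Scheme

/-! ### Heights for the two cost models. -/

namespace Scheme

theorem isHeight_realCost : IsHeight realCost fun _ => 1 where
  size_le := by intro x _; simp [realCost]
  le_size := by intro x _; simp [realCost]
  nat_mem := by intro n; simp [realCost]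
  nat_le := by intro n; simp
  result := by intro o x y z _ _ _; simp [realCost]

/-- The larger one of the binary lengths of numerator and denominator. -/
def ratHeight (q : ℚ) : ℕ := max q.num.natAbs.size q.den.size

theorem lt_two_pow_ratHeight_num (q : ℚ) : q.num.natAbs < 2 ^ ratHeight q :=
  Nat.size_le.1 (le_max_left _ _)

theorem lt_two_pow_ratHeight_den (q : ℚ) : q.den < 2 ^ ratHeight q :=
  Nat.size_le.1 (le_max_right _ _)

/-- Cancellation can only shorten numerator and denominator, so any representing fraction bounds the
height. -/
theorem ratHeight_le {a b : ℤ} {m : ℕ} (hb : b ≠ 0) (ha : a.natAbs < 2 ^ m)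
    (hbm : b.natAbs < 2 ^ m) : ratHeight ((a : ℚ) / b) ≤ m := by
  rw [← Rat.divInt_eq_div]
  refine max_le (Nat.size_le.2 ?_) (Nat.size_le.2 ?_)
  · refine lt_of_le_of_lt ?_ ha
    by_cases h0 : a = 0
    · simp [h0]
    · exact Nat.le_of_dvd (Int.natAbs_pos.2 h0) (Int.natAbs_dvd_natAbs.2 (Rat.num_dvd a hb))
  · refine lt_of_le_of_lt ?_ hbm
    have := Int.natAbs_dvd_natAbs.2 (Rat.den_dvd a b)
    exact Nat.le_of_dvd (Int.natAbs_pos.2 hb) (by simpa using this)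

theorem mul_lt_two_pow {a b m k : ℕ} (ha : a < 2 ^ m) (hb : b < 2 ^ k) : a * b < 2 ^ (m + k) := by
  rw [pow_add]
  exact Nat.mul_lt_mul'' ha hb

theorem ratHeight_mul_le (p q : ℚ) : ratHeight (p * q) ≤ ratHeight p + ratHeight q := by
  have e : p * q = ((p.num * q.num : ℤ) : ℚ) / ((p.den * q.den : ℤ) : ℚ) := by
    conv_lhs => rw [← Rat.num_div_den p, ← Rat.num_div_den q]
    push_cast
    rw [div_mul_div_comm]
  rw [e]
  refine ratHeight_le ?_ ?_ ?_
  · exact_mod_cast (Nat.mul_pos p.den_pos q.den_pos).ne'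
  · rw [Int.natAbs_mul]
    exact mul_lt_two_pow (lt_two_pow_ratHeight_num p) (lt_two_pow_ratHeight_num q)
  · rw [Int.natAbs_mul]
    exact mul_lt_two_pow (lt_two_pow_ratHeight_den p) (lt_two_pow_ratHeight_den q)

theorem ratHeight_inv_le (q : ℚ) : ratHeight q⁻¹ ≤ max (ratHeight q) 1 := by
  by_cases h : q = 0
  · subst h
    simp [ratHeight]
  · have e : q⁻¹ = ((q.den : ℤ) : ℚ) / (q.num : ℚ) := by
      conv_lhs => rw [← Rat.num_div_den q]
      rw [inv_div]
      rfl
    rw [e]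
    have := lt_two_pow_ratHeight_den q
    exact (ratHeight_le (Rat.num_ne_zero.2 h) (by simpa using this)
      (lt_two_pow_ratHeight_num q)).trans (le_max_left _ _)

theorem one_le_ratHeight (q : ℚ) : 1 ≤ ratHeight q :=
  (Nat.size_pos.2 q.den_pos).trans_le (le_max_right _ _)

theorem ratHeight_neg (q : ℚ) : ratHeight (-q) = ratHeight q := by simp [ratHeight]

theorem ratHeight_add_le (p q : ℚ) : ratHeight (p + q) ≤ ratHeight p + ratHeight q + 1 := by
  have hp : (p.den : ℚ) ≠ 0 := by exact_mod_cast p.den_pos.ne'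
  have hq : (q.den : ℚ) ≠ 0 := by exact_mod_cast q.den_pos.ne'
  have e : p + q = ((p.num * q.den + p.den * q.num : ℤ) : ℚ) / ((p.den * q.den : ℤ) : ℚ) := by
    conv_lhs => rw [← Rat.num_div_den p, ← Rat.num_div_den q]
    push_cast
    rw [div_add_div _ _ hp hq]
  rw [e]
  have a := mul_lt_two_pow (lt_two_pow_ratHeight_num p) (lt_two_pow_ratHeight_den q)
  have b := mul_lt_two_pow (lt_two_pow_ratHeight_den p) (lt_two_pow_ratHeight_num q)
  have c := mul_lt_two_pow (lt_two_pow_ratHeight_den p) (lt_two_pow_ratHeight_den q)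
  refine ratHeight_le ?_ ?_ ?_
  · exact_mod_cast (Nat.mul_pos p.den_pos q.den_pos).ne'
  · have h1 := Int.natAbs_add_le (p.num * q.den) (p.den * q.num)
    rw [Int.natAbs_mul, Int.natAbs_mul, Int.natAbs_natCast, Int.natAbs_natCast] at h1
    rw [pow_succ]
    omega
  · rw [Int.natAbs_mul, Int.natAbs_natCast, Int.natAbs_natCast, pow_succ]
    omega

theorem ratHeight_nat_le (n : ℕ) : ratHeight n ≤ n + 1 := by
  have h1 : n < 2 ^ (n + 1) := Nat.lt_two_pow_self.trans (Nat.pow_lt_pow_right (by norm_num) (by simp))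
  have := ratHeight_le (a := n) (b := 1) (m := n + 1) (by norm_num) (by simpa using h1) (by
    have := Nat.lt_two_pow_self (n := n + 1)
    simp only [Int.natAbs_one]
    omega)
  simpa using this

/-- The height of a rational number, as a function of real numbers. -/
noncomputable def realHeight (x : ℝ) : ℕ := sInf {m : ℕ | ∃ q : ℚ, (q : ℝ) = x ∧ m = ratHeight q}

theorem realHeight_cast (q : ℚ) : realHeight (q : ℝ) = ratHeight q := by
  have : {m : ℕ | ∃ p : ℚ, (p : ℝ) = (q : ℝ) ∧ m = ratHeight p} = {ratHeight q} := by
    ext m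
    constructor
    · rintro ⟨p, hp, rfl⟩
      rw [Rat.cast_inj.1 hp]
      rfl
    · rintro rfl
      exact ⟨q, rfl, rfl⟩
  rw [realHeight, this, csInf_singleton]

theorem bitLength_cast (q : ℚ) : bitLength (q : ℝ) = q.num.natAbs.size + q.den.size := by
  have : {m : ℕ | ∃ p : ℚ, (p : ℝ) = (q : ℝ) ∧ m = p.num.natAbs.size + p.den.size} =
      {q.num.natAbs.size + q.den.size} := by
    ext m
    constructor
    · rintro ⟨p, hp, rfl⟩
      rw [Rat.cast_inj.1 hp]
      rfl
    · rintro rfl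
      exact ⟨q, rfl, rfl⟩
  rw [bitLength, this, csInf_singleton]

/-- The height is the maximum of the two lengths rather than their sum: cross-multiplying in a sum
uses each denominator twice, which the maximum absorbs with additive growth. -/
theorem isHeight_bitCost : IsHeight bitCost realHeight where
  size_le := by
    rintro x ⟨q, rfl⟩
    simp only [realHeight_cast, bitCost, bitLength_cast, ratHeight]
    omega
  le_size := by
    rintro x ⟨q, rfl⟩
    simp only [realHeight_cast, bitCost, bitLength_cast, ratHeight]
    omega
  nat_mem := fun n => ⟨n, by simp⟩
  nat_le := by
    intro n
    have := realHeight_cast n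
    rw [Rat.cast_natCast] at this
    rw [this]
    exact ratHeight_nat_le n
  result := by
    rintro o x y z ⟨p, rfl⟩ ⟨q, rfl⟩ hz
    dsimp only at hz ⊢
    rw [realHeight_cast, realHeight_cast]
    cases o
    · obtain rfl : z = ((p + q : ℚ) : ℝ) := by rw [Rat.cast_add]; exact hz
      exact ⟨⟨_, rfl⟩, by rw [realHeight_cast]; exact ratHeight_add_le p q⟩
    · obtain rfl : z = ((p + -q : ℚ) : ℝ) := by
        rw [Rat.cast_add, Rat.cast_neg, ← sub_eq_add_neg]; exact hz
      refine ⟨⟨_, rfl⟩, ?_⟩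
      rw [realHeight_cast]
      exact (ratHeight_add_le p (-q)).trans_eq (by rw [ratHeight_neg])
    · obtain rfl : z = ((p * q : ℚ) : ℝ) := by rw [Rat.cast_mul]; exact hz
      exact ⟨⟨_, rfl⟩, by rw [realHeight_cast]; exact (ratHeight_mul_le p q).trans (Nat.le_succ _)⟩
    · obtain rfl : z = ((p * q⁻¹ : ℚ) : ℝ) := by
        rw [Rat.cast_mul, Rat.cast_inv, ← div_eq_mul_inv]; exact hz.2
      refine ⟨⟨_, rfl⟩, ?_⟩
      rw [realHeight_cast]
      have a := ratHeight_mul_le p q⁻¹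
      have b := ratHeight_inv_le q
      have c := one_le_ratHeight q
      rw [max_eq_left c] at b
      omega

end Scheme

/-! ### Polynomial bounds and the assembled scheme. -/

namespace Scheme

open Hyp

/-- `F` is nonnegative and polynomially bounded on `[1, ∞)`. -/
def PolyBounded (F : ℝ → ℝ) : Prop :=
  ∃ C k : ℕ, ∀ s : ℝ, 1 ≤ s → 0 ≤ F s ∧ F s ≤ C * s ^ k

namespace PolyBounded

variable {F G : ℝ → ℝ}

theorem const {c : ℝ} (hc : 0 ≤ c) : PolyBounded fun _ => c := by
  refine ⟨⌈c⌉₊, 0, fun s _ => ⟨hc, ?_⟩⟩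
  rw [pow_zero, mul_one]
  exact Nat.le_ceil c

theorem id : PolyBounded fun s => s :=
  ⟨1, 1, fun s hs => ⟨by linarith, by simp⟩⟩

theorem add (hF : PolyBounded F) (hG : PolyBounded G) : PolyBounded fun s => F s + G s := by
  obtain ⟨C, k, h⟩ := hF
  obtain ⟨D, l, g⟩ := hG
  refine ⟨C + D, max k l, fun s hs => ⟨add_nonneg (h s hs).1 (g s hs).1, ?_⟩⟩
  have h1 : (C : ℝ) * s ^ k ≤ C * s ^ max k l := by
    gcongr
    exact le_max_left k l
  have h2 : (D : ℝ) * s ^ l ≤ D * s ^ max k l := by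
    gcongr
    exact le_max_right k l
  push_cast
  linarith [(h s hs).2, (g s hs).2]

theorem mul (hF : PolyBounded F) (hG : PolyBounded G) : PolyBounded fun s => F s * G s := by
  obtain ⟨C, k, h⟩ := hF
  obtain ⟨D, l, g⟩ := hG
  refine ⟨C * D, k + l, fun s hs => ⟨mul_nonneg (h s hs).1 (g s hs).1, ?_⟩⟩
  calc F s * G s ≤ (C * s ^ k) * (D * s ^ l) :=
        mul_le_mul (h s hs).2 (g s hs).2 (g s hs).1 (by positivity)
    _ = _ := by push_cast; ring

theorem pow (hF : PolyBounded F) (T : ℕ) : PolyBounded fun s => F s ^ T := by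
  induction T with
  | zero => simpa using const zero_le_one
  | succ T ih => simpa only [pow_succ] using ih.mul hF

end PolyBounded

/-! ## Bounds for a whole run, as functions of the size parameter `s` -/

noncomputable def heightBound (b s : ℝ) : ℝ := s + b

noncomputable def budgetBound (K T : ℕ) (s : ℝ) : ℝ := (K * (s + 1) * s) ^ T

noncomputable def ratioBound (K T : ℕ) (b s : ℝ) : ℝ :=
  heightBound b s + 2 * (s * (6 * heightBound b s + 34)) * budgetBound K T s

noncomputable def depthBound (C K T : ℕ) (s : ℝ) : ℝ :=
  T * (2 * s + K + 8) + 2 + (budgetBound K T s + 1) * (C + s + 6)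

noncomputable def sizeBound (C K T : ℕ) (b s : ℝ) : ℝ :=
  depthBound C K T s + (C + s + 6) + (s + 3) +
    (heightBound b s + (s + 2) * (2 * heightBound b s + 34 + 4 * ratioBound K T b s)) +
    ((s + 1) * (ratioBound K T b s + 4) + 2) + ((T + 1) * (2 * s + K + 8) + 2) +
    (s * (heightBound b s + 1) + 2) + (2 * s + 2 * K + 20)

noncomputable def stepBound (K T : ℕ) (s : ℝ) : ℝ :=
  100 + 2 * T + 10 * (s + 1) +
    s * (100 * (s + 1) + 60 + (30 + 2 * (30 + s * (660 + 300 * (s + 1))) * budgetBound K T s))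

theorem polyBounded_total (C K T : ℕ) {b : ℝ} (hb : 0 ≤ b) :
    PolyBounded fun s => (4 * sizeBound C K T b s + 1) * stepBound K T s := by
  have c : ∀ {x : ℝ}, 0 ≤ x → PolyBounded fun _ => x := PolyBounded.const
  have i := PolyBounded.id
  have n : ∀ m : ℕ, PolyBounded fun _ => (m : ℝ) := fun m => c (Nat.cast_nonneg m)
  have hB : PolyBounded (heightBound b) := i.add (c hb)
  have hN : PolyBounded (budgetBound K T) := (((n K).mul (i.add (c zero_le_one))).mul i).pow T
  have hX : PolyBounded (ratioBound K T b) :=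
    hB.add (((c (by norm_num : (0 : ℝ) ≤ 2)).mul (i.mul
      (((c (by norm_num : (0 : ℝ) ≤ 6)).mul hB).add (c (by norm_num : (0 : ℝ) ≤ 34))))).mul hN)
  have hA : PolyBounded fun s : ℝ => 2 * s + K + 8 :=
    (((c zero_le_two).mul i).add (n K)).add (c (by norm_num))
  have hC : PolyBounded fun s : ℝ => C + s + 6 := ((n C).add i).add (c (by norm_num))
  have hD : PolyBounded (depthBound C K T) :=
    (((n T).mul hA).add (c zero_le_two)).add ((hN.add (c zero_le_one)).mul hC)
  have hY : PolyBounded (sizeBound C K T b) :=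
    ((((((hD.add hC).add (i.add (c (by norm_num)))).add
      (hB.add ((i.add (c zero_le_two)).mul ((((c zero_le_two).mul hB).add (c (by norm_num))).add
        ((c (by norm_num : (0 : ℝ) ≤ 4)).mul hX))))).add
      (((i.add (c zero_le_one)).mul (hX.add (c (by norm_num)))).add (c zero_le_two))).add
      ((((n T).add (c zero_le_one)).mul hA).add (c zero_le_two))).add
      ((i.mul (hB.add (c zero_le_one))).add (c zero_le_two))).add
      ((((c zero_le_two).mul i).add ((c zero_le_two).mul (n K))).add (c (by norm_num)))
  have hS : PolyBounded (stepBound K T) :=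
    (((c (by norm_num)).add ((c zero_le_two).mul (n T))).add
      ((c (by norm_num : (0 : ℝ) ≤ 10)).mul (i.add (c zero_le_one)))).add
      (i.mul ((((c (by norm_num : (0 : ℝ) ≤ 100)).mul (i.add (c zero_le_one))).add
        (c (by norm_num))).add ((c (by norm_num)).add (((c zero_le_two).mul ((c (by norm_num)).add
          (i.mul ((c (by norm_num)).add ((c (by norm_num : (0 : ℝ) ≤ 300)).mul
            (i.add (c zero_le_one))))))).mul hN))))
  exact (((c (by norm_num : (0 : ℝ) ≤ 4)).mul hY).add (c zero_le_one)).mul hS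

variable {n : ℕ} {M : CostModel} {h : ℝ → ℕ}

theorem vol_ofSystem_le (M : CostModel) {G : SpinSystem (Fin n)} {L : List (List (Fin n))}
    (hL : Lists G L) : vol (ofSystem G L) + n ≤ SpinSystem.inputSize M G := by
  have e : vol (ofSystem G L) = ∑ e ∈ G.edges, (1 + #e) := by
    rw [← hL.edges_eq, List.sum_toFinset _ hL.nodup_edges, vol, ofSystem, List.map_map,
      List.map_map]
    congr 1
    refine List.map_congr_left fun l hl => ?_
    simp [List.toFinset_card_of_nodup (hL.nodup_verts l hl)]
  rw [e, SpinSystem.inputSize, add_comm]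
  refine Nat.add_le_add_left (Finset.sum_le_sum fun e _ => ?_) n
  omega

theorem label_size_le {G : SpinSystem (Fin n)} {e : Finset (Fin n)} (he : e ∈ G.edges) :
    M.size (G.β e) ≤ SpinSystem.inputSize M G ∧ M.size (G.γ e) ≤ SpinSystem.inputSize M G := by
  have := Finset.single_le_sum (f := fun e => 1 + #e + M.size (G.β e) + M.size (G.γ e))
    (fun _ _ => Nat.zero_le _) he
  unfold SpinSystem.inputSize
  constructor <;> omega

theorem length_le_vol (H : List (WEdge (Fin n))) : H.length ≤ vol H := by
  induction H with
  | nil => simp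
  | cons e H ih => rw [vol_cons, List.length_cons]; omega

theorem run (hh : IsHeight M h) {lam ε s b : ℝ} {D T : ℕ} (hl : 0 < lam)
    (hlam : lam ∈ M.carrier) (hε : 0 < ε) (hεM : ε ∈ M.carrier) {G : SpinSystem (Fin n)}
    (hG : G.maxDegree ≤ D) (hG' : G.LabelsInRange)
    (hM : ∀ e ∈ G.edges, G.β e ∈ M.carrier ∧ G.γ e ∈ M.carrier)
    {L : List (List (Fin n))} (hL : Lists G L) (hs : 1 ≤ s)
    (hI : (SpinSystem.inputSize M G : ℝ) ≤ s) (hεs : (M.size ε : ℝ) ≤ s) (hεs' : 1 / ε ≤ s)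
    (hb : (M.size lam : ℝ) + 2 ≤ b) :
    ∃ k : ℕ, budget D T n ε < 2 ^ k ∧
      Ev M (program (8 * D + 8) (4 * D + 1) T)
        (sizeBound (8 * D + 8) (4 * D + 1) T b s)
        [.pair (.num lam) (.pair (.num ε) (.pair (.num n) (encH (ofSystem G L))))]
        (.call 0 (.var 0))
        (.num (bprod (ofSystem G L) * telescope
          (approx (8 * D + 8 : ℕ) lam k (budget D T n ε)) (ofSystem G L) (below n n le_rfl)))
        (stepBound (4 * D + 1) T s) := by
  set C := 8 * D + 8 with hC
  set K := 4 * D + 1 with hK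
  set Y := sizeBound C K T b s with hY
  set W := SpinSystem.inputSize M G with hW
  set B := heightBound b s with hB
  set δ := slack G.maxDegree
  -- Pinning introduces only the label 1, so this set is closed under everything the recursion does
  -- and labels never grow.
  set S : Set ℝ := {x | x ∈ Set.Icc (1 - δ) 1 ∧ Bounded M h B x} with hS
  have hb0 : (0 : ℝ) ≤ M.size lam := Nat.cast_nonneg _
  have hB2 : 2 ≤ B := by rw [hB, heightBound]; linarith
  have hδ0 : 0 < δ := slack_pos _
  have hLab : Labels M h δ B S :=
    ⟨⟨⟨by linarith, le_rfl⟩, (Bounded.one hh).mono hB2⟩, fun x hx => hx.1, fun x hx => hx.2,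
      hδ0.le, slack_le _, hB2⟩
  have hlamB : Bounded M h B lam := by
    refine ⟨hlam, ?_⟩
    have : (h lam : ℝ) ≤ M.size lam := by exact_mod_cast hh.le_size lam hlam
    rw [hB, heightBound]
    linarith
  have hε' : Bounded M h s ε := by
    refine ⟨hεM, ?_⟩
    have : (h ε : ℝ) ≤ M.size ε := by exact_mod_cast hh.le_size ε hεM
    linarith
  have hlabel : ∀ x ∈ M.carrier, M.size x ≤ W → Bounded M h B x := by
    intro x hx hxW
    refine ⟨hx, ?_⟩
    have : (h x : ℝ) ≤ W := by exact_mod_cast (hh.le_size x hx).trans hxW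
    rw [hB, heightBound]
    linarith
  have hadm : Adm S G.maxDegree (ofSystem G L) := hL.adm le_rfl fun e he =>
    ⟨⟨(hG' e he).1, hlabel _ (hM e he).1 (label_size_le he).1⟩,
      ⟨(hG' e he).2, hlabel _ (hM e he).2 (label_size_le he).2⟩⟩
  have hvolW := vol_ofSystem_le M hL
  have hv : Valid S G.maxDegree W (ofSystem G L) := ⟨hadm, by omega⟩
  have hnW : (n : ℝ) ≤ W := by exact_mod_cast (by omega : n ≤ W)
  have hns : (n : ℝ) ≤ s := hnW.trans hI
  have hn0 : (0 : ℝ) ≤ n := Nat.cast_nonneg _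
  have hW0 : (0 : ℝ) ≤ W := Nat.cast_nonneg _
  have hC0 : (0 : ℝ) ≤ C := Nat.cast_nonneg _
  have hK0 : (0 : ℝ) ≤ K := Nat.cast_nonneg _
  have hT0 : (0 : ℝ) ≤ T := Nat.cast_nonneg _
  -- the budget
  set N := budget D T n ε with hN
  set Nb := budgetBound K T s with hNb
  have hX0 : 0 ≤ (K : ℝ) * ((n : ℝ) + 1) / ε := by positivity
  have hNN : N ≤ Nb := by
    rw [hN, budget, hNb, budgetBound]
    refine pow_le_pow_left₀ hX0 ?_ T
    rw [div_eq_mul_one_div]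
    gcongr
  have hNpos : 0 < N := by rw [hN, budget]; positivity
  have hNb0 : 0 ≤ Nb := hNpos.le.trans hNN
  -- the parts of the size bound
  set X := ratioBound K T b s with hX
  have hgr : 0 ≤ growth B W := by unfold growth; positivity
  have hXg : B + growth B W * Nb ≤ X := by
    rw [hX, ratioBound, ← hB, ← hNb, growth]
    gcongr
  have hXB : 0 ≤ X := le_trans (by positivity) hXg
  have p1 : 0 ≤ depthBound C K T s := by unfold depthBound; positivity
  have p2 : 0 ≤ (s + 2) * (2 * B + 34 + 4 * X) := by positivity
  have p3 : 0 ≤ (s + 1) * (X + 4) := by positivity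
  have p4 : 0 ≤ ((T : ℝ) + 1) * (2 * s + K + 8) := by positivity
  have p5 : 0 ≤ s * (B + 1) := by positivity
  have hYe : Y = depthBound C K T s + (C + s + 6) + (s + 3) + (B + (s + 2) * (2 * B + 34 + 4 * X)) +
    ((s + 1) * (X + 4) + 2) + ((T + 1) * (2 * s + K + 8) + 2) + (s * (B + 1) + 2) +
    (2 * s + 2 * K + 20) := rfl
  have hnY : (n : ℝ) + 3 ≤ Y := by linarith
  -- the recursion depth
  refine ⟨⌈N⌉₊, (Nat.le_ceil N).trans_lt (by exact_mod_cast Nat.lt_two_pow_self), ?_⟩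
  have hk : (⌈N⌉₊ : ℝ) ≤ Nb + 1 := (Nat.ceil_lt_add_one hNpos.le).le.trans (by linarith)
  have o := Bounded.one hh
  have bn := Bounded.nat hh n
  have bK := Bounded.nat hh K
  have b1 := bn.add hh o
  have b2 := bK.mul hh b1
  have b3 := (b2.div hh hε' hε.ne').mono (by linarith : _ ≤ 2 * s + K + 7)
  obtain ⟨b4, e4⟩ := ev_pow (Y := Y) (P := program C K T) (ρ := .num ((K : ℝ) * (n + 1) / ε) ::
    [.num n, encH (ofSystem G L), .num ε, .pair (.num n) (encH (ofSystem G L)), .num lam,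
      .pair (.num ε) (.pair (.num n) (encH (ofSystem G L))),
      .pair (.num lam) (.pair (.num ε) (.pair (.num n) (encH (ofSystem G L))))])
    hh b3 rfl T (by linarith)
  have hcall : ∀ (u : Fin n) (H : List (WEdge (Fin n))), Valid S G.maxDegree W H → Fn M (program C K T) Y 6
      (.pair (.pair (.num lam) (.num N)) (.pair (encV u) (encH H)))
      (.num (approx C lam ⌈N⌉₊ N u H)) (30 + rate W * N) := by
    intro u H hH
    refine fn_approx hh hLab (N₀ := Nb) (A := depthBound C K T s) hl hlamB (by omega) (by omega)
      (by linarith) (by linarith) hnY hNb0 ?_ ⌈N⌉₊ N u H hNpos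
      ((Nat.le_ceil N).trans_lt (by exact_mod_cast Nat.lt_two_pow_self)) hNN (b4.mono ?_) hH
    · have : (W + 2) * (2 * B + 34 + 4 * (B + growth B W * Nb)) ≤
          (s + 2) * (2 * B + 34 + 4 * X) := by gcongr
      linarith
    · have : (⌈N⌉₊ : ℝ) * (C + W + 6) ≤ (Nb + 1) * (C + s + 6) := by gcongr
      rw [depthBound, ← hNb]
      linarith
  obtain ⟨b5, e5⟩ := fn_telescope (C := C) (K := K) (T := T) (Y := Y) hh hLab.one_mem hXB
    (fun u H hH => (approx_bounded hh hLab hl hlamB (by omega : 8 * G.maxDegree + 1 ≤ C) ⌈N⌉₊ N u H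
      hNpos hH).mono ((add_le_add_right (mul_le_mul_of_nonneg_left hNN hgr) B).trans hXg))
    hcall hnY (by
      have : ((n : ℝ) + 1) * (X + 4) ≤ (s + 1) * (X + 4) := by gcongr
      linarith) n le_rfl _ hv
  have hlen : ((ofSystem G L).length : ℝ) ≤ s := by
    refine le_trans ?_ hI
    have := length_le_vol (ofSystem G L)
    exact_mod_cast (by omega : (ofSystem G L).length ≤ W)
  have hlen' : ((ofSystem G L).length : ℝ) * (B + 1) ≤ s * (B + 1) := by gcongr
  obtain ⟨e6, b6⟩ := fn_bprod (C := C) (K := K) (T := T) (Y := Y) hh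
    (fun x hx => hLab.bounded x hx) (by linarith : 0 ≤ B) (ofSystem G L) hadm.b_mem (by linarith)
  have p6 : (n : ℝ) * (X + 4) ≤ s * (X + 4) := by gcongr
  refine (Ev.call (Ev.var rfl) ⟨_, rfl, Ev.split (Ev.var rfl) (Ev.split (Ev.var rfl)
    (Ev.split (Ev.var rfl) (Ev.letIn (Ev.arith (o := .div) hh
      (Ev.arith (o := .mul) hh (Ev.nat K) (Ev.arith (o := .add) hh (Ev.var rfl) Ev.one
        (bn.mono (by linarith)) (o.mono (by linarith)) rfl) (bK.mono (by linarith))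
        (b1.mono (by linarith)) rfl) (Ev.var rfl) (b2.mono (by linarith)) (hε'.mono (by linarith))
      ⟨hε.ne', rfl⟩) (Ev.letIn e4 (Ev.arith (o := .mul) hh (Ev.call (Ev.var rfl) e6)
        (Ev.call (Ev.pair (Ev.pair (Ev.var rfl) (Ev.var rfl)) (Ev.pair (Ev.var rfl) (Ev.var rfl)))
          e5) (b6.mono (by linarith)) (b5.mono (by linarith)) rfl)))))⟩).mono ?_
  have q1 : (n : ℝ) * (100 * (W + 1) + 60 + (30 + rate W * N)) ≤
      s * (100 * (s + 1) + 60 + (30 + 2 * (30 + s * (660 + 300 * (s + 1))) * Nb)) := by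
    unfold rate
    gcongr
  unfold stepBound
  linarith

/-- The program is a fully polynomial-time approximation scheme in every model of cost that has a
height. -/
theorem isFPTAS (hh : IsHeight M h) {lam : ℝ} (hl : 0 < lam) {D T : ℕ} (hT : 0 < T)
    (hcontr : ∀ d ≤ D, ∀ m : ℕ, d * (slack d / (1 - slack d) *
      min (Real.exp (-1 / 2))
        (2 * (m * Real.sigmoid (|Real.log lam| + D * Real.log 3) ^ m))) *
      (((8 * D + 8 : ℕ) : ℝ) * (m + 1)) ^ (1 / (T : ℝ)) ≤ 1) :
    SpinSystem.IsFPTAS M (program (8 * D + 8) (4 * D + 1) T) lam (SpinSystem.boundedClass D) := by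
  -- The size of `lam` is not part of the instance size, so it enters the constants. The multiplier
  -- `8 D + 8` exceeds both 2 and `8 d + 1`.
  obtain ⟨Q, k, hQ⟩ := polyBounded_total (8 * D + 8) (4 * D + 1) T
    (b := (M.size lam : ℝ) + 2) (by positivity)
  refine ⟨Q, k, ?_⟩
  rintro n G ε x ⟨hG, hG'⟩ hlam hεM hM hε hε1 ⟨L, hL1, hL2, hL3, rfl⟩
  have hL : Lists G L := ⟨hL1, hL2, hL3⟩
  set s : ℝ := ((G.inputSize M + M.size ε : ℕ) : ℝ) + 1 / ε with hs
  have h1ε : 1 ≤ 1 / ε := by rw [le_div_iff₀ hε]; linarith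
  have hI0 : (0 : ℝ) ≤ G.inputSize M := Nat.cast_nonneg _
  have hE0 : (0 : ℝ) ≤ M.size ε := Nat.cast_nonneg _
  push_cast at hs
  have hs1 : 1 ≤ s := by linarith
  obtain ⟨k', hk', t, ht, ht'⟩ := run (T := T) (s := s) hh hl hlam hε hεM hG hG' hM hL hs1
    (by linarith) (by linarith) (by linarith) le_rfl
  rw [encH_ofSystem] at ht
  refine ⟨_, t, ht, ?_, ?_⟩
  · have hlen := length_below (n := n) n le_rfl
    have := accuracy (V := Fin n) (C := ((8 * D + 8 : ℕ) : ℝ)) (l := below n n le_rfl) (k := k') hl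
      (by push_cast; linarith [Nat.cast_nonneg (α := ℝ) D]) hT hcontr hG hG' hL
      (nodup_below n le_rfl) (fun v => (mem_below n le_rfl v).2 v.2) hε hε1 (by rwa [hlen])
    rwa [hlen] at this
  · obtain ⟨-, hle⟩ := hQ s hs1
    refine ht'.trans (le_trans (le_of_eq ?_) hle)
    rw [abs_of_nonneg]
    unfold sizeBound depthBound ratioBound heightBound budgetBound
    positivity

end Scheme

/-- For every external field `lam > 0` and every degree bound `D` there is one program that is an
FPTAS for the partition function, both for real parameters with unit-cost arithmetic and for
rational parameters with bit cost. -/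
theorem theorem3 (lam : ℝ) (hlam : 0 < lam) (D : ℕ) :
    ∃ P : Program,
      SpinSystem.IsFPTAS realCost P lam (SpinSystem.boundedClass D) ∧
      SpinSystem.IsFPTAS bitCost P lam (SpinSystem.boundedClass D) := by
  -- The program depends on `lam` only through the natural number `T`, which is the same for both
  -- cost models.
  obtain ⟨T, hT, hcontr⟩ := Hyp.exists_exponent (lam := lam) (C := ((8 * D + 8 : ℕ) : ℝ)) D
    (by push_cast; linarith [Nat.cast_nonneg (α := ℝ) D])
  exact ⟨_, Scheme.isFPTAS Scheme.isHeight_realCost hlam hT hcontr,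
    Scheme.isFPTAS Scheme.isHeight_bitCost hlam hT hcontr⟩
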